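/- Let $p$ be a prime, $F/\mathbb{Q}_p$ a finite extension with ring of integers $\mathcal{O}$, uniformizer $\pi$, residue field $\mathbb{F}_q$, ramification index $e$ and inertia degree $f$ (so $q=p^f$), and let $\overline{\mathbb{F}}_p$ be an algebraic closure of $\mathbb{F}_q$. Put $G=\mathrm{GL}_2(F)$, $K=\mathrm{GL}_2(\mathcal{O})$, let $Z$ be the centre of $G$, let $I\subset K$ be the Iwahori subgroup (matrices upper triangular modulo $\pi$) and $I(1)\subset I$ its pro-$p$ part (matrices upper triangular unipotent modulo $\pi$). For $w\ge 0$ and $\vec s=(s_0,\dots,s_{f-1})\in\mathbb{Z}_{\ge 0}^f$ let $\sigma_{w,\vec s}=\det^w\otimes\bigotimes_{j=0}^{f-1}\mathrm{Sym}_j^{s_j}\overline{\mathbb{F}}_p^2$ be the representation of $KZ$ in which $K$ acts through $\mathrm{GL}_2(\mathbb{F}_q)$ on polynomials that are homogeneous of degree $s_j$ in each pair $x_j,y_j$, by $$\begin{pmatrix}a&b\\c&d\end{pmatrix}\bigotimes_j x_j^{s_j-i_j}y_j^{i_j}=(ad-bc)^w\bigotimes_j (a^{p^j}x_j+c^{p^j}y_j)^{s_j-i_j}(b^{p^j}x_j+d^{p^j}y_j)^{i_j},$$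 and the scalar matrix $\pi$ acts trivially. Let $\sigma=\sigma_{w,\vec r}$ with $2<r_j<p-3$ for all $j$, and let $\mathrm{ind}_{KZ}^G\sigma$ be the space of functions $\varphi:G\to\sigma$ with $\varphi(hg)=\sigma(h)\varphi(g)$ for $h\in KZ$ that are supported on finitely many cosets $KZg$, with $G$ acting by right translation. For $g\in G$ and $v\in\sigma$ let $g\otimes v$ be the function supported on $KZg^{-1}$ with $(g\otimes v)(x)=\sigma(xg)v$ there. For $n\ge1$ let $I_n=\{\sum_{i=0}^{n-1}\pi^i[\mu_i]:\mu_i\in\mathbb{F}_q\}$, where $[\cdot]$ is the Teichmüller lift, and for $\vec 0\le\vec k\le\vec r$ (componentwise) put $$t_n^{\vec k}=\sum_{\mu\in I_n}\begin{pmatrix}\pi^n&\mu\\0&1\end{pmatrix}\otimes\bigotimes_{j=0}^{f-1}x_j^{r_j-k_j}y_j^{k_j}\in\mathrm{ind}_{KZ}^G\sigma .$$ Assume that $e>1$ and $0\le k_j\le\lfloor r_j/2\rfloor-1$ for all $0\le j\le f-1$. Let $M_{\vec k}$ be the $G$-subrepresentation of $\mathrm{ind}_{KZ}^G\sigma$ generated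 by all $t_l^{\vec i}$ with $l\ge1$, $\vec 0\le\vec i\le\vec k$ and $\vec i\ne\vec k$. Then for every $n\ge1$ the image of $t_n^{\vec k}$ in $\mathrm{ind}_{KZ}^G\sigma/M_{\vec k}$ is nonzero, is an eigenvector for $I$ (that is, $I$ acts on it through a character $I\to\overline{\mathbb{F}}_p^\times$), and is in particular $I(1)$-invariant. The $KZ$-subrepresentation that it generates is irreducible and isomorphic to $\sigma_{w+k,\,\vec r-2\vec k}=\det^{w+k}\otimes\bigotimes_{j=0}^{f-1}\mathrm{Sym}_j^{r_j-2k_j}\overline{\mathbb{F}}_p^2$, where $k=\sum_{j=0}^{f-1}k_jp^j$; for $w=0$ this is $\det^k\otimes\bigotimes_j\mathrm{Sym}_j^{r_j-2k_j}\overline{\mathbb{F}}_p^2$. -/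

import Mathlib

namespace GL2ModP

/-! ### The ring of integers of a finite extension of `ℚ_p` -/

section LocalField
variable (p : ℕ) [Fact p.Prime] (F : Type*) [Field F] [Algebra ℚ_[p] F]
  [FiniteDimensional ℚ_[p] F] [Algebra ℤ_[p] F] [IsScalarTower ℤ_[p] ℚ_[p] F]

/-- An element of `F` is integral over `ℤ_p` if and only if its spectral norm is at most one. -/
theorem isIntegral_iff_spectralNorm_le_one (x : F) :
    IsIntegral ℤ_[p] x ↔ spectralNorm ℚ_[p] F x ≤ 1 := by
  have hx : IsIntegral ℚ_[p] x := Algebra.IsIntegral.isIntegral x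
  rw [spectralNorm, spectralValue_le_one_iff (minpoly.monic hx)]
  constructor
  · intro h n
    rw [minpoly.isIntegrallyClosed_eq_field_fractions' ℚ_[p] h, Polynomial.coeff_map]
    exact PadicInt.norm_le_one _
  · intro h
    have hl : minpoly ℚ_[p] x ∈ Polynomial.lifts (algebraMap ℤ_[p] ℚ_[p]) := by
      rw [Polynomial.lifts_iff_coeff_lifts]
      intro n
      exact ⟨⟨_, h n⟩, rfl⟩
    obtain ⟨P, hP, -, hm⟩ := Polynomial.lifts_and_degree_eq_and_monic hl (minpoly.monic hx)
    refine ⟨P, hm, ?_⟩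
    have : Polynomial.aeval x (P.map (algebraMap ℤ_[p] ℚ_[p])) = 0 := by
      rw [hP]; exact minpoly.aeval _ _
    rwa [Polynomial.aeval_map_algebraMap, Polynomial.aeval_def] at this

/-- The ring of integers of a finite extension of `ℚ_p` is local. -/
instance isLocalRing_integralClosure : IsLocalRing (integralClosure ℤ_[p] F) := by
  have hu : ∀ x : integralClosure ℤ_[p] F,
      IsUnit x ↔ spectralMulAlgNorm ℚ_[p] F (x : F) = 1 := by
    intro x
    have hx := (isIntegral_iff_spectralNorm_le_one p F (x : F)).1 x.2
    rw [← spectralMulAlgNorm_def] at hx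
    constructor
    · rintro ⟨u, rfl⟩
      have hy := (isIntegral_iff_spectralNorm_le_one p F ((u⁻¹ : (integralClosure ℤ_[p] F)ˣ) : integralClosure ℤ_[p] F)).1
        ((u⁻¹ : (integralClosure ℤ_[p] F)ˣ) : integralClosure ℤ_[p] F).2
      rw [← spectralMulAlgNorm_def] at hy
      have h1 : ((u : integralClosure ℤ_[p] F) : F) *
          ((u⁻¹ : (integralClosure ℤ_[p] F)ˣ) : integralClosure ℤ_[p] F) = 1 := by
        have := congrArg (Subtype.val) u.mul_inv
        exact this
      have h2 := congrArg (spectralMulAlgNorm ℚ_[p] F) h1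
      rw [map_mul, map_one] at h2
      have h3 := apply_nonneg (spectralMulAlgNorm ℚ_[p] F) ((u : integralClosure ℤ_[p] F) : F)
      nlinarith
    · intro h
      have hx0 : (x : F) ≠ 0 := by
        intro h0
        rw [h0, map_zero] at h
        exact zero_ne_one h
      have hi : IsIntegral ℤ_[p] (x : F)⁻¹ := by
        rw [isIntegral_iff_spectralNorm_le_one, ← spectralMulAlgNorm_def]
        have h2 := congrArg (spectralMulAlgNorm ℚ_[p] F) (mul_inv_cancel₀ hx0)
        rw [map_mul, map_one, h, one_mul] at h2
        exact h2.le
      refine IsUnit.of_mul_eq_one ⟨(x : F)⁻¹, hi⟩ (Subtype.ext ?_)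
      exact mul_inv_cancel₀ hx0
  refine IsLocalRing.of_nonunits_add fun a b ha hb => ?_
  rw [mem_nonunits_iff, hu] at *
  have hlt : ∀ x : integralClosure ℤ_[p] F, spectralMulAlgNorm ℚ_[p] F (x : F) ≠ 1 →
      spectralMulAlgNorm ℚ_[p] F (x : F) < 1 := fun x hx =>
    lt_of_le_of_ne ((isIntegral_iff_spectralNorm_le_one p F (x : F)).1 x.2) hx
  have hs : spectralMulAlgNorm ℚ_[p] F ((a : F) + b) ≤ _ :=
    isNonarchimedean_spectralNorm (K := ℚ_[p]) (a : F) (b : F)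
  exact (lt_of_le_of_lt hs (max_lt (hlt a ha) (hlt b hb))).ne

/-- The ring of integers of a finite extension of `ℚ_p` is a discrete valuation ring. -/
instance isDiscreteValuationRing_integralClosure :
    IsDiscreteValuationRing (integralClosure ℤ_[p] F) := by
  have hD : IsDedekindDomain (integralClosure ℤ_[p] F) :=
    integralClosure.isDedekindDomain ℤ_[p] ℚ_[p] F
  have hnf : ¬ IsField (integralClosure ℤ_[p] F) := by
    intro h
    have hinj : Function.Injective (algebraMap ℤ_[p] (integralClosure ℤ_[p] F)) := by
      have : Function.Injective (algebraMap ℤ_[p] F) := by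
        rw [IsScalarTower.algebraMap_eq ℤ_[p] ℚ_[p] F]
        exact (algebraMap ℚ_[p] F).injective.comp (IsFractionRing.injective ℤ_[p] ℚ_[p])
      intro a b hab
      exact this (congrArg Subtype.val hab)
    exact IsDiscreteValuationRing.not_isField ℤ_[p] (isField_of_isIntegral_of_isField hinj h)
  exact ((IsDiscreteValuationRing.TFAE _ hnf).out 0 2).mpr hD

instance isFractionRing_integralClosure : IsFractionRing (integralClosure ℤ_[p] F) F :=
  integralClosure.isFractionRing_of_finite_extension ℚ_[p] F
end LocalField

/-! ### Representation theory of abstract groups -/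

section Abstract
variable {G E V : Type*} [Group G] [Field E] [AddCommGroup V] [Module E V]

/-- The subrepresentation of `ρ` generated by a set of vectors. -/
def generatedBy (ρ : Representation E G V) (S : Set V) : Subrepresentation ρ where
  toSubmodule := Submodule.span E {v | ∃ g : G, ∃ s ∈ S, v = ρ g s}
  apply_mem_toSubmodule g v hv := by
    induction hv using Submodule.span_induction with
    | mem x hx =>
      obtain ⟨h, s, hs, rfl⟩ := hx
      exact Submodule.subset_span ⟨g * h, s, hs, by simp⟩
    | zero => simp
    | add x y _ _ hx hy => rw [map_add]; exact Submodule.add_mem _ hx hy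
    | smul a x _ hx => rw [map_smul]; exact Submodule.smul_mem _ a hx

/-- The quotient of a representation by a subrepresentation. -/
def quotientRep (ρ : Representation E G V) (M : Subrepresentation ρ) :
    Representation E G (V ⧸ M.toSubmodule) :=
  ρ.quotient M.toSubmodule fun g _ hv => M.apply_mem_toSubmodule g hv

variable {H : Subgroup G} (σ : Representation E H V)

/-- The space of the compact induction `ind_H^G σ`: functions `φ : G → V` with
`φ (h g) = σ(h) φ(g)` whose support is contained in finitely many cosets `H s`. -/
def compactIndSpace : Submodule E (G → V) where
  carrier := {φ | (∀ (h : H) (g : G), φ (h * g) = σ h (φ g)) ∧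
    ∃ S : Set G, S.Finite ∧ ∀ g, φ g ≠ 0 → ∃ s ∈ S, g * s⁻¹ ∈ H}
  zero_mem' := ⟨by simp, ∅, Set.finite_empty, by simp⟩
  add_mem' := by
    rintro φ ψ ⟨h₁, S, hS, hS'⟩ ⟨h₂, T, hT, hT'⟩
    refine ⟨fun h g => by simp [h₁, h₂], S ∪ T, hS.union hT, fun g hg => ?_⟩
    by_cases h0 : φ g = 0
    · obtain ⟨s, hs, hs'⟩ := hT' g fun h => hg (by simp [h0, h])
      exact ⟨s, Or.inr hs, hs'⟩
    · obtain ⟨s, hs, hs'⟩ := hS' g h0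
      exact ⟨s, Or.inl hs, hs'⟩
  smul_mem' := by
    rintro c φ ⟨h₁, S, hS, hS'⟩
    refine ⟨fun h g => by simp [h₁], S, hS, fun g hg => hS' g fun h => hg (by simp [h])⟩

/-- The compact induction `ind_H^G σ`, with `G` acting by right translation:
`(g φ)(x) = φ (x g)`. -/
def compactInd : Representation E G (compactIndSpace σ) where
  toFun g :=
    { toFun := fun φ => ⟨fun x => φ.1 (x * g), by
        obtain ⟨φ, h₁, S, hS, hS'⟩ := φ
        refine ⟨fun h x => by simp [mul_assoc, h₁], (· * g⁻¹) '' S, hS.image _, fun x hx => ?_⟩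
        obtain ⟨s, hs, hs'⟩ := hS' _ hx
        exact ⟨_, ⟨s, hs, rfl⟩, by simpa [mul_assoc] using hs'⟩⟩
      map_add' := fun _ _ => rfl
      map_smul' := fun _ _ => rfl }
  map_one' := by ext φ x; simp
  map_mul' a b := by ext φ x; simp [mul_assoc]

open scoped Classical in
/-- The element `g ⊗ v` of `ind_H^G σ`: the function supported on `H g⁻¹` with
`(g ⊗ v)(x) = σ(x g) v` for `x g ∈ H`. -/
noncomputable def compactIndMk (g : G) (v : V) : compactIndSpace σ :=
  ⟨fun x => if hx : x * g ∈ H then σ ⟨x * g, hx⟩ v else 0, by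
    refine ⟨fun h x => ?_, {g⁻¹}, Set.finite_singleton _, fun x hx => ?_⟩
    · by_cases hx : x * g ∈ H
      · have hx' : (h : G) * x * g ∈ H := by
          rw [mul_assoc]; exact H.mul_mem h.2 hx
        beta_reduce
        rw [dif_pos hx, dif_pos hx', ← Module.End.mul_apply, ← map_mul]
        congr 2
        exact Subtype.ext (mul_assoc _ _ _)
      · have hx' : ¬ (h : G) * x * g ∈ H := by
          rw [mul_assoc, H.mul_mem_cancel_left h.2]; exact hx
        beta_reduce
        rw [dif_neg hx, dif_neg hx', map_zero]
    · refine ⟨g⁻¹, rfl, ?_⟩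
      by_contra h
      rw [inv_inv] at h
      exact hx (dif_neg h)⟩

end Abstract

/-! ### The groups -/

section Groups
open scoped MatrixGroups

variable (O : Type*) [CommRing O] [IsDomain O] [IsDiscreteValuationRing O]
  (F : Type*) [Field F] [Algebra O F] [IsFractionRing O F]

/-- The inclusion `GL₂(O) → GL₂(F)`. -/
def toG : GL (Fin 2) O →* GL (Fin 2) F :=
  Matrix.GeneralLinearGroup.map (algebraMap O F)

/-- `K = GL₂(O)` as a subgroup of `G = GL₂(F)`. -/
def subgroupK : Subgroup (GL (Fin 2) F) :=
  (toG O F).range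

/-- `KZ`, with `Z` the centre of `G`. -/
def subgroupKZ : Subgroup (GL (Fin 2) F) := subgroupK O F ⊔ Subgroup.center _

/-- The Iwahori subgroup, inside `GL₂(O)`: matrices which are upper triangular modulo the
maximal ideal. -/
def iwahori : Subgroup (GL (Fin 2) O) where
  carrier := {κ | IsLocalRing.residue O (κ 1 0) = 0}
  one_mem' := by simp
  mul_mem' := by
    intro a b ha hb
    simp only [Set.mem_ofPred_eq] at *
    simp [Matrix.mul_apply, Fin.sum_univ_two, ha, hb]
  inv_mem' := by
    intro a ha
    simp only [Set.mem_ofPred_eq] at *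
    simp [Matrix.inv_def, Matrix.adjugate_fin_two, ha]

/-- The pro-`p` Iwahori subgroup, inside `GL₂(O)`: matrices which are upper triangular unipotent
modulo the maximal ideal. -/
def iwahoriOne : Subgroup (GL (Fin 2) O) where
  carrier := {κ | IsLocalRing.residue O (κ 1 0) = 0 ∧ IsLocalRing.residue O (κ 0 0) = 1 ∧
    IsLocalRing.residue O (κ 1 1) = 1}
  one_mem' := by simp
  mul_mem' := by
    rintro a b ⟨ha, ha', ha''⟩ ⟨hb, hb', hb''⟩
    simp [-IsLocalRing.residue_eq_zero_iff, Matrix.mul_apply, Fin.sum_univ_two, ha, hb, ha', hb', ha'', hb'']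
  inv_mem' := by
    rintro a ⟨ha, ha', ha''⟩
    have hd : IsLocalRing.residue O (Ring.inverse (a : Matrix (Fin 2) (Fin 2) O).det) = 1 := by
      have hu : IsUnit (a : Matrix (Fin 2) (Fin 2) O).det :=
        (Matrix.isUnit_iff_isUnit_det _).1 a.isUnit
      have h1 := congrArg (IsLocalRing.residue O) (Ring.inverse_mul_cancel _ hu)
      rw [map_mul, map_one, Matrix.det_fin_two (a : Matrix (Fin 2) (Fin 2) O)] at h1
      rw [Matrix.det_fin_two (a : Matrix (Fin 2) (Fin 2) O)]
      simpa [ha, ha', ha''] using h1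
    simp [-IsLocalRing.residue_eq_zero_iff, Matrix.inv_def, Matrix.adjugate_fin_two, ha, ha', ha'', hd]

variable {O F}

/-- The image in `GL₂(F)` of the subgroup `J` of `GL₂(O)`. -/
def inG (F : Type*) [Field F] [Algebra O F] (J : Subgroup (GL (Fin 2) O)) :
    Subgroup (GL (Fin 2) F) :=
  J.map (toG O F)

theorem algebraMap_uniformizer_ne_zero (F : Type*) [Field F] [Algebra O F] [IsFractionRing O F]
    {π : O} (hπ : Irreducible π) : algebraMap O F π ≠ 0 := fun h =>
  hπ.ne_zero ((map_eq_zero_iff _ (IsFractionRing.injective O F)).1 h)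

/-- The uniformizer as a unit of `F`. -/
def unif (F : Type*) [Field F] [Algebra O F] [IsFractionRing O F]
    {π : O} (hπ : Irreducible π) : Fˣ :=
  Units.mk0 (algebraMap O F π) (algebraMap_uniformizer_ne_zero F hπ)

/-- The central element of `G` with diagonal entries `z`. -/
def centralG (z : Fˣ) : GL (Fin 2) F := Matrix.GeneralLinearGroup.scalar (Fin 2) z

theorem centralG_mul (z y : Fˣ) : (centralG (z * y)) = centralG z * centralG y :=
  map_mul _ _ _

theorem centralG_one : centralG (1 : Fˣ) = 1 := map_one _

theorem centralG_mul_comm (z : Fˣ) (g : GL (Fin 2) F) : centralG z * g = g * centralG z := by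
  ext i j
  simp [centralG, mul_comm]

theorem det_centralG_mul (z : Fˣ) (g : GL (Fin 2) F) :
    ((centralG z * g : GL (Fin 2) F) : Matrix (Fin 2) (Fin 2) F).det =
      z * z * (g : Matrix (Fin 2) (Fin 2) F).det := by
  simp [centralG, Matrix.det_mul, ← sq]

/-- A power of the uniformizer that is a quotient of two units has exponent zero. -/
theorem unif_zpow_mul_eq {π : O} (hπ : Irreducible π) {j : ℤ} {u u' : O} (hu : IsUnit u)
    (hu' : IsUnit u')
    (h : ((unif F hπ ^ j : Fˣ) : F) * algebraMap O F u = algebraMap O F u') : j = 0 := by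
  have key : ∀ (i : ℕ) (v v' : O), IsUnit v' →
      ((unif F hπ ^ (i : ℤ) : Fˣ) : F) * algebraMap O F v = algebraMap O F v' → i = 0 := by
    intro i v v' hv' hi
    by_contra h0
    have h1 : π ^ i * v = v' := by
      apply IsFractionRing.injective O F
      rw [map_mul, map_pow, ← hi]
      simp [unif]
    rw [← h1] at hv'
    exact hπ.not_isUnit ((isUnit_pow_iff h0).1 (isUnit_of_mul_isUnit_left hv'))
  obtain ⟨i, rfl | rfl⟩ := j.eq_nat_or_neg
  · exact_mod_cast key i u u' hu' h
  · have := key i u' u hu (by rw [← h, ← mul_assoc, ← Units.val_mul, ← _root_.zpow_add]; simp)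
    simp [this]

/-- In a product `π^n κ` with `κ ∈ GL₂(O)`, the factor `κ` is determined. -/
theorem scalar_unif_zpow_unique {π : O} (hπ : Irreducible π) {n m : ℤ} {κ κ' : GL (Fin 2) O}
    (h : centralG (unif F hπ ^ n) *
        toG O F κ =
      centralG (unif F hπ ^ m) *
        toG O F κ') : κ = κ' := by
  have h1 : centralG (unif F hπ ^ (n - m)) *
      toG O F κ = toG O F κ' := by
    have : centralG (unif F hπ ^ m) * (centralG (unif F hπ ^ (n - m)) * toG O F κ) =
        centralG (unif F hπ ^ m) * toG O F κ' := by
      rw [← mul_assoc, ← centralG_mul, ← _root_.zpow_add, add_sub_cancel, h]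
    exact mul_left_cancel this
  have hu : ∀ κ : GL (Fin 2) O, IsUnit (κ : Matrix (Fin 2) (Fin 2) O).det := fun κ =>
    (Matrix.isUnit_iff_isUnit_det _).1 κ.isUnit
  have h2 := congrArg (fun g : GL (Fin 2) F => (g : Matrix (Fin 2) (Fin 2) F).det) h1
  have hd : ∀ κ : GL (Fin 2) O,
      (toG O F κ : Matrix (Fin 2) (Fin 2) F).det =
        algebraMap O F (κ : Matrix (Fin 2) (Fin 2) O).det := fun κ => by
    rw [RingHom.map_det]; rfl
  have h3 : (2 * (n - m) : ℤ) = 0 := by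
    refine unif_zpow_mul_eq (F := F) hπ (hu κ) (hu κ') ?_
    rw [← hd κ, ← hd κ', ← h2, det_centralG_mul, two_mul, _root_.zpow_add, Units.val_mul]
  have h4 : n - m = 0 := by lia
  rw [h4, zpow_zero, centralG_one, one_mul] at h1
  ext i j
  have h5 := congrArg (fun g : GL (Fin 2) F => (g : Matrix (Fin 2) (Fin 2) F) i j) h1
  exact IsFractionRing.injective O F h5

/-- `KZ` consists of the products `π^n κ` with `n ∈ ℤ` and `κ ∈ GL₂(O)`. -/
theorem mem_subgroupKZ_iff {π : O} (hπ : Irreducible π) (g : GL (Fin 2) F) :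
    g ∈ subgroupKZ O F ↔ ∃ (κ : GL (Fin 2) O) (n : ℤ),
      g = centralG (unif F hπ ^ n) *
        toG O F κ := by
  rw [subgroupKZ, Subgroup.mem_sup_of_normal_right, Matrix.GeneralLinearGroup.center_eq_range_scalar]
  constructor
  · rintro ⟨_, ⟨κ, rfl⟩, _, ⟨z, rfl⟩, rfl⟩
    obtain ⟨a, b, hb, hab⟩ := IsFractionRing.div_surjective (A := O) (z : F)
    have hb0 : b ≠ 0 := nonZeroDivisors.ne_zero hb
    have ha0 : a ≠ 0 := by
      rintro rfl
      exact z.ne_zero (by rw [← hab]; simp)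
    obtain ⟨i, u, rfl⟩ := IsDiscreteValuationRing.eq_unit_mul_pow_irreducible ha0 hπ
    obtain ⟨j, v, rfl⟩ := IsDiscreteValuationRing.eq_unit_mul_pow_irreducible hb0 hπ
    have hz : z = unif F hπ ^ ((i : ℤ) - j) *
        Units.map (algebraMap O F : O →* F) (u * v⁻¹) := by
      have hu : ∀ l : ℕ, ((unif F hπ ^ l : Fˣ) : F) = algebraMap O F π ^ l := fun l => by
        simp [unif]
      have hp := algebraMap_uniformizer_ne_zero F hπ
      have hv : Units.map (algebraMap O F : O →* F) v * unif F hπ ^ j * z =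
          Units.map (algebraMap O F : O →* F) u * unif F hπ ^ i := by
        ext
        rw [Units.val_mul, Units.val_mul, Units.val_mul, hu, hu, ← hab]
        have hv0 : algebraMap O F (v : O) ≠ 0 := (v.isUnit.map (algebraMap O F)).ne_zero
        simp only [map_mul, map_pow, Units.coe_map, MonoidHom.coe_coe]
        field_simp
      rw [eq_inv_mul_of_mul_eq hv, _root_.zpow_sub, zpow_natCast, zpow_natCast, map_mul, map_inv,
        mul_inv]
      ac_rfl
    refine ⟨Matrix.GeneralLinearGroup.scalar (Fin 2) (u * v⁻¹) * κ, (i : ℤ) - j, ?_⟩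
    have hs : toG O F (Matrix.GeneralLinearGroup.scalar (Fin 2) (u * v⁻¹)) =
        centralG (Units.map (algebraMap O F : O →* F) (u * v⁻¹)) :=
      Matrix.GeneralLinearGroup.map_scalar _ _
    rw [map_mul, hs, ← mul_assoc, ← centralG_mul, ← hz, centralG_mul_comm]
    rfl
  · rintro ⟨κ, n, rfl⟩
    exact ⟨_, ⟨κ, rfl⟩, _, ⟨unif F hπ ^ n, rfl⟩, (centralG_mul_comm _ _).symm⟩

/-- The projection `KZ = K × π^ℤ → K ≃ GL₂(O)`: it sends `π^n κ` to `κ`. -/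
noncomputable def projK {π : O} (hπ : Irreducible π) : subgroupKZ O F →* GL (Fin 2) O where
  toFun g := ((mem_subgroupKZ_iff hπ g.1).1 g.2).choose
  map_one' := by
    obtain ⟨n, h⟩ := ((mem_subgroupKZ_iff hπ _).1 (1 : subgroupKZ O F).2).choose_spec
    refine scalar_unif_zpow_unique (F := F) hπ (n := n) (m := 0) ?_
    rw [← h]
    simp [centralG_one]
  map_mul' a b := by
    obtain ⟨n, h⟩ := ((mem_subgroupKZ_iff hπ _).1 (a * b).2).choose_spec
    obtain ⟨na, ha⟩ := ((mem_subgroupKZ_iff hπ _).1 a.2).choose_spec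
    obtain ⟨nb, hb⟩ := ((mem_subgroupKZ_iff hπ _).1 b.2).choose_spec
    refine scalar_unif_zpow_unique (F := F) hπ (n := n) (m := na + nb) ?_
    rw [← h, Subgroup.coe_mul]
    conv_lhs => rw [ha, hb]
    rw [map_mul, _root_.zpow_add, centralG_mul, mul_assoc, mul_assoc]
    congr 1
    rw [← mul_assoc, ← centralG_mul_comm, mul_assoc]

theorem projK_eq {π : O} (hπ : Irreducible π) (g : subgroupKZ O F) (n : ℤ) (κ : GL (Fin 2) O)
    (h : (g : GL (Fin 2) F) = centralG (unif F hπ ^ n) *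
      toG O F κ) : projK hπ g = κ := by
  obtain ⟨m, hm⟩ := ((mem_subgroupKZ_iff hπ _).1 g.2).choose_spec
  exact scalar_unif_zpow_unique (F := F) hπ (n := m) (m := n) (hm.symm.trans h)
end Groups

/-! ### Serre weights -/

section Weights
open scoped MatrixGroups
open MvPolynomial

variable (E : Type*) [Field E] (p : ℕ) {f : ℕ}

/-- The multigrading on `E[x_0, y_0, …, x_{f-1}, y_{f-1}]` in which `x_j = X (j, 0)` and
`y_j = X (j, 1)` have the `j`-th unit vector as their degree. -/
def multiDeg (a : Fin f × Fin 2) : Fin f → ℕ := Pi.single a.1 1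

/-- `⨂_j Sym^{r_j} E²`, realised as the space of polynomials in `x_0, y_0, …, x_{f-1}, y_{f-1}`
which are homogeneous of degree `r_j` in each pair of variables `x_j, y_j`. -/
abbrev symSpace (r : Fin f → ℕ) : Submodule E (MvPolynomial (Fin f × Fin 2) E) :=
  weightedHomogeneousSubmodule E multiDeg r

/-- The submodule `symSpace E r` as a vector space of its own. -/
def SymType (r : Fin f → ℕ) : Type _ := symSpace E r

noncomputable instance (r : Fin f → ℕ) : AddCommGroup (SymType E r) :=
  inferInstanceAs (AddCommGroup (symSpace E r))

noncomputable instance (r : Fin f → ℕ) : Module E (SymType E r) :=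
  inferInstanceAs (Module E (symSpace E r))

/-- For `g = (a b; c d)`, the substitution `x_j ↦ a^{p^j} x_j + c^{p^j} y_j`,
`y_j ↦ b^{p^j} x_j + d^{p^j} y_j`. -/
noncomputable def symSubst (g : Matrix (Fin 2) (Fin 2) E) :
    MvPolynomial (Fin f × Fin 2) E →ₐ[E] MvPolynomial (Fin f × Fin 2) E :=
  aeval fun a => ∑ i : Fin 2, C (g i a.2 ^ p ^ (a.1 : ℕ)) * X (a.1, i)

theorem symSubst_mem (r : Fin f → ℕ) (g : Matrix (Fin 2) (Fin 2) E)
    {P : MvPolynomial (Fin f × Fin 2) E} (hP : P ∈ symSpace E r) :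
    symSubst E p g P ∈ symSpace E r := by
  rw [P.as_sum, map_sum]
  refine Submodule.sum_mem _ fun d hd => ?_
  have hd' : Finsupp.weight multiDeg d = r := hP (mem_support_iff.1 hd)
  rw [symSubst, aeval_monomial, ← smul_eq_mul, algebraMap_smul]
  refine Submodule.smul_mem _ _ ?_
  rw [mem_weightedHomogeneousSubmodule, ← hd', Finsupp.weight_apply]
  refine IsWeightedHomogeneous.prod _ _ _ fun a _ => ?_
  refine IsWeightedHomogeneous.pow ?_ _
  refine (weightedHomogeneousSubmodule E multiDeg (multiDeg a)).sum_mem fun i _ => ?_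
  rw [← smul_eq_C_mul]
  exact Submodule.smul_mem _ _ (isWeightedHomogeneous_X E multiDeg (a.1, i))

theorem symSubst_one [Fact p.Prime] : symSubst (f := f) E p 1 = AlgHom.id E _ := by
  ext1 a
  obtain ⟨j, i⟩ := a
  fin_cases i <;> simp [symSubst, (Fact.out : p.Prime).ne_zero]

theorem symSubst_mul [CharP E p] [Fact p.Prime] (g h : Matrix (Fin 2) (Fin 2) E) :
    symSubst (f := f) E p (g * h) = (symSubst E p g).comp (symSubst E p h) := by
  ext1 a
  obtain ⟨j, i⟩ := a
  simp only [symSubst, AlgHom.comp_apply, aeval_X, Fin.sum_univ_two, Matrix.mul_apply, map_add,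
    map_mul, add_pow_char_pow, mul_pow, algHom_C, algebraMap_eq]
  ring

/-- The restriction of `symSubst` to `⨂_j Sym^{r_j} E²`. -/
noncomputable def symEnd (r : Fin f → ℕ) (g : Matrix (Fin 2) (Fin 2) E) :
    SymType E r →ₗ[E] SymType E r where
  toFun P := ⟨symSubst E p g P.1, symSubst_mem E p r g P.2⟩
  map_add' P Q := Subtype.ext (map_add (symSubst E p g) P.1 Q.1)
  map_smul' c P := Subtype.ext (map_smul (symSubst E p g) c P.1)

/-- The representation `det^w ⊗ ⨂_j Sym_j^{r_j} E²` of `GL₂(E)`, the `j`-th factor being twisted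
by the `j`-th power of the Frobenius. -/
noncomputable def symRep [CharP E p] [Fact p.Prime] (w : ℕ) (r : Fin f → ℕ) :
    Representation E (GL (Fin 2) E) (SymType E r) where
  toFun g := (g : Matrix (Fin 2) (Fin 2) E).det ^ w •
    symEnd E p r (g : Matrix (Fin 2) (Fin 2) E)
  map_one' := by
    have h : symEnd E p r 1 = LinearMap.id := LinearMap.ext fun P => Subtype.ext <| by
      change symSubst E p 1 P.1 = P.1
      rw [symSubst_one]
      rfl
    rw [Units.val_one, Matrix.det_one, one_pow, one_smul, h]
    rfl
  map_mul' g h := by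
    have h : symEnd E p r (g * h : Matrix (Fin 2) (Fin 2) E) =
        symEnd E p r (g : Matrix (Fin 2) (Fin 2) E) *
          symEnd E p r (h : Matrix (Fin 2) (Fin 2) E) := LinearMap.ext fun P => Subtype.ext <| by
      change symSubst E p _ P.1 = symSubst E p _ (symSubst E p _ P.1)
      rw [symSubst_mul]
      rfl
    rw [Units.val_mul, Matrix.det_mul, mul_pow, h, smul_mul_smul_comm]

/-- The vector `⨂_j x_j^{r_j - k_j} y_j^{k_j}`. -/
noncomputable def symVec (r k : Fin f → ℕ) (hk : k ≤ r) : SymType E r :=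
  ⟨∏ j, X (j, 0) ^ (r j - k j) * X (j, 1) ^ k j, by
    have h : IsWeightedHomogeneous multiDeg
        (∏ j, X (j, 0) ^ (r j - k j) * X (j, 1) ^ k j : MvPolynomial (Fin f × Fin 2) E)
        (∑ j, ((r j - k j) • multiDeg (j, 0) + k j • multiDeg (j, 1))) :=
      IsWeightedHomogeneous.prod _ _ _ fun j _ =>
        ((isWeightedHomogeneous_X E multiDeg (j, (0 : Fin 2))).pow _).mul
          ((isWeightedHomogeneous_X E multiDeg (j, (1 : Fin 2))).pow _)
    have hr : ∑ j, ((r j - k j) • multiDeg (f := f) (j, 0) + k j • multiDeg (j, 1)) = r := by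
      ext l
      simp only [multiDeg, ← add_smul, Nat.sub_add_cancel (hk _), Finset.sum_apply]
      simp [Pi.single_apply]
    rw [hr] at h
    exact h⟩

variable {O : Type*} [CommRing O] [IsDomain O] [IsDiscreteValuationRing O]
  (F : Type*) [Field F] [Algebra O F] [IsFractionRing O F]
  [Algebra (IsLocalRing.ResidueField O) E] [CharP E p] [Fact p.Prime]

/-- The representation `det^w ⊗ ⨂_j Sym_j^{r_j} E²` of `KZ`: inflated from `GL₂` of the residue
field to `K`, and extended to `KZ` by letting the scalar matrix `π` act trivially. -/
noncomputable def weightKZ {π : O} (hπ : Irreducible π) (w : ℕ) (r : Fin f → ℕ) :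
    Representation E (subgroupKZ O F) (SymType E r) :=
  (symRep E p w r).comp
    ((Matrix.GeneralLinearGroup.map
      ((algebraMap (IsLocalRing.ResidueField O) E).comp (IsLocalRing.residue O))).comp (projK hπ))

end Weights

section Elements
open scoped MatrixGroups

variable {O : Type*} [CommRing O] [IsDomain O] [IsDiscreteValuationRing O]
  (F : Type*) [Field F] [Algebra O F] [IsFractionRing O F]

variable (O) in
open scoped Classical in
/-- The Teichmüller representatives in `O`, that is, the solutions of `x^q = x`, with `q` the
order of the residue field. -/
noncomputable def teichmullerSet : Finset O :=
  (Polynomial.X ^ Nat.card (IsLocalRing.ResidueField O) - Polynomial.X :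
    Polynomial O).roots.toFinset

open scoped Classical in
/-- `I_n`: the set of all `[μ_0] + π [μ_1] + ⋯ + π^(n-1) [μ_{n-1}]`. -/
noncomputable def repSet (π : O) (n : ℕ) : Finset O :=
  (Fintype.piFinset fun _ : Fin n => teichmullerSet O).image
    fun c : Fin n → O => ∑ i : Fin n, π ^ (i : ℕ) * c i

/-- The matrix `(π^n μ; 0 1)`. -/
def gMat {π : O} (hπ : Irreducible π) (n : ℕ) (μ : O) : GL (Fin 2) F :=
  Matrix.GeneralLinearGroup.mkOfDetNeZero
    !![algebraMap O F π ^ n, algebraMap O F μ; 0, 1]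
    (by simpa using pow_ne_zero n (algebraMap_uniformizer_ne_zero F hπ))

variable (E : Type*) [Field E] (p : ℕ) [CharP E p] [Fact p.Prime]
  [Algebra (IsLocalRing.ResidueField O) E] {f : ℕ}

/-- `t_n^k = ∑_{μ ∈ I_n} (π^n μ; 0 1) ⊗ ⨂_j x_j^{r_j - k_j} y_j^{k_j}`. -/
noncomputable def tElt {π : O} (hπ : Irreducible π) (w : ℕ) (r k : Fin f → ℕ) (hk : k ≤ r)
    (n : ℕ) : compactIndSpace (weightKZ E p F hπ w r) :=
  ∑ μ ∈ repSet π n, compactIndMk (weightKZ E p F hπ w r) (gMat F hπ n μ) (symVec E r k hk)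

/-- The `G`-subrepresentation of `ind_{KZ}^G σ` generated by all `t_l^i` with `l ≥ 1` and
`i < k` (that is, `i_j ≤ k_j` for all `j`, and `i ≠ k`). -/
noncomputable def lowerSpan {π : O} (hπ : Irreducible π) (w : ℕ) (r k : Fin f → ℕ) (hk : k ≤ r) :
    Subrepresentation (compactInd (weightKZ E p F hπ w r)) :=
  generatedBy _ {t | ∃ l : ℕ, 1 ≤ l ∧ ∃ (i : Fin f → ℕ) (hi : i < k),
    t = tElt F E p hπ w r i (hi.le.trans hk) l}

/-- The quotient of `ind_{KZ}^G σ` by the subrepresentation generated by the lower `t_l^i`. -/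
noncomputable def indModLower {π : O} (hπ : Irreducible π) (w : ℕ) (r k : Fin f → ℕ)
    (hk : k ≤ r) : Representation E (GL (Fin 2) F)
      (compactIndSpace (weightKZ E p F hπ w r) ⧸ (lowerSpan F E p hπ w r k hk).toSubmodule) :=
  quotientRep (compactInd (weightKZ E p F hπ w r)) (lowerSpan F E p hπ w r k hk)

/-- The image of `t_n^k` in that quotient. -/
noncomputable def tBar {π : O} (hπ : Irreducible π) (w : ℕ) (r k : Fin f → ℕ) (hk : k ≤ r)
    (n : ℕ) :
    compactIndSpace (weightKZ E p F hπ w r) ⧸ (lowerSpan F E p hπ w r k hk).toSubmodule :=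
  (lowerSpan F E p hπ w r k hk).toSubmodule.mkQ (tElt F E p hπ w r k hk n)

/-- The `KZ`-subrepresentation generated by the image of `t_n^k` in that quotient. -/
noncomputable def tBarKZ {π : O} (hπ : Irreducible π) (w : ℕ) (r k : Fin f → ℕ) (hk : k ≤ r)
    (n : ℕ) :
    Subrepresentation ((indModLower F E p hπ w r k hk).comp (subgroupKZ O F).subtype) :=
  generatedBy _ {tBar F E p hπ w r k hk n}

end Elements

theorem le_of_le_half_sub_one {f : ℕ} {r k : Fin f → ℕ} (h : ∀ j, k j ≤ r j / 2 - 1) : k ≤ r :=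
  fun j => (h j).trans (by lia)

end GL2ModP

/-! Write `q` for the order of the residue field, `ξ_i` for the element `1 ⊗ ⨂ x_j^{r_j-i_j}
y_j^{i_j}` of the compact induction, and `u(c, e)` for the value of `u` at `x_j = c^{p^j}`, `y_j =
e^{p^j}`.

Construction. Suppose matrices of `K` that are diagonal modulo `π` act on a vector `ξ` as on the
highest weight vector of `det^w ⊗ ⨂ Sym_j^{r_j}`. Frobenius reciprocity suggests the map `Ψ` given
by `u ↦ ∑_μ u(1, -μ) (π [μ]; 0 1) ξ + (-1)^w u(0, 1) (0 1; π 0) ξ`, a sum over the projective line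
over the residue field. It commutes with `(0 1; 1 0)` exactly (`psi_swapK`). An upper triangular
matrix permutes the summands, except that it also produces unipotents `(1 x_μ; 0 1)` acting on `ξ`
(`psi_upperK`). As `e > 1`, Teichmüller lifts are additive modulo `π²`, and so `x_μ` is an affine
function of `μ` modulo `π` (`IsTeichmullerLift.affine`).

Equivariance. For `ξ = ξ_k` and the weight `r - 2k`, the binomial expansion turns the error into
sums over `i < k` of `u(1, -μ)` times a power of an affine function of `μ`, applied to `ξ_i`. Such a
product is again `u'(1, -μ)` for some `u'` of weight `r - 2i` that vanishes at `(0, 1)`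
(`exists_symEval_eq_mul_affine`). So `Ψ_k` is `K`-equivariant modulo the images of the `Ψ_i` with `i
< k`, and these images lie in `M_k` by induction (`psiInd_mem_lowerSpan`). The highest weight vector
goes to `t_1^k`. Modulo `M_k` the image of `t_n^k` is then itself invariant under upper unipotents,
and the same construction with `ξ` equal to it gives `t_{n+1}^k` with no error term
(`exists_equivariant_tBar`). The weights are irreducible, since polynomial functions of degree less
than `q` on the residue field have well-defined coefficients. Everything is thereby reduced to
nonvanishing.

Nonvanishing. Evaluate functions at the inverses of the matrices `(π^n b; 0 1)` and call `n` the
height. The space `S`, the sum of the images of the `Ψ_i` with `i < k`, is `K`-stable and seen only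
at heights `1` and `-1`. An element of `S` is determined by its values at height `1`, and these have
no component along `⨂ x_j^{r_j-k_j} y_j^{k_j}`. By the Iwasawa decomposition, `M_k` is contained in
the sum of the translates of `S` by matrices `(π^n b; 0 1)`. An element built from translates with
`n ≤ N` that vanishes at height `N + 1` needs only those with `n ≤ N - 1`
(`mem_heightSpan_of_apply_eq_zero`). If `t_n^k`, which lives at height `n`, were in `M_k`,
descending to `N = n - 1` would kill its `k`-th component, which is `1` at a suitable point. -/

namespace GL2ModP

/-! ### Multi-indices and digit expansions -/

section Digits

/-- The natural number `∑ d_j p^j`. -/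
def digitSum (p : ℕ) {f : ℕ} (d : Fin f → ℕ) : ℕ := ∑ j : Fin f, d j * p ^ (j : ℕ)

variable {p f : ℕ}

theorem digitSum_add (d e : Fin f → ℕ) : digitSum p (d + e) = digitSum p d + digitSum p e := by
  simp [digitSum, add_mul, Finset.sum_add_distrib]

theorem digitSum_lt {d : Fin f → ℕ} (hd : ∀ j, d j < p) : digitSum p d < p ^ f := by
  have h := (finFunctionFinEquiv fun j => (⟨d j, hd j⟩ : Fin p)).2
  rwa [finFunctionFinEquiv_apply] at h

/-- Uniqueness of base `p` expansions. It allows multi-indices with entries below `p` to be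
separated by powers of a single variable running over the residue field. -/
theorem digitSum_inj {d e : Fin f → ℕ} (hd : ∀ j, d j < p) (he : ∀ j, e j < p)
    (h : digitSum p d = digitSum p e) : d = e := by
  have h1 : finFunctionFinEquiv (fun j => (⟨d j, hd j⟩ : Fin p)) =
      finFunctionFinEquiv fun j => (⟨e j, he j⟩ : Fin p) := by
    apply Fin.ext
    rw [finFunctionFinEquiv_apply, finFunctionFinEquiv_apply]
    exact h
  have h2 := finFunctionFinEquiv.injective h1
  funext j
  exact congrArg Fin.val (congrFun h2 j)

/-- The multi-indices `i ≤ r`. -/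
abbrev Below (r : Fin f → ℕ) := {i : Fin f → ℕ // i ≤ r}

instance finite_below (r : Fin f → ℕ) : Finite (Below r) := (Set.finite_Iic r).to_subtype

noncomputable instance fintype_below (r : Fin f → ℕ) : Fintype (Below r) := Fintype.ofFinite _

theorem prod_pow_mul_pow_digit {R : Type*} [CommMonoid R] (c : R) (d : Fin f → ℕ) :
    ∏ j : Fin f, (c ^ p ^ (j : ℕ)) ^ d j = c ^ digitSum p d := by
  rw [digitSum, ← Finset.prod_pow_eq_pow_sum]
  exact Finset.prod_congr rfl fun j _ => by rw [← pow_mul, mul_comm]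

theorem prod_add_pow_eq_sum_Iic {R : Type*} [CommSemiring R] (A B : Fin f → R) (k : Fin f → ℕ) :
    ∏ j, (A j + B j) ^ k j =
      ∑ i : Below k, ∏ j, (B j ^ (i.1 j) * A j ^ (k j - i.1 j) * ((k j).choose (i.1 j) : R)) := by
  simp_rw [add_comm (A _), add_pow]
  rw [Finset.prod_univ_sum]
  refine Finset.sum_bij' (fun i hi => ⟨i, fun j => by
    have := Fintype.mem_piFinset.1 hi j
    exact Nat.lt_succ_iff.1 (Finset.mem_range.1 this)⟩) (fun i _ => i.1) ?_ ?_ ?_ ?_ ?_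
  · intros; exact Finset.mem_univ _
  · intro i _
    exact Fintype.mem_piFinset.2 fun j => Finset.mem_range.2 (Nat.lt_succ_iff.2 (i.2 j))
  · intros; rfl
  · intros; rfl
  · intros; rfl

/-- If a polynomial function on a finite field, with coefficients in a vector space and of degree
less than the order of the field, takes values in a subspace, then so do its coefficients. -/
theorem sum_filter_mem_of_sum_pow_smul_mem {k E V ι : Type*} [Field k] [Fintype k] [Field E]
    [Algebra k E] [AddCommGroup V] [Module E V] [Fintype ι] (W : Submodule E V) (e : ι → ℕ)
    (he : ∀ i, e i < Fintype.card k) (v : ι → V)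
    (h : ∀ c : k, ∑ i, algebraMap k E c ^ e i • v i ∈ W) (n : ℕ) :
    ∑ i with e i = n, v i ∈ W := by
  rw [← Submodule.Quotient.mk_eq_zero, ← Module.forall_dual_apply_eq_zero_iff E]
  intro φ
  -- A functional that kills `W` turns the hypothesis into a polynomial of degree less than the
  -- order of the field vanishing at all its points, so each coefficient is zero.
  let P : Polynomial E := ∑ i, Polynomial.monomial (e i) (φ (W.mkQ (v i)))
  have hP : P = 0 := by
    refine Polynomial.eq_zero_of_natDegree_lt_card_of_eval_eq_zero P
      (algebraMap k E).injective (fun c => ?_) ?_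
    · have h1 := congrArg φ ((Submodule.Quotient.mk_eq_zero W).2 (h c))
      rw [← Submodule.mkQ_apply, map_sum, map_sum, map_zero] at h1
      rw [Polynomial.eval_finsetSum, ← h1]
      refine Finset.sum_congr rfl fun i _ => ?_
      rw [map_smul, map_smul, Polynomial.eval_monomial, smul_eq_mul, mul_comm]
    · refine lt_of_le_of_lt (Polynomial.natDegree_sum_le_of_forall_le (n := Fintype.card k - 1) _ _
        fun i _ => (Polynomial.natDegree_monomial_le _).trans (Nat.le_sub_one_of_lt (he i))) ?_
      have := Fintype.card_pos (α := k)
      lia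
  have h2 := congrArg (fun Q => Polynomial.coeff Q n) hP
  simp only [P, Polynomial.finsetSum_coeff, Polynomial.coeff_monomial, Polynomial.coeff_zero] at h2
  rw [← Submodule.mkQ_apply, map_sum, map_sum, ← h2, Finset.sum_filter]

theorem mem_of_sum_pow_smul_mem {k E V ι : Type*} [Field k] [Fintype k] [Field E]
    [Algebra k E] [AddCommGroup V] [Module E V] [Fintype ι] (W : Submodule E V) (e : ι → ℕ)
    (he : ∀ i, e i < Fintype.card k) (hi : Function.Injective e) (v : ι → V)
    (h : ∀ c : k, ∑ i, algebraMap k E c ^ e i • v i ∈ W) (i : ι) : v i ∈ W := by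
  classical
  have h1 := sum_filter_mem_of_sum_pow_smul_mem W e he v h (e i)
  have h2 : (Finset.univ.filter fun j => e j = e i) = {i} := by
    ext j
    simp [hi.eq_iff]
  rwa [h2, Finset.sum_singleton] at h1

end Digits

/-! ### Symmetric powers -/

section SymmetricPowers
open MvPolynomial

variable (E : Type*) [Field E] (p : ℕ) {f : ℕ}

/-- The polynomial underlying an element of `⨂_j Sym^{r_j} E²`. -/
noncomputable def symVal (r : Fin f → ℕ) : SymType E r →ₗ[E] MvPolynomial (Fin f × Fin 2) E where
  toFun u := u.1
  map_add' _ _ := rfl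
  map_smul' _ _ := rfl

/-- Evaluation of polynomials at `x_j = c^{p^j}`, `y_j = e^{p^j}`. -/
noncomputable def pointEval (c e : E) : MvPolynomial (Fin f × Fin 2) E →ₐ[E] E :=
  aeval fun a => ![c, e] a.2 ^ p ^ (a.1 : ℕ)

/-- Evaluation of elements of `⨂_j Sym^{r_j} E²` at `x_j = c^{p^j}`, `y_j = e^{p^j}`. -/
noncomputable def symEval (r : Fin f → ℕ) (c e : E) : SymType E r →ₗ[E] E :=
  (pointEval E p c e).toLinearMap ∘ₗ symVal E r

/-- The exponent of the monomial `∏_j x_j^{r_j - k_j} y_j^{k_j}`. -/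
noncomputable def symExp (r k : Fin f → ℕ) : Fin f × Fin 2 →₀ ℕ :=
  Finsupp.equivFunOnFinite.symm fun a => ![r a.1 - k a.1, k a.1] a.2

/-- The coefficient of `∏_j x_j^{r_j - k_j} y_j^{k_j}`. -/
noncomputable def symCoord (r k : Fin f → ℕ) : SymType E r →ₗ[E] E :=
  lcoeff E (symExp r k) ∘ₗ symVal E r

variable {E} in
theorem symType_ext {r : Fin f → ℕ} {u v : SymType E r} (h : symVal E r u = symVal E r v) :
    u = v := Subtype.ext h

theorem symVal_mem {r : Fin f → ℕ} (u : SymType E r) : symVal E r u ∈ symSpace E r := u.2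

theorem symVal_symVec (r k : Fin f → ℕ) (hk : k ≤ r) :
    symVal E r (symVec E r k hk) = ∏ j, X (j, 0) ^ (r j - k j) * X (j, 1) ^ k j := rfl

theorem symVal_symVec_eq_monomial (r k : Fin f → ℕ) (hk : k ≤ r) :
    symVal E r (symVec E r k hk) = monomial (symExp r k) 1 := by
  rw [symVal_symVec, monomial_eq, C_1, one_mul, Finsupp.prod_fintype _ _ (by simp),
    Fintype.prod_prod_type]
  simp [symExp]

theorem symExp_injective (r : Fin f → ℕ) {k l : Fin f → ℕ} (h : symExp r k = symExp r l) :
    k = l := by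
  funext j
  have := DFunLike.congr_fun h (j, 1)
  simpa [symExp] using this

theorem symCoord_symVec (r k l : Fin f → ℕ) (hl : l ≤ r) :
    symCoord E r k (symVec E r l hl) = if l = k then 1 else 0 := by
  classical
  change coeff (symExp r k) (symVal E r (symVec E r l hl)) = _
  rw [symVal_symVec_eq_monomial, coeff_monomial]
  by_cases h : l = k
  · simp [h]
  · rw [if_neg h, if_neg fun h' => h (symExp_injective r h')]

theorem weight_multiDeg (d : Fin f × Fin 2 →₀ ℕ) (j : Fin f) :
    Finsupp.weight multiDeg d j = d (j, 0) + d (j, 1) := by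
  rw [Finsupp.weight_apply, Finsupp.sum_fintype _ _ (by simp), Fintype.sum_prod_type,
    Finset.sum_apply, Finset.sum_eq_single j]
  · simp [multiDeg]
  · intro b _ hb
    simp [multiDeg, hb.symm]
  · simp

/-- Multihomogeneity makes the exponent of each `y_j` determine that of `x_j`, so the coefficients
at the multi-indices below `r` capture the whole polynomial. -/
theorem symType_eq_sum {r : Fin f → ℕ} (u : SymType E r) :
    u = ∑ i : Below r, symCoord E r i.1 u • symVec E r i.1 i.2 := by
  classical
  apply symType_ext
  simp only [map_sum, map_smul, symVal_symVec_eq_monomial]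
  ext d
  rw [coeff_sum]
  simp only [coeff_smul, coeff_monomial, smul_eq_mul, mul_ite, mul_one, mul_zero]
  by_cases hd : coeff d (symVal E r u) = 0
  · rw [hd]
    symm
    refine Finset.sum_eq_zero fun i _ => ?_
    split_ifs with h
    · rw [← hd, ← h]; rfl
    · rfl
  · have hw : Finsupp.weight multiDeg d = r := symVal_mem E u hd
    have hj : ∀ j, d (j, 0) + d (j, 1) = r j := fun j => by rw [← weight_multiDeg, hw]
    have hde : symExp r (fun j => d (j, 1)) = d := by
      ext ⟨j, i⟩
      have := hj j
      fin_cases i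
      · simp [symExp, ← hj j]
      · simp [symExp]
    rw [Finset.sum_eq_single ⟨fun j => d (j, 1), fun j => by have := hj j; lia⟩]
    · rw [if_pos hde]
      exact (congrArg (fun d' => coeff d' (symVal E r u)) hde).symm
    · intro i _ hi
      rw [if_neg]
      intro h
      rw [← hde] at h
      exact hi (Subtype.ext (symExp_injective r h))
    · simp

theorem eq_zero_of_symCoord_eq_zero {r : Fin f → ℕ} {u : SymType E r}
    (h : ∀ i : Below r, symCoord E r i.1 u = 0) : u = 0 := by
  rw [symType_eq_sum E u]
  simp [h]

theorem pointEval_X (c e : E) (j : Fin f) (i : Fin 2) :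
    pointEval E p c e (X (j, i)) = ![c, e] i ^ p ^ (j : ℕ) := aeval_X _ _

theorem symEval_apply (r : Fin f → ℕ) (c e : E) (u : SymType E r) :
    symEval E p r c e u = pointEval E p c e (symVal E r u) := rfl

theorem symEval_symVec (r k : Fin f → ℕ) (hk : k ≤ r) (c e : E) :
    symEval E p r c e (symVec E r k hk) = c ^ digitSum p (r - k) * e ^ digitSum p k := by
  rw [symEval_apply, symVal_symVec, map_prod, ← prod_pow_mul_pow_digit, ← prod_pow_mul_pow_digit,
    ← Finset.prod_mul_distrib]
  refine Finset.prod_congr rfl fun j _ => ?_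
  simp [pointEval_X]

theorem symEval_smul (r : Fin f → ℕ) (l c e : E) (u : SymType E r) :
    symEval E p r (l * c) (l * e) u = l ^ digitSum p r * symEval E p r c e u := by
  rw [symType_eq_sum E u]
  simp only [map_sum, map_smul, symEval_symVec, Finset.mul_sum, smul_eq_mul]
  refine Finset.sum_congr rfl fun i _ => ?_
  have : digitSum p r = digitSum p (r - i.1) + digitSum p i.1 := by
    rw [← digitSum_add, tsub_add_cancel_of_le i.2]
  rw [this, mul_pow, mul_pow, pow_add]
  ring

theorem symEval_zero_one [Fact p.Prime] (r k : Fin f → ℕ) (hk : k ≤ r) (h : k ≠ r) :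
    symEval E p r 0 1 (symVec E r k hk) = 0 := by
  rw [symEval_symVec, zero_pow, zero_mul]
  intro h0
  apply h
  funext j
  have := (Finset.sum_eq_zero_iff.1 h0) j (Finset.mem_univ _)
  have hp : p ^ (j : ℕ) ≠ 0 := pow_ne_zero _ (Fact.out : p.Prime).ne_zero
  have := (mul_eq_zero.1 this).resolve_right hp
  have h2 := hk j
  simp at this
  lia

/-- The matrix acts on the point as on a row vector from the right; additivity of the Frobenius
makes this compatible with the twist by `p^j`. -/
theorem pointEval_symSubst [CharP E p] [Fact p.Prime] (g : Matrix (Fin 2) (Fin 2) E) (c e : E)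
    (P : MvPolynomial (Fin f × Fin 2) E) :
    pointEval E p c e (symSubst E p g P) =
      pointEval E p (c * g 0 0 + e * g 1 0) (c * g 0 1 + e * g 1 1) P := by
  rw [← AlgHom.comp_apply]
  congr 1
  ext ⟨j, i⟩
  simp only [symSubst, AlgHom.comp_apply, aeval_X, Fin.sum_univ_two, map_add, map_mul, algHom_C,
    pointEval_X, Algebra.algebraMap_self, RingHom.id_apply]
  fin_cases i <;> simp [add_pow_char_pow, mul_pow, mul_comm]

theorem symVal_symRep [CharP E p] [Fact p.Prime] (w : ℕ) (r : Fin f → ℕ) (g : GL (Fin 2) E)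
    (u : SymType E r) :
    symVal E r (symRep E p w r g u) =
      (g : Matrix (Fin 2) (Fin 2) E).det ^ w •
        symSubst E p (g : Matrix (Fin 2) (Fin 2) E) (symVal E r u) := rfl

theorem symEval_symRep [CharP E p] [Fact p.Prime] (w : ℕ) (r : Fin f → ℕ) (g : GL (Fin 2) E)
    (c e : E) (u : SymType E r) :
    symEval E p r c e (symRep E p w r g u) = (g : Matrix (Fin 2) (Fin 2) E).det ^ w *
      symEval E p r (c * g 0 0 + e * g 1 0) (c * g 0 1 + e * g 1 1) u := by
  rw [symEval_apply, symVal_symRep, map_smul, pointEval_symSubst, smul_eq_mul, symEval_apply]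

variable {k : Type*} [Field k] [Fintype k] [Algebra k E]

/-- In `u(1, c)` distinct coordinates of `u` come with distinct powers of `c`, all smaller than the
order of `k`, so a zero function has zero coordinates. -/
theorem eq_zero_of_symEval_eq_zero (hq : Fintype.card k = p ^ f) {r : Fin f → ℕ}
    (hr : ∀ j, r j < p) {u : SymType E r}
    (h : ∀ c : k, symEval E p r 1 (algebraMap k E c) u = 0) : u = 0 := by
  apply eq_zero_of_symCoord_eq_zero
  have hlt : ∀ i : Below r, ∀ j, i.1 j < p := fun i j => (i.2 j).trans_lt (hr j)
  refine mem_of_sum_pow_smul_mem (k := k) (⊥ : Submodule E E)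
    (fun i : Below r => digitSum p i.1) (fun i => hq ▸ digitSum_lt (hlt i))
    (fun i i' hii => Subtype.ext (digitSum_inj (hlt i) (hlt i') hii))
    (fun i => symCoord E r i.1 u) fun c => ?_
  rw [Submodule.mem_bot]
  have h1 := h c
  rw [symType_eq_sum E u] at h1
  simp only [map_sum, map_smul, symEval_symVec, one_pow, one_mul, smul_eq_mul] at h1
  rw [← h1]
  exact Finset.sum_congr rfl fun i _ => by rw [smul_eq_mul, mul_comm]

theorem symVal_symEnd (r : Fin f → ℕ) (g : Matrix (Fin 2) (Fin 2) E) (u : SymType E r) :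
    symVal E r (symEnd E p r g u) = symSubst E p g (symVal E r u) := rfl

theorem symSubst_X (g : Matrix (Fin 2) (Fin 2) E) (j : Fin f) (i : Fin 2) :
    symSubst E p g (X (j, i)) =
      C (g 0 i ^ p ^ (j : ℕ)) * X (j, 0) + C (g 1 i ^ p ^ (j : ℕ)) * X (j, 1) := by
  simp [symSubst]

theorem symEnd_upper_symVec [Fact p.Prime] (r l : Fin f → ℕ) (hl : l ≤ r) (c : E) :
    symEnd E p r !![1, c; 0, 1] (symVec E r l hl) =
      ∑ i : Below l, ((∏ j, ((l j).choose (i.1 j) : E)) * c ^ digitSum p (l - i.1)) •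
        symVec E r i.1 (i.2.trans hl) := by
  have hp := (Fact.out : p.Prime).ne_zero
  apply symType_ext
  simp only [map_sum, map_smul, symVal_symEnd, symVal_symVec, map_prod, map_mul, map_pow,
    symSubst_X]
  rw [Finset.prod_mul_distrib, prod_add_pow_eq_sum_Iic _ _ l, Finset.mul_sum]
  refine Finset.sum_congr rfl fun i _ => ?_
  rw [← prod_pow_mul_pow_digit, ← Finset.prod_mul_distrib, ← Finset.prod_mul_distrib,
    smul_eq_C_mul, map_prod, ← Finset.prod_mul_distrib]
  refine Finset.prod_congr rfl fun j _ => ?_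
  have h1 : r j - i.1 j = (r j - l j) + (l j - i.1 j) := by
    have := hl j; have := i.2 j; lia
  rw [h1, pow_add]
  simp [hp]
  ring

theorem symEnd_lower_symVec_zero [Fact p.Prime] (r : Fin f → ℕ) (c : E) :
    symEnd E p r !![1, 0; c, 1] (symVec E r 0 (fun _ => Nat.zero_le _)) =
      ∑ i : Below r, ((∏ j, ((r j).choose (i.1 j) : E)) * c ^ digitSum p i.1) •
        symVec E r i.1 i.2 := by
  have hp := (Fact.out : p.Prime).ne_zero
  apply symType_ext
  simp only [map_sum, map_smul, symVal_symEnd, symVal_symVec, map_prod, map_mul, map_pow,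
    symSubst_X, Pi.zero_apply, pow_zero, mul_one, Nat.sub_zero]
  rw [prod_add_pow_eq_sum_Iic]
  refine Finset.sum_congr rfl fun i _ => ?_
  rw [← prod_pow_mul_pow_digit, ← Finset.prod_mul_distrib, smul_eq_C_mul, map_prod,
    ← Finset.prod_mul_distrib]
  refine Finset.prod_congr rfl fun j _ => ?_
  simp [hp]
  ring

theorem prod_choose_ne_zero [CharP E p] [Fact p.Prime] {r i : Fin f → ℕ} (hr : ∀ j, r j < p)
    (hi : i ≤ r) : (∏ j, ((r j).choose (i j) : E)) ≠ 0 := by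
  refine Finset.prod_ne_zero_iff.2 fun j _ h => ?_
  rw [CharP.cast_eq_zero_iff E p] at h
  have h1 : p ∣ (r j).factorial := by
    rw [← Nat.choose_mul_factorial_mul_factorial (hi j), mul_assoc]
    exact h.mul_right _
  exact absurd ((Fact.out : p.Prime).dvd_factorial.1 h1) (by have := hr j; lia)

/-- A subspace of `⨂_j Sym^{r_j} E²` that contains `⨂_j x_j^{r_j}` and is stable under the
lower unipotent matrices over `k` is everything. -/
theorem eq_top_of_symVec_zero_mem [CharP E p] [Fact p.Prime] (hq : Fintype.card k = p ^ f)
    {r : Fin f → ℕ} (hr : ∀ j, r j < p) (W : Submodule E (SymType E r))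
    (h0 : symVec E r 0 (fun _ => Nat.zero_le _) ∈ W)
    (hW : ∀ c : k, ∀ u ∈ W, symEnd E p r !![1, 0; algebraMap k E c, 1] u ∈ W) : W = ⊤ := by
  have hlt : ∀ i : Below r, ∀ j, i.1 j < p := fun i j => (i.2 j).trans_lt (hr j)
  -- Each coefficient in `c` of the translate of `⨂ x_j^{r_j}` is a basis vector times binomials
  -- that are invertible because `r_j < p`.
  have key := mem_of_sum_pow_smul_mem (k := k) W
    (fun i : Below r => digitSum p i.1) (fun i => hq ▸ digitSum_lt (hlt i))
    (fun i i' hii => Subtype.ext (digitSum_inj (hlt i) (hlt i') hii))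
    (fun i => (∏ j, ((r j).choose (i.1 j) : E)) • symVec E r i.1 i.2) fun c => by
      have := hW c _ h0
      rw [symEnd_lower_symVec_zero] at this
      simpa only [smul_smul, mul_comm] using this
  rw [eq_top_iff]
  intro u _
  rw [symType_eq_sum E u]
  refine Submodule.sum_mem _ fun i _ => Submodule.smul_mem _ _ ?_
  exact (Submodule.smul_mem_iff _ (prod_choose_ne_zero E p hr i.2)).1 (key i)

/-- A nonzero subspace of `⨂_j Sym^{r_j} E²` that is stable under the upper unipotent matrices
over `k` contains `⨂_j x_j^{r_j}`. -/
theorem symVec_zero_mem_of_ne_bot [CharP E p] [Fact p.Prime] (hq : Fintype.card k = p ^ f)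
    {r : Fin f → ℕ} (hr : ∀ j, r j < p) (W : Submodule E (SymType E r)) (h0 : W ≠ ⊥)
    (hW : ∀ c : k, ∀ u ∈ W, symEnd E p r !![1, algebraMap k E c; 0, 1] u ∈ W) :
    symVec E r 0 (fun _ => Nat.zero_le _) ∈ W := by
  classical
  obtain ⟨u, hu, hu0⟩ := W.ne_bot_iff.1 h0
  have hs : ({i | symCoord E r i.1 u ≠ 0} : Set (Below r)).Nonempty := by
    by_contra h
    apply hu0
    apply eq_zero_of_symCoord_eq_zero
    intro i
    by_contra hi
    exact h ⟨i, hi⟩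
  -- Take a maximal `l` in the support of `u` and extract the coefficient of `c^{digitSum p l}`. A
  -- contribution `x_2` of the expansion at `x_1` has `x_1 - x_2 = l`, hence `x_1 ≥ l`; maximality
  -- leaves only `x_1 = l` and `x_2 = 0`.
  obtain ⟨l, hl⟩ := (Set.toFinite _).exists_maximal hs
  have hlt : ∀ i : Below r, ∀ j, i.1 j < p := fun i j => (i.2 j).trans_lt (hr j)
  have key := sum_filter_mem_of_sum_pow_smul_mem (k := k) W
    (fun x : (i : Below r) × Below i.1 => digitSum p (x.1.1 - x.2.1))
    (fun x => hq ▸ digitSum_lt fun j => (Nat.sub_le _ _).trans_lt (hlt x.1 j))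
    (fun x => symCoord E r x.1.1 u • (∏ j, ((x.1.1 j).choose (x.2.1 j) : E)) •
      symVec E r x.2.1 (x.2.2.trans x.1.2)) (fun c => by
      have := hW c _ hu
      rw [symType_eq_sum E u, map_sum] at this
      simp only [map_smul, symEnd_upper_symVec, Finset.smul_sum] at this
      rw [Fintype.sum_sigma]
      refine (congrArg (· ∈ W) (Finset.sum_congr rfl fun i _ => Finset.sum_congr rfl
        fun m _ => ?_)).mpr this
      simp only [smul_smul]
      congr 1
      ring) (digitSum p l.1)
  rw [Finset.sum_eq_single ⟨l, ⟨0, fun _ => Nat.zero_le _⟩⟩] at key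
  · have h1 : (∏ j, ((l.1 j).choose 0 : E)) = 1 := by simp
    simp only [Pi.zero_apply, h1, one_smul] at key
    exact (Submodule.smul_mem_iff _ hl.prop).1 key
  · rintro ⟨i, m⟩ hx hne
    have h2 : digitSum p (i.1 - m.1) = digitSum p l.1 := (Finset.mem_filter.1 hx).2
    have h3 := digitSum_inj (fun j => (Nat.sub_le _ _).trans_lt (hlt i j)) (hlt l) h2
    by_cases hi : symCoord E r i.1 u = 0
    · simp [hi]
    · exfalso
      have hli : l ≤ i := by
        change l.1 ≤ i.1
        rw [← h3]
        exact tsub_le_self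
      have hil : i = l := (hl.eq_of_le hi hli).symm
      subst hil
      apply hne
      congr 1
      apply Subtype.ext
      funext j
      have h4 := congrFun h3 j
      have h5 := m.2 j
      change i.1 j - m.1 j = i.1 j at h4
      change m.1 j = 0
      lia
  · intro h
    exact absurd (by simp) h

end SymmetricPowers
end GL2ModP

namespace GL2ModP

/-! ### Elements of the groups -/

section GroupElements
open IsLocalRing

section Integral
variable {O : Type*} [CommRing O]

/-- The matrix `(a b; 0 d)`. -/
def upperK (a d : Oˣ) (b : O) : GL (Fin 2) O where
  val := !![a, b; 0, d]
  inv := !![(a⁻¹ : Oˣ), -(a⁻¹ : Oˣ) * b * (d⁻¹ : Oˣ); 0, (d⁻¹ : Oˣ)]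
  val_inv := by
    ext i j
    fin_cases i <;> fin_cases j <;> simp [Matrix.mul_apply, Fin.sum_univ_two, mul_assoc]
  inv_val := by
    ext i j
    fin_cases i <;> fin_cases j <;> simp [Matrix.mul_apply, Fin.sum_univ_two, mul_assoc]

/-- The matrix `(0 1; 1 0)`. -/
def swapK : GL (Fin 2) O where
  val := !![0, 1; 1, 0]
  inv := !![0, 1; 1, 0]
  val_inv := by
    ext i j
    fin_cases i <;> fin_cases j <;> simp [Matrix.mul_apply, Fin.sum_univ_two]
  inv_val := by
    ext i j
    fin_cases i <;> fin_cases j <;> simp [Matrix.mul_apply, Fin.sum_univ_two]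

theorem coe_upperK (a d : Oˣ) (b : O) :
    (upperK a d b : Matrix (Fin 2) (Fin 2) O) = !![(a : O), b; 0, (d : O)] := rfl

theorem coe_swapK : ((swapK : GL (Fin 2) O) : Matrix (Fin 2) (Fin 2) O) = !![0, 1; 1, 0] := rfl

theorem swapK_mul_self : swapK * swapK = (1 : GL (Fin 2) O) := Units.ext swapK.mul_inv

theorem exists_eq_upperK {κ : GL (Fin 2) O} (h : κ 1 0 = 0) : ∃ a d b, κ = upperK a d b := by
  have hd : IsUnit (κ 0 0 * κ 1 1) := by
    have := (Matrix.isUnit_iff_isUnit_det _).1 κ.isUnit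
    rwa [Matrix.det_fin_two, h, mul_zero, sub_zero] at this
  obtain ⟨a, ha⟩ := isUnit_of_mul_isUnit_left hd
  obtain ⟨d, hd⟩ := isUnit_of_mul_isUnit_right hd
  refine ⟨a, d, κ 0 1, ?_⟩
  ext i j
  fin_cases i <;> fin_cases j <;> simp [coe_upperK, ha, hd, h]

/-- `GL₂` of a local ring is generated by the upper triangular matrices and `(0 1; 1 0)`. -/
theorem gl2_induction [IsLocalRing O] {P : GL (Fin 2) O → Prop}
    (hu : ∀ a d b, P (upperK a d b)) (hs : P swapK) (hm : ∀ g h, P g → P h → P (g * h))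
    (κ : GL (Fin 2) O) : P κ := by
  have key : ∀ κ : GL (Fin 2) O, IsUnit (κ 1 0) → P κ := by
    rintro κ ⟨c, hc⟩
    -- One row operation clears the upper left entry when the lower left one is a unit, and the swap
    -- makes the result upper triangular. If the lower left entry is not a unit, the lower right one
    -- is, and multiplication by `swapK` on the right reduces to this case.
    have h1 : (swapK * upperK 1 1 (-(κ 0 0 * (c⁻¹ : Oˣ))) * κ : GL (Fin 2) O) 1 0 = 0 := by
      simp [coe_upperK, coe_swapK, Matrix.mul_apply, Fin.sum_univ_two, ← hc]
    obtain ⟨a, d, b, h⟩ := exists_eq_upperK h1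
    have h2 : κ = upperK 1 1 (κ 0 0 * (c⁻¹ : Oˣ)) * (swapK * upperK a d b) := by
      rw [← h]
      simp only [← mul_assoc]
      rw [mul_assoc (upperK 1 1 _) swapK swapK]
      have h4 : upperK 1 1 (κ 0 0 * (c⁻¹ : Oˣ)) * upperK 1 1 (-(κ 0 0 * (c⁻¹ : Oˣ))) = 1 := by
        ext i j
        fin_cases i <;> fin_cases j <;> simp [coe_upperK, Matrix.mul_apply, Fin.sum_univ_two]
      rw [swapK_mul_self, mul_one, h4, one_mul]
    rw [h2]
    exact hm _ _ (hu _ _ _) (hm _ _ hs (hu _ _ _))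
  by_cases h : IsUnit (κ 1 0)
  · exact key κ h
  · have hd : IsUnit (κ 1 1) := by
      have hdet := (Matrix.isUnit_iff_isUnit_det _).1 κ.isUnit
      rw [Matrix.det_fin_two, sub_eq_add_neg] at hdet
      rcases IsLocalRing.isUnit_or_isUnit_of_isUnit_add hdet with h' | h'
      · exact isUnit_of_mul_isUnit_right h'
      · rw [IsUnit.neg_iff] at h'
        exact absurd (isUnit_of_mul_isUnit_right h') h
    have h5 : κ = (κ * swapK) * swapK := by
      rw [mul_assoc, swapK_mul_self, mul_one]
    rw [h5]
    refine hm _ _ (key _ ?_) hs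
    simpa [coe_swapK, Matrix.mul_apply, Fin.sum_univ_two] using hd

/-- A multiplicative section of the reduction map that is additive modulo `π²`. -/
structure IsTeichmullerLift [IsLocalRing O] (π : O) (T : ResidueField O →* O) : Prop where
  residue_apply : ∀ a, residue O (T a) = a
  sq_dvd : ∀ a b, π ^ 2 ∣ T a + T b - T (a + b)

theorem IsTeichmullerLift.map_zero [IsLocalRing O] [IsDomain O] {π : O} {T : ResidueField O →* O}
    (hT : IsTeichmullerLift π T) : T 0 = 0 := by
  have h : T 0 * (T 0 - 1) = 0 := by
    rw [mul_sub, ← map_mul, mul_zero, mul_one, sub_self]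
  refine (mul_eq_zero.1 h).resolve_right fun h1 => ?_
  have h2 := hT.residue_apply 0
  rw [sub_eq_zero.1 h1, _root_.map_one] at h2
  exact one_ne_zero h2

variable [IsDomain O] [IsDiscreteValuationRing O]

theorem residue_eq_zero_iff_dvd {π : O} (hπ : Irreducible π) (x : O) :
    residue O x = 0 ↔ π ∣ x := by
  rw [IsLocalRing.residue_eq_zero_iff, hπ.maximalIdeal_eq, Ideal.mem_span_singleton]

/-- Write `a` and `b` as Teichmüller lifts plus `π a'` and `π b'`. Additivity modulo `π²`
contributes only a multiple of `π` to `x`, so its residue is that of `b' + a' T μ`. -/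
theorem IsTeichmullerLift.affine {π : O} {T : ResidueField O →* O}
    (hT : IsTeichmullerLift π T) (hπ : Irreducible π) (a b : O) :
    ∃ β₀ β₁ : ResidueField O, ∀ μ, ∃ x : O,
      a * T μ + b = T (residue O a * μ + residue O b) + π * x ∧ residue O x = β₀ + β₁ * μ := by
  have h : ∀ y : O, ∃ z, y = T (residue O y) + π * z := fun y => by
    obtain ⟨z, hz⟩ := (residue_eq_zero_iff_dvd hπ (y - T (residue O y))).1
      (by rw [map_sub, hT.residue_apply, sub_self])
    exact ⟨z, by rw [← hz]; ring⟩
  obtain ⟨a', ha⟩ := h a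
  obtain ⟨b', hb⟩ := h b
  refine ⟨residue O b', residue O a', fun μ => ?_⟩
  obtain ⟨y, hy⟩ := hT.sq_dvd (residue O a * μ) (residue O b)
  refine ⟨b' + a' * T μ + π * y, ?_, ?_⟩
  · rw [map_mul] at hy
    linear_combination hy + T μ * ha + hb
  · rw [map_add, map_add, map_mul, map_mul, hT.residue_apply,
      (residue_eq_zero_iff_dvd hπ π).2 dvd_rfl]
    ring

end Integral

variable {O : Type*} [CommRing O] [IsDomain O] [IsDiscreteValuationRing O]
  (F : Type*) [Field F] [Algebra O F] [IsFractionRing O F]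

theorem coe_toG (κ : GL (Fin 2) O) (i j : Fin 2) : toG O F κ i j = algebraMap O F (κ i j) := rfl

theorem coe_gMat {π : O} (hπ : Irreducible π) (n : ℕ) (μ : O) :
    (gMat F hπ n μ : Matrix (Fin 2) (Fin 2) F) =
      !![algebraMap O F π ^ n, algebraMap O F μ; 0, 1] := rfl

/-- The translation `(a M + b) / d` of the parameter splits into a new representative `N` and a
carry `x`; the carry becomes a unipotent factor acting on `ξ`. -/
theorem upperK_mul_gMat_one {π : O} (hπ : Irreducible π) (a d : Oˣ) (b M N x : O)
    (h : (a * (d⁻¹ : Oˣ)) * M + b * (d⁻¹ : Oˣ) = N + π * x) :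
    toG O F (upperK a d b) * gMat F hπ 1 M =
      gMat F hπ 1 N * (toG O F (upperK 1 1 x) * toG O F (upperK a d 0)) := by
  have h1 : a * M + b = N * d + π * x * d := by
    have hd : ((d⁻¹ : Oˣ) : O) * d = 1 := d.inv_mul
    linear_combination (d : O) * h - (a * M + b) * hd
  have h2 := congrArg (algebraMap O F) h1
  simp only [map_add, map_mul] at h2
  ext i j
  fin_cases i <;> fin_cases j <;>
    simp [Matrix.mul_apply, Fin.sum_univ_two, coe_toG, coe_upperK, coe_gMat]
  · ring
  · linear_combination h2

theorem upperK_mul_swapK_mul_gMat {π : O} (hπ : Irreducible π) (a d : Oˣ) (b : O) :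
    toG O F (upperK a d b) * (toG O F swapK * gMat F hπ 1 0) =
      toG O F swapK * gMat F hπ 1 0 *
        toG O F (swapK * upperK a d (π * b) * swapK) := by
  ext i j
  fin_cases i <;> fin_cases j <;>
    simp [Matrix.mul_apply, Fin.sum_univ_two, coe_toG, coe_upperK, coe_gMat, coe_swapK, mul_comm]

theorem swapK_mul_gMat_one {π : O} (hπ : Irreducible π) (M : Oˣ) :
    toG O F swapK * gMat F hπ 1 M =
      gMat F hπ 1 (M⁻¹ : Oˣ) * toG O F (swapK * upperK M (-M⁻¹) π * swapK) := by
  ext i j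
  fin_cases i <;> fin_cases j <;>
    simp [Matrix.mul_apply, Fin.sum_univ_two, coe_toG, coe_upperK, coe_gMat, coe_swapK]
  ring

theorem toG_swapK_mul_self : toG O F swapK * toG O F swapK = 1 := by
  rw [← map_mul, swapK_mul_self, map_one]

theorem gMat_one_mul {π : O} (hπ : Irreducible π) (n : ℕ) (μ ν : O) :
    gMat F hπ 1 μ * gMat F hπ n ν = gMat F hπ (n + 1) (μ + π * ν) := by
  ext i j
  fin_cases i <;> fin_cases j <;>
    simp [Matrix.mul_apply, Fin.sum_univ_two, coe_gMat, pow_succ']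
  ring

end GroupElements
end GL2ModP

namespace GL2ModP

/-! ### The map `Ψ` from a weight to a representation of `GL₂(F)` -/

section Psi
open IsLocalRing

variable {O : Type*} [CommRing O] [IsDomain O] [IsDiscreteValuationRing O]
  {F : Type*} [Field F] [Algebra O F] [IsFractionRing O F]
  {E : Type*} [Field E] {p : ℕ} [CharP E p] [Fact p.Prime]
  [Algebra (ResidueField O) E] {f : ℕ} {V : Type*} [AddCommGroup V] [Module E V]

variable (O E) in
/-- The map `O → E` through the residue field. -/
noncomputable def resHom : O →+* E := (algebraMap (ResidueField O) E).comp (residue O)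

variable (O E) in
/-- The reduction `GL₂(O) → GL₂(E)`. -/
noncomputable def redGL : GL (Fin 2) O →* GL (Fin 2) E :=
  Matrix.GeneralLinearGroup.map (resHom O E)

theorem coe_redGL (κ : GL (Fin 2) O) (i j : Fin 2) : redGL O E κ i j = resHom O E (κ i j) := rfl

theorem redGL_upperK (a d : Oˣ) (b : O) :
    (redGL O E (upperK a d b) : Matrix (Fin 2) (Fin 2) E) =
      !![resHom O E a, resHom O E b; 0, resHom O E d] := by
  ext i j
  rw [coe_redGL]
  fin_cases i <;> fin_cases j <;> simp [coe_upperK]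

theorem redGL_swapK :
    (redGL O E swapK : Matrix (Fin 2) (Fin 2) E) = !![0, 1; 1, 0] := by
  ext i j
  rw [coe_redGL]
  fin_cases i <;> fin_cases j <;> simp [coe_swapK]

variable [Fintype (ResidueField O)]

variable (E p) in
/-- The linear map that sends `u` to
`∑_μ u(1, -μ) (π [μ]; 0 1) ξ + (-1)^w u(0, 1) (0 1; π 0) ξ`. -/
noncomputable def psi (ρ : Representation E (GL (Fin 2) F) V) {π : O} (hπ : Irreducible π)
    (T : ResidueField O →* O) (w : ℕ) (r : Fin f → ℕ) (ξ : V) : SymType E r →ₗ[E] V :=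
  ∑ μ : ResidueField O, (symEval E p r 1 (-algebraMap _ E μ)).smulRight (ρ (gMat F hπ 1 (T μ)) ξ) +
    (-1 : E) ^ w • (symEval E p r 0 1).smulRight (ρ (toG O F swapK * gMat F hπ 1 0) ξ)

variable (ρ : Representation E (GL (Fin 2) F) V) {π : O} (hπ : Irreducible π)
    {T : ResidueField O →* O} (w : ℕ) (r : Fin f → ℕ) (ξ : V)

variable (p T) in
theorem psi_apply (u : SymType E r) : psi E p ρ hπ T w r ξ u =
    ∑ μ : ResidueField O, symEval E p r 1 (-algebraMap _ E μ) u • ρ (gMat F hπ 1 (T μ)) ξ +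
    ((-1 : E) ^ w * symEval E p r 0 1 u) • ρ (toG O F swapK * gMat F hπ 1 0) ξ := by
  simp [psi, mul_smul]

variable (p T) in
theorem psi_symVec_zero (hr : r ≠ 0) :
    psi E p ρ hπ T w r ξ (symVec E r 0 fun _ => Nat.zero_le _) =
      ∑ μ : ResidueField O, ρ (gMat F hπ 1 (T μ)) ξ := by
  rw [psi_apply, symEval_zero_one E p r 0 _ hr.symm]
  simp [symEval_symVec, digitSum]

/-- The elements of `GL₂(O)` that are diagonal modulo the maximal ideal act on `ξ` in the same way
as on the highest weight vector of `det^w ⊗ ⨂_j Sym_j^{r_j}`. -/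
def IsDiagEigen (p : ℕ) (ρ : Representation E (GL (Fin 2) F) V) (w : ℕ) (r : Fin f → ℕ) (ξ : V) :
    Prop :=
  ∀ κ : GL (Fin 2) O, residue O (κ 0 1) = 0 → residue O (κ 1 0) = 0 →
    ρ (toG O F κ) ξ = ((resHom O E (κ 0 0) * resHom O E (κ 1 1)) ^ w *
      resHom O E (κ 0 0) ^ digitSum p r) • ξ

/-- Unipotent matrices with a top right entry that is an affine function of `μ` modulo `π` may be
removed from `∑_μ u(1, -μ) (π [μ]; 0 1) (1 x_μ; 0 1) ξ` modulo `Y`. -/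
def UnipotentInvariant (p : ℕ) (ρ : Representation E (GL (Fin 2) F) V) {π : O}
    (hπ : Irreducible π) (T : ResidueField O →* O) (r : Fin f → ℕ) (ξ : V) (Y : Submodule E V) :
    Prop :=
  ∀ (x : ResidueField O → O) (β₀ β₁ : ResidueField O), (∀ μ, residue O (x μ) = β₀ + β₁ * μ) →
    ∀ u : SymType E r, ∑ μ : ResidueField O, symEval E p r 1 (-algebraMap _ E μ) u •
      ρ (gMat F hπ 1 (T μ)) (ρ (toG O F (upperK 1 1 (x μ))) ξ - ξ) ∈ Y

variable {ρ w r ξ}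

/-- The matrix acts on the affine line by `μ ↦ (A μ + B) / D` and fixes the point at infinity. The
homogeneity of `u` produces exactly the scalar by which the diagonal part acts on `ξ`, so the
carries are the only discrepancy. -/
theorem psi_upperK (hT : IsTeichmullerLift π T) (Y : Submodule E V)
    (h1 : IsDiagEigen (O := O) p ρ w r ξ) (h2 : UnipotentInvariant p ρ hπ T r ξ Y)
    (a d : Oˣ) (b : O) (u : SymType E r) :
    ρ (toG O F (upperK a d b)) (psi E p ρ hπ T w r ξ u) -
      psi E p ρ hπ T w r ξ (symRep E p w r (redGL O E (upperK a d b)) u) ∈ Y := by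
  have ha : residue O a ≠ 0 := (a.isUnit.map (residue O)).ne_zero
  have hd : residue O d ≠ 0 := (d.isUnit.map (residue O)).ne_zero
  have hdi : residue O (d⁻¹ : Oˣ) = (residue O d)⁻¹ := by simp
  obtain ⟨β₀, β₁, hβ⟩ := hT.affine hπ (a * (d⁻¹ : Oˣ)) (b * (d⁻¹ : Oˣ))
  choose x hx hxr using hβ
  set A := residue O a with hA
  set B := residue O b with hB
  set D := residue O d with hD
  simp only [map_mul, hdi, ← hA, ← hB] at hx
  let σ : Equiv.Perm (ResidueField O) :=
    { toFun := fun μ => A * D⁻¹ * μ + B * D⁻¹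
      invFun := fun ν => (D * ν - B) * A⁻¹
      left_inv := fun μ => by
        change (D * (A * D⁻¹ * μ + B * D⁻¹) - B) * A⁻¹ = μ
        field_simp
        ring
      right_inv := fun ν => by
        change A * D⁻¹ * ((D * ν - B) * A⁻¹) + B * D⁻¹ = ν
        field_simp
        ring }
  set κu := symRep E p w r (redGL O E (upperK a d b)) u with hκu
  have hev : ∀ c e : E, symEval E p r c e κu =
      (resHom O E a * resHom O E d) ^ w *
        symEval E p r (c * resHom O E a) (c * resHom O E b + e * resHom O E d) u := fun c e => by
    rw [hκu, symEval_symRep, redGL_upperK, Matrix.det_fin_two]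
    simp
  have hterm : ∀ μ, symEval E p r 1 (-algebraMap _ E μ) u •
      ρ (toG O F (upperK a d b)) (ρ (gMat F hπ 1 (T μ)) ξ) =
        symEval E p r 1 (-algebraMap _ E (σ μ)) κu • ρ (gMat F hπ 1 (T (σ μ)))
          (ρ (toG O F (upperK 1 1 (x (σ.symm (σ μ))))) ξ) := fun μ => by
    have hs : -(algebraMap (ResidueField O) E μ) * resHom O E a =
        1 * resHom O E b + -algebraMap _ E (σ μ) * resHom O E d := by
      change -(algebraMap (ResidueField O) E μ) * algebraMap _ E A =
        1 * algebraMap _ E B + -algebraMap _ E (σ μ) * algebraMap _ E D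
      have : σ μ * D = A * μ + B := by
        change (A * D⁻¹ * μ + B * D⁻¹) * D = _
        field_simp
      rw [one_mul, neg_mul, neg_mul, ← map_mul, ← map_mul, this, map_add, mul_comm μ]
      ring
    rw [hev, ← hs, one_mul, mul_comm _ (resHom O E a), σ.symm_apply_apply]
    have h3 := symEval_smul E p r (resHom O E a) 1 (-algebraMap _ E μ) u
    rw [mul_one] at h3
    rw [h3, ← Module.End.mul_apply, ← map_mul,
      upperK_mul_gMat_one F hπ a d b (T μ) (T (σ μ)) (x μ) (hx μ), map_mul, map_mul,
      Module.End.mul_apply, Module.End.mul_apply, h1 (upperK a d 0) (by simp [coe_upperK])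
      (by simp [coe_upperK]), map_smul, map_smul, smul_smul]
    congr 1
    simp only [coe_upperK, Matrix.of_apply, Matrix.cons_val_zero, Matrix.cons_val_one]
    ring
  -- At infinity the matrix becomes lower triangular and diagonal modulo `π`, so this term matches
  -- exactly.
  have hinf : ρ (toG O F (upperK a d b)) (((-1 : E) ^ w * symEval E p r 0 1 u) •
      ρ (toG O F swapK * gMat F hπ 1 0) ξ) =
        ((-1 : E) ^ w * symEval E p r 0 1 κu) • ρ (toG O F swapK * gMat F hπ 1 0) ξ := by
    have hlow : ((swapK * upperK a d (π * b) * swapK : GL (Fin 2) O) :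
        Matrix (Fin 2) (Fin 2) O) = !![(d : O), 0; π * b, (a : O)] := by
      ext i j
      fin_cases i <;> fin_cases j <;>
        simp [Matrix.mul_apply, Fin.sum_univ_two, coe_upperK, coe_swapK]
    have h3 := symEval_smul E p r (resHom O E d) 0 1 u
    rw [mul_one, mul_zero] at h3
    rw [map_smul, ← Module.End.mul_apply, ← map_mul, upperK_mul_swapK_mul_gMat F hπ a d b,
      map_mul ρ (_ * _) (toG O F _), Module.End.mul_apply, h1 _ (by simp [hlow]) (by
        rw [hlow]
        simpa using Or.inl hπ.not_isUnit), map_smul, smul_smul, hev, zero_mul, zero_mul, zero_add,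
      one_mul, h3]
    congr 1
    simp only [hlow, Matrix.of_apply, Matrix.cons_val_zero, Matrix.cons_val_one,
      Matrix.cons_val', Matrix.cons_val_fin_one]
    ring
  have hsum := Equiv.sum_comp σ fun ν => symEval E p r 1 (-algebraMap _ E ν) κu •
    ρ (gMat F hπ 1 (T ν)) (ρ (toG O F (upperK 1 1 (x (σ.symm ν)))) ξ)
  rw [psi_apply, psi_apply, map_add, map_sum, hinf, add_sub_add_right_eq_sub]
  simp only [map_smul]
  rw [Finset.sum_congr rfl fun μ _ => hterm μ, hsum, ← Finset.sum_sub_distrib]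
  -- The carry remains affine in the new variable `ν`, since `σ⁻¹ ν = (D ν - B) / A`.
  have := h2 (fun ν => x (σ.symm ν)) (β₀ - β₁ * B * A⁻¹) (β₁ * D * A⁻¹) (fun ν => by
    rw [hxr]
    change β₀ + β₁ * ((D * ν - B) * A⁻¹) = _
    ring) κu
  simpa only [map_sub, smul_sub] using this

/-- The swap exchanges `0` and infinity and inverts the other points. Multiplicativity gives `[μ]⁻¹
= [μ⁻¹]`, so no carry occurs; the sign `(-1)^w` in `psi` compensates for the determinant `-1` of the
swap. -/
theorem psi_swapK (hT : IsTeichmullerLift π T) (h1 : IsDiagEigen (O := O) p ρ w r ξ)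
    (u : SymType E r) :
    ρ (toG O F swapK) (psi E p ρ hπ T w r ξ u) =
      psi E p ρ hπ T w r ξ (symRep E p w r (redGL O E swapK) u) := by
  classical
  have hev : ∀ c e : E, symEval E p r c e (symRep E p w r (redGL O E swapK) u) =
      (-1 : E) ^ w * symEval E p r e c u := fun c e => by
    rw [symEval_symRep, redGL_swapK, Matrix.det_fin_two]
    simp
  have hm1 : ((-1 : E) ^ w) * (-1 : E) ^ w = 1 := by
    rw [← mul_pow]; simp
  have hz : ∀ g : ResidueField O → V,
      ∑ μ, g μ = g 0 + ∑ μ : (ResidueField O)ˣ, g μ := fun g => by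
    rw [← Finset.add_sum_erase _ _ (Finset.mem_univ 0)]
    congr 1
    refine Finset.sum_bij' (fun μ hμ => Units.mk0 μ (Finset.ne_of_mem_erase hμ))
      (fun μ _ => μ.1) ?_ ?_ ?_ ?_ ?_ <;> simp
  rw [psi_apply, psi_apply, map_add, map_sum, hz, hz]
  simp only [map_smul]
  have h00 : ρ (toG O F swapK) (ρ (toG O F swapK * gMat F hπ 1 0) ξ) =
      ρ (gMat F hπ 1 (T 0)) ξ := by
    rw [hT.map_zero, ← Module.End.mul_apply, ← map_mul, ← mul_assoc, toG_swapK_mul_self, one_mul]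
  have h0 : ρ (toG O F swapK) (ρ (gMat F hπ 1 (T 0)) ξ) =
      ρ (toG O F swapK * gMat F hπ 1 0) ξ := by
    rw [hT.map_zero, map_mul]; rfl
  have hterm : ∀ μ : (ResidueField O)ˣ, symEval E p r 1 (-algebraMap _ E (μ : ResidueField O)) u •
      ρ (toG O F swapK) (ρ (gMat F hπ 1 (T μ)) ξ) =
        symEval E p r 1 (-algebraMap _ E ((μ⁻¹ : (ResidueField O)ˣ) : ResidueField O))
          (symRep E p w r (redGL O E swapK) u) •
            ρ (gMat F hπ 1 (T (μ⁻¹ : (ResidueField O)ˣ))) ξ := fun μ => by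
    set M : Oˣ := Units.map T μ with hM
    have hMr : resHom O E M = algebraMap _ E (μ : ResidueField O) := by
      change algebraMap _ E (residue O (T μ)) = _
      rw [hT.residue_apply]
    have hMi : T (μ⁻¹ : (ResidueField O)ˣ) = (M⁻¹ : Oˣ) := by
      rw [hM, ← map_inv]; rfl
    have hlow : ((swapK * upperK M (-M⁻¹) π * swapK : GL (Fin 2) O) :
        Matrix (Fin 2) (Fin 2) O) = !![-((M⁻¹ : Oˣ) : O), 0; π, (M : O)] := by
      ext i j
      fin_cases i <;> fin_cases j <;>
        simp [Matrix.mul_apply, Fin.sum_univ_two, coe_upperK, coe_swapK]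
    have hMM : resHom O E (M⁻¹ : Oˣ) * resHom O E M = 1 := by
      rw [← map_mul, Units.inv_mul, map_one]
    have hMI : algebraMap _ E ((μ⁻¹ : (ResidueField O)ˣ) : ResidueField O) =
        resHom O E (M⁻¹ : Oˣ) := by
      rw [← hMi]
      change _ = algebraMap _ E (residue O (T _))
      rw [hT.residue_apply]
    have h3 := symEval_smul E p r (-resHom O E (M⁻¹ : Oˣ)) 1 (-algebraMap _ E (μ : ResidueField O)) u
    rw [mul_one, neg_mul_neg, ← hMr, hMM] at h3
    rw [← Module.End.mul_apply, ← map_mul, show T μ = M from rfl, swapK_mul_gMat_one F hπ M,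
      map_mul ρ, Module.End.mul_apply, h1 _ (by simp [hlow]) (by
        rw [hlow]
        simpa using hπ.not_isUnit), map_smul, smul_smul, hev, hMI, ← hMr, h3, hMi]
    congr 1
    simp only [hlow, Matrix.of_apply, Matrix.cons_val_zero, Matrix.cons_val_one,
      Matrix.cons_val', Matrix.cons_val_fin_one, map_neg, neg_mul, hMM]
    ring
  have hinv := Equiv.sum_comp (Equiv.inv (ResidueField O)ˣ) fun μ =>
    symEval E p r 1 (-algebraMap _ E (μ : ResidueField O)) (symRep E p w r (redGL O E swapK) u) •
      ρ (gMat F hπ 1 (T μ)) ξ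
  rw [Finset.sum_congr rfl fun μ _ => hterm μ, h00, h0]
  simp only [Equiv.inv_apply] at hinv
  rw [hinv]
  simp only [hev, map_zero, neg_zero]
  rw [← mul_assoc, hm1, one_mul]
  abel

/-- Equivariance modulo a `K`-stable `Y` is preserved under products, so it suffices to check the
generators of `GL₂(O)`. -/
theorem psi_equivariant (hT : IsTeichmullerLift π T) (Y : Submodule E V)
    (hY : ∀ κ : GL (Fin 2) O, ∀ y ∈ Y, ρ (toG O F κ) y ∈ Y)
    (h1 : IsDiagEigen (O := O) p ρ w r ξ) (h2 : UnipotentInvariant p ρ hπ T r ξ Y)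
    (κ : GL (Fin 2) O) (u : SymType E r) :
    ρ (toG O F κ) (psi E p ρ hπ T w r ξ u) -
      psi E p ρ hπ T w r ξ (symRep E p w r (redGL O E κ) u) ∈ Y := by
  revert u
  refine gl2_induction (P := fun κ => ∀ u, ρ (toG O F κ) (psi E p ρ hπ T w r ξ u) -
      psi E p ρ hπ T w r ξ (symRep E p w r (redGL O E κ) u) ∈ Y)
    (fun a d b => psi_upperK hπ hT Y h1 h2 a d b) (fun u => ?_) (fun g h hg hh u => ?_) κ
  · rw [psi_swapK hπ hT h1, sub_self]
    exact Y.zero_mem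
  · have h3 := Y.add_mem (hY g _ (hh u)) (hg (symRep E p w r (redGL O E h) u))
    rw [map_sub, sub_add_sub_cancel] at h3
    simpa only [map_mul, Module.End.mul_apply] using h3

end Psi
end GL2ModP

namespace GL2ModP

/-! ### Elements of compact inductions -/

section CompactInd

variable {G E V : Type*} [Group G] [Field E] [AddCommGroup V] [Module E V]
  {H : Subgroup G} (σ : Representation E H V)

theorem compactInd_apply (g x : G) (φ : compactIndSpace σ) :
    (compactInd σ g φ).1 x = φ.1 (x * g) := rfl

open scoped Classical in
theorem compactIndMk_apply (g x : G) (v : V) :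
    (compactIndMk σ g v).1 x = if hx : x * g ∈ H then σ ⟨x * g, hx⟩ v else 0 := rfl

theorem compactIndMk_apply_inv (g : G) (v : V) : (compactIndMk σ g v).1 g⁻¹ = v := by
  rw [compactIndMk_apply, dif_pos (by simp : g⁻¹ * g ∈ H)]
  have : (⟨g⁻¹ * g, by simp⟩ : H) = 1 := Subtype.ext (inv_mul_cancel g)
  rw [this, map_one]
  rfl

theorem compactIndMk_apply_of_notMem {g x : G} (h : x * g ∉ H) (v : V) :
    (compactIndMk σ g v).1 x = 0 := by
  rw [compactIndMk_apply, dif_neg h]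

/-- `v ↦ g ⊗ v` as a linear map. -/
noncomputable def compactIndMkHom (g : G) : V →ₗ[E] compactIndSpace σ where
  toFun := compactIndMk σ g
  map_add' v v' := by
    apply Subtype.ext
    funext x
    change (compactIndMk σ g (v + v')).1 x = (compactIndMk σ g v).1 x + (compactIndMk σ g v').1 x
    simp only [compactIndMk_apply]
    split_ifs <;> simp
  map_smul' c v := by
    apply Subtype.ext
    funext x
    change (compactIndMk σ g (c • v)).1 x = c • (compactIndMk σ g v).1 x
    simp only [compactIndMk_apply]
    split_ifs <;> simp

theorem compactInd_compactIndMkHom (g h : G) (v : V) :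
    compactInd σ g (compactIndMkHom σ h v) = compactIndMkHom σ (g * h) v := by
  apply Subtype.ext
  funext x
  change (compactIndMk σ h v).1 (x * g) = (compactIndMk σ (g * h) v).1 x
  by_cases hx : x * g * h ∈ H
  · rw [compactIndMk_apply, compactIndMk_apply, dif_pos hx, dif_pos (by rwa [← mul_assoc])]
    congr 3
    exact mul_assoc _ _ _
  · rw [compactIndMk_apply_of_notMem σ hx, compactIndMk_apply_of_notMem σ (by rwa [← mul_assoc])]

theorem compactIndMkHom_mul (g : G) (h : H) (v : V) :
    compactIndMkHom σ (g * h) v = compactIndMkHom σ g (σ h v) := by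
  apply Subtype.ext
  funext x
  change (compactIndMk σ (g * h) v).1 x = (compactIndMk σ g (σ h v)).1 x
  have hiff : x * (g * h) ∈ H ↔ x * g ∈ H := by rw [← mul_assoc, H.mul_mem_cancel_right h.2]
  by_cases hx : x * g ∈ H
  · rw [compactIndMk_apply, compactIndMk_apply, dif_pos hx, dif_pos (hiff.2 hx),
      ← Module.End.mul_apply, ← map_mul]
    congr 3
    exact (mul_assoc _ _ _).symm
  · rw [compactIndMk_apply_of_notMem σ hx, compactIndMk_apply_of_notMem σ (mt hiff.1 hx)]

theorem compactInd_one_mk (h : H) (v : V) :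
    compactInd σ h (compactIndMkHom σ 1 v) = compactIndMkHom σ 1 (σ h v) := by
  rw [compactInd_compactIndMkHom, mul_one, ← compactIndMkHom_mul, one_mul]

end CompactInd

/-! ### The maps `Ψ_i` into the compact induction of a weight -/

section WeightAction
open IsLocalRing

variable {O : Type*} [CommRing O] [IsDomain O] [IsDiscreteValuationRing O]
  {F : Type*} [Field F] [Algebra O F] [IsFractionRing O F]
  {E : Type*} [Field E] {p : ℕ} [CharP E p] [Fact p.Prime]
  [Algebra (ResidueField O) E] {f : ℕ}
  {π : O} (hπ : Irreducible π) (w : ℕ) (r : Fin f → ℕ)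

theorem toG_mem_subgroupKZ (κ : GL (Fin 2) O) : toG O F κ ∈ subgroupKZ O F :=
  (le_sup_left : subgroupK O F ≤ subgroupKZ O F) ⟨κ, rfl⟩

theorem weightKZ_apply (g : subgroupKZ O F) (n : ℤ) (κ : GL (Fin 2) O)
    (h : (g : GL (Fin 2) F) = centralG (unif F hπ ^ n) * toG O F κ) :
    weightKZ E p F hπ w r g = symRep E p w r (redGL O E κ) := by
  change symRep E p w r (redGL O E (projK hπ g)) = _
  rw [projK_eq hπ g n κ h]

theorem weightKZ_toG (κ : GL (Fin 2) O) :
    weightKZ E p F hπ w r ⟨toG O F κ, toG_mem_subgroupKZ κ⟩ = symRep E p w r (redGL O E κ) :=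
  weightKZ_apply hπ w r _ 0 κ (by simp [centralG_one])

theorem compactInd_toG_mk (κ : GL (Fin 2) O) (v : SymType E r) :
    compactInd (weightKZ E p F hπ w r) (toG O F κ) (compactIndMkHom _ 1 v) =
      compactIndMkHom _ 1 (symRep E p w r (redGL O E κ) v) := by
  rw [← weightKZ_toG (F := F) hπ w r κ]
  exact compactInd_one_mk _ (⟨toG O F κ, toG_mem_subgroupKZ κ⟩ : subgroupKZ O F) v

/-- A central element can be moved to the left of the argument, where it acts through the weight,
and powers of `π` act trivially there. -/
theorem compactInd_centralG (n : ℤ) (φ : compactIndSpace (weightKZ E p F hπ w r)) :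
    compactInd (weightKZ E p F hπ w r) (centralG (unif F hπ ^ n)) φ = φ := by
  have hmem : centralG (unif F hπ ^ n) ∈ subgroupKZ O F :=
    (mem_subgroupKZ_iff hπ _).2 ⟨1, n, by simp⟩
  apply Subtype.ext
  funext x
  rw [compactInd_apply, ← centralG_mul_comm]
  have := φ.2.1 ⟨_, hmem⟩ x
  rw [weightKZ_apply hπ w r _ n 1 (by simp), map_one, map_one] at this
  exact this

theorem symEnd_diag_symVec (g : Matrix (Fin 2) (Fin 2) E) (h01 : g 0 1 = 0) (h10 : g 1 0 = 0)
    (k : Fin f → ℕ) (hk : k ≤ r) :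
    symEnd E p r g (symVec E r k hk) =
      (g 0 0 ^ digitSum p (r - k) * g 1 1 ^ digitSum p k) • symVec E r k hk := by
  have hp := (Fact.out : p.Prime).ne_zero
  apply symType_ext
  simp only [map_smul, symVal_symEnd, symVal_symVec, map_prod, map_mul, map_pow, symSubst_X,
    h01, h10]
  rw [← prod_pow_mul_pow_digit, ← prod_pow_mul_pow_digit, MvPolynomial.smul_eq_C_mul, map_mul,
    map_prod, map_prod, ← Finset.prod_mul_distrib, ← Finset.prod_mul_distrib]
  refine Finset.prod_congr rfl fun j _ => ?_
  simp [hp]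
  ring

/-- The weight `r - 2k`. -/
abbrev subTwo (r k : Fin f → ℕ) : Fin f → ℕ := fun j => r j - 2 * k j

variable {w r}

/-- The torus weight of the `i`-th basis vector is `a^{r-i} d^i = (a d)^i a^{r-2i}`, which is where
the twist by `det^i` and the weight `r - 2i` come from. -/
theorem isDiagEigen_symVec (i : Fin f → ℕ) (hi : i ≤ r) (hi2 : ∀ j, 2 * i j ≤ r j) :
    IsDiagEigen (O := O) p (compactInd (weightKZ E p F hπ w r)) (w + digitSum p i) (subTwo r i)
      (compactIndMkHom _ 1 (symVec E r i hi)) := by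
  intro κ h01 h10
  have e01 : redGL O E κ 0 1 = 0 := by
    rw [coe_redGL, resHom, RingHom.comp_apply, h01, map_zero]
  have e10 : redGL O E κ 1 0 = 0 := by
    rw [coe_redGL, resHom, RingHom.comp_apply, h10, map_zero]
  have hd : digitSum p (r - i) = digitSum p i + digitSum p (subTwo r i) := by
    rw [← digitSum_add]
    congr 1
    funext j
    have := hi2 j
    simp only [Pi.sub_apply, Pi.add_apply]
    lia
  rw [compactInd_toG_mk, ← map_smul]
  congr 1
  change (redGL O E κ : Matrix (Fin 2) (Fin 2) E).det ^ w • symEnd E p r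
    (redGL O E κ : Matrix (Fin 2) (Fin 2) E) (symVec E r i hi) = _
  rw [symEnd_diag_symVec r _ e01 e10, smul_smul, Matrix.det_fin_two, e01, hd, coe_redGL, coe_redGL]
  congr 1
  ring

-- Since `r - 2i = (r - 2k) + 2(k - i)`, there is room to multiply `u` by the `(k - i)`-th powers of
-- twisted linear forms and also of the `x_j`. The linear forms give the affine factor; the powers
-- of `x_j` do nothing at `(1, e)` and vanish at `(0, 1)`, so the term at infinity disappears.
open MvPolynomial in
theorem exists_symEval_eq_mul_affine {i k : Fin f → ℕ} (hik : i < k) (hk2 : ∀ j, 2 * k j ≤ r j)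
    (u : SymType E (subTwo r k)) (b₀ b₁ : E) :
    ∃ u' : SymType E (subTwo r i),
      (∀ e, symEval E p _ 1 e u' = symEval E p _ 1 e u * (b₀ + b₁ * e) ^ digitSum p (k - i)) ∧
      symEval E p _ 0 1 u' = 0 := by
  have hp := (Fact.out : p.Prime).ne_zero
  let Q : MvPolynomial (Fin f × Fin 2) E :=
    ∏ j : Fin f, (C (b₀ ^ p ^ (j : ℕ)) * X (j, 0) + C (b₁ ^ p ^ (j : ℕ)) * X (j, 1)) ^ (k - i) j *
      X (j, 0) ^ (k - i) j
  have hQ : IsWeightedHomogeneous multiDeg Q (∑ j : Fin f, ((k - i) j • Pi.single j 1 +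
      (k - i) j • Pi.single j 1)) := by
    refine IsWeightedHomogeneous.prod _ _ _ fun j _ => ?_
    have hX : ∀ t, IsWeightedHomogeneous multiDeg (X (j, t) : MvPolynomial (Fin f × Fin 2) E)
      (Pi.single j 1) := fun t => isWeightedHomogeneous_X E multiDeg (j, t)
    refine IsWeightedHomogeneous.mul (IsWeightedHomogeneous.pow ?_ _) ((hX 0).pow _)
    rw [← smul_eq_C_mul, ← smul_eq_C_mul]
    exact (weightedHomogeneousSubmodule E multiDeg (Pi.single j 1)).add_mem
      (Submodule.smul_mem _ _ (hX 0)) (Submodule.smul_mem _ _ (hX 1))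
  have hdeg : subTwo r k + ∑ j : Fin f, ((k - i) j • Pi.single j 1 + (k - i) j • Pi.single j 1) =
      subTwo r i := by
    funext l
    have h1 := hk2 l
    have h2 := hik.le l
    simp only [Pi.add_apply, Finset.sum_apply, Pi.smul_apply, Pi.single_apply, Pi.sub_apply,
      smul_eq_mul, mul_ite, mul_one, mul_zero, Finset.sum_add_distrib, Finset.sum_ite_eq,
      Finset.mem_univ, if_true]
    lia
  have hmem : symVal E _ u * Q ∈ symSpace E (subTwo r i) := by
    rw [← hdeg]
    exact IsWeightedHomogeneous.mul (symVal_mem E u) hQ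
  refine ⟨⟨symVal E _ u * Q, hmem⟩, fun e => ?_, ?_⟩
  · change pointEval E p 1 e (symVal E _ u * Q) = pointEval E p 1 e (symVal E _ u) * _
    rw [map_mul]
    congr 1
    rw [map_prod, ← prod_pow_mul_pow_digit]
    refine Finset.prod_congr rfl fun j _ => ?_
    simp [pointEval_X, add_pow_char_pow, mul_pow]
  · change pointEval E p 0 1 (symVal E _ u * Q) = 0
    obtain ⟨j, hj⟩ := (Pi.lt_def.1 hik).2
    rw [map_mul, map_prod, Finset.prod_eq_zero (Finset.mem_univ j), mul_zero]
    have : k j - i j ≠ 0 := by lia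
    simp [pointEval_X, hp, this]

variable [Fintype (ResidueField O)]

variable (E p F w) in
/-- The map `Ψ` for the element `1 ⊗ ⨂_j x_j^{r_j - i_j} y_j^{i_j}` of the compact induction. -/
noncomputable def psiInd (T : ResidueField O →* O) (i : Fin f → ℕ) (hi : i ≤ r) :
    SymType E (subTwo r i) →ₗ[E] compactIndSpace (weightKZ E p F hπ w r) :=
  psi E p (compactInd (weightKZ E p F hπ w r)) hπ T (w + digitSum p i) (subTwo r i)
    (compactIndMkHom _ 1 (symVec E r i hi))

/-- The difference of a unipotent translate of `ξ_k` and `ξ_k` involves only `ξ_i` with `i < k`. Its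
coefficients, powers of an affine function of `μ`, can be absorbed into `u`, and the result is a
value of `Ψ_i`. -/
theorem unipotentInvariant_symVec {T : ResidueField O →* O}
    {k : Fin f → ℕ} (hk : k ≤ r) (hk2 : ∀ j, 2 * k j ≤ r j)
    (Y : Submodule E (compactIndSpace (weightKZ E p F hπ w r)))
    (hY : ∀ (i : Fin f → ℕ) (hi : i < k) (u : SymType E (subTwo r i)),
      psiInd F E p hπ w T i (hi.le.trans hk) u ∈ Y) :
    UnipotentInvariant p (compactInd (weightKZ E p F hπ w r)) hπ T (subTwo r k)
      (compactIndMkHom _ 1 (symVec E r k hk)) Y := by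
  classical
  intro x β₀ β₁ hx u
  have hdiff : ∀ y : O, compactInd (weightKZ E p F hπ w r) (toG O F (upperK 1 1 y))
      (compactIndMkHom _ 1 (symVec E r k hk)) - compactIndMkHom _ 1 (symVec E r k hk) =
        ∑ i ∈ (Finset.univ : Finset (Below k)).erase ⟨k, le_rfl⟩,
          ((∏ j, ((k j).choose (i.1 j) : E)) * resHom O E y ^ digitSum p (k - i.1)) •
            compactIndMkHom _ 1 (symVec E r i.1 (i.2.trans hk)) := fun y => by
    rw [compactInd_toG_mk]
    change compactIndMkHom _ 1 ((redGL O E (upperK 1 1 y) : Matrix (Fin 2) (Fin 2) E).det ^ w •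
      symEnd E p r (redGL O E (upperK 1 1 y) : Matrix (Fin 2) (Fin 2) E) (symVec E r k hk)) - _ = _
    rw [redGL_upperK, Units.val_one, map_one, symEnd_upper_symVec, Matrix.det_fin_two]
    rw [← Finset.add_sum_erase _ _ (Finset.mem_univ (⟨k, le_rfl⟩ : Below k))]
    simp [digitSum]
  simp only [hdiff, map_sum, map_smul, Finset.smul_sum]
  rw [Finset.sum_comm]
  refine Submodule.sum_mem _ fun i hi => ?_
  have hik : i.1 < k := lt_of_le_of_ne i.2 fun h => Finset.ne_of_mem_erase hi (Subtype.ext h)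
  -- The second coefficient is `-β₁` because `u` is evaluated at `e = -μ`.
  obtain ⟨u', hu, hu0⟩ := exists_symEval_eq_mul_affine (p := p) hik hk2 u
    (algebraMap (ResidueField O) E β₀) (-algebraMap (ResidueField O) E β₁)
  have := Y.smul_mem (∏ j, ((k j).choose (i.1 j) : E)) (hY i.1 hik u')
  rw [psiInd, psi_apply, hu0, mul_zero, zero_smul, add_zero, Finset.smul_sum] at this
  convert this using 2 with μ
  rw [hu, smul_smul, smul_smul]
  congr 1
  have : resHom O E (x μ) = algebraMap _ E β₀ +
      -algebraMap _ E β₁ * -algebraMap (ResidueField O) E μ := by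
    rw [resHom, RingHom.comp_apply, hx, map_add, map_mul, neg_mul_neg]
  rw [this]
  ring

theorem psiInd_equivariant {T : ResidueField O →* O} (hT : IsTeichmullerLift π T)
    {k : Fin f → ℕ} (hk : k ≤ r) (hk2 : ∀ j, 2 * k j ≤ r j)
    (Y : Submodule E (compactIndSpace (weightKZ E p F hπ w r)))
    (hYK : ∀ κ : GL (Fin 2) O, ∀ y ∈ Y, compactInd (weightKZ E p F hπ w r) (toG O F κ) y ∈ Y)
    (hY : ∀ (i : Fin f → ℕ) (hi : i < k) (u : SymType E (subTwo r i)),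
      psiInd F E p hπ w T i (hi.le.trans hk) u ∈ Y)
    (κ : GL (Fin 2) O) (u : SymType E (subTwo r k)) :
    compactInd (weightKZ E p F hπ w r) (toG O F κ) (psiInd F E p hπ w T k hk u) -
      psiInd F E p hπ w T k hk
        (symRep E p (w + digitSum p k) (subTwo r k) (redGL O E κ) u) ∈ Y :=
  psi_equivariant hπ hT Y hYK (isDiagEigen_symVec hπ k hk hk2)
    (unipotentInvariant_symVec hπ hk hk2 Y hY) κ u

end WeightAction
end GL2ModP

namespace GL2ModP

section LowerSpan
open IsLocalRing

variable {O : Type*} [CommRing O] [IsDomain O] [IsDiscreteValuationRing O]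
  {F : Type*} [Field F] [Algebra O F] [IsFractionRing O F]
  {E : Type*} [Field E] {p : ℕ} [CharP E p] [Fact p.Prime]
  [Algebra (ResidueField O) E] {f : ℕ}
  {π : O} (hπ : Irreducible π) {w : ℕ} {r : Fin f → ℕ} [Fintype (ResidueField O)]

/-! ### The subspace `S = ∑_{i < k} Ψ_i` -/

/-- The multi-indices `i < k`. -/
abbrev StrictlyBelow (k : Fin f → ℕ) := {i : Fin f → ℕ // i < k}

instance finite_strictlyBelow (k : Fin f → ℕ) : Finite (StrictlyBelow k) :=
  (Set.finite_Iio k).to_subtype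

noncomputable instance fintype_strictlyBelow (k : Fin f → ℕ) : Fintype (StrictlyBelow k) :=
  Fintype.ofFinite _

open scoped Classical in
noncomputable instance decidableEq_strictlyBelow (k : Fin f → ℕ) :
    DecidableEq (StrictlyBelow k) := Classical.decEq _

variable (F E p w) in
/-- The sum of the maps `Ψ_i` for `i < k`. -/
noncomputable def psiSum (T : ResidueField O →* O) (k : Fin f → ℕ) (hk : k ≤ r) :
    ((i : StrictlyBelow k) → SymType E (subTwo r i.1)) →ₗ[E]
      compactIndSpace (weightKZ E p F hπ w r) :=
  ∑ i : StrictlyBelow k, psiInd F E p hπ w T i.1 (i.2.le.trans hk) ∘ₗ LinearMap.proj i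

theorem psiSum_apply (T : ResidueField O →* O) (k : Fin f → ℕ) (hk : k ≤ r)
    (u : (i : StrictlyBelow k) → SymType E (subTwo r i.1)) :
    psiSum F E p hπ w T k hk u =
      ∑ i : StrictlyBelow k, psiInd F E p hπ w T i.1 (i.2.le.trans hk) (u i) := by
  simp [psiSum]

theorem psiInd_mem_range_psiSum (T : ResidueField O →* O) {k : Fin f → ℕ} (hk : k ≤ r)
    {i : Fin f → ℕ} (hi : i < k) (u : SymType E (subTwo r i)) :
    psiInd F E p hπ w T i (hi.le.trans hk) u ∈ LinearMap.range (psiSum F E p hπ w T k hk) := by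
  refine ⟨Pi.single ⟨i, hi⟩ u, ?_⟩
  rw [psiSum_apply, Finset.sum_eq_single ⟨i, hi⟩]
  · rw [Pi.single_eq_same]
  · intro j _ hj
    rw [Pi.single_eq_of_ne hj, map_zero]
  · simp

theorem range_psiSum_mono (T : ResidueField O →* O) {i k : Fin f → ℕ} (hk : k ≤ r)
    (hi : i ≤ k) : LinearMap.range (psiSum F E p hπ w T i (hi.trans hk)) ≤
      LinearMap.range (psiSum F E p hπ w T k hk) := by
  rintro _ ⟨u, rfl⟩
  rw [psiSum_apply]
  exact Submodule.sum_mem _ fun j _ => psiInd_mem_range_psiSum hπ T hk (j.2.trans_le hi) _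

/-- By well-founded induction on `k`: translating `Ψ_i(u)` gives `Ψ_i` of the translate, up to an
error in the sum of the `Ψ_m` with `m < i`. -/
theorem toG_mem_range_psiSum {T : ResidueField O →* O} (hT : IsTeichmullerLift π T)
    (k : Fin f → ℕ) (hk : k ≤ r) (hk2 : ∀ j, 2 * k j ≤ r j) (κ : GL (Fin 2) O)
    (s : compactIndSpace (weightKZ E p F hπ w r))
    (hs : s ∈ LinearMap.range (psiSum F E p hπ w T k hk)) :
    compactInd (weightKZ E p F hπ w r) (toG O F κ) s ∈
      LinearMap.range (psiSum F E p hπ w T k hk) := by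
  induction k using WellFoundedLT.induction generalizing κ s with
  | ind k ih =>
    obtain ⟨u, rfl⟩ := hs
    rw [psiSum_apply, map_sum]
    refine Submodule.sum_mem _ fun i _ => ?_
    have hi2 : ∀ j, 2 * i.1 j ≤ r j := fun j =>
      (Nat.mul_le_mul_left 2 (i.2.le j)).trans (hk2 j)
    have h := psiInd_equivariant (F := F) (p := p) (w := w) hπ hT (i.2.le.trans hk) hi2
      (LinearMap.range (psiSum F E p hπ w T i.1 (i.2.le.trans hk)))
      (fun κ y hy => ih i.1 i.2 (i.2.le.trans hk) hi2 κ y hy)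
      (fun m hm u => psiInd_mem_range_psiSum hπ T (i.2.le.trans hk) hm u) κ (u i)
    have h2 := Submodule.add_mem _ (range_psiSum_mono hπ T hk i.2.le h)
      (psiInd_mem_range_psiSum hπ T hk i.2
        (symRep E p (w + digitSum p i.1) (subTwo r i.1) (redGL O E κ) (u i)))
    rwa [sub_add_cancel] at h2

/-! ### The elements `t_n^k` -/

theorem sum_repSet_zero {M : Type*} [AddCommMonoid M] (π : O) (g : O → M) :
    ∑ μ ∈ repSet π 0, g μ = g 0 := by
  classical
  have : repSet π 0 = {0} := by
    ext x
    simp [repSet, eq_comm]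
  rw [this, Finset.sum_singleton]

theorem sum_repSet_succ {M : Type*} [AddCommMonoid M] (hπ : Irreducible π)
    {T : ResidueField O →* O}
    (hT : IsTeichmullerLift π T) (hTs : ∀ x, x ∈ teichmullerSet O ↔ ∃ a, T a = x) (n : ℕ)
    (g : O → M) :
    ∑ μ ∈ repSet π (n + 1), g μ =
      ∑ a : ResidueField O, ∑ ν ∈ repSet π n, g (T a + π * ν) := by
  classical
  rw [← Finset.sum_product']
  symm
  refine Finset.sum_bij (fun x _ => T x.1 + π * x.2) ?_ ?_ ?_ ?_
  · rintro ⟨a, ν⟩ hx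
    simp only [repSet, Finset.mem_product, Finset.mem_univ, true_and, Finset.mem_image,
      Fintype.mem_piFinset] at hx ⊢
    obtain ⟨c, hc, rfl⟩ := hx
    refine ⟨Fin.cons (T a) c, fun i => ?_, ?_⟩
    · refine Fin.cases ?_ (fun i => ?_) i
      · exact (hTs _).2 ⟨a, rfl⟩
      · exact hc i
    · rw [Fin.sum_univ_succ, Finset.mul_sum]
      simp [pow_succ', mul_assoc]
  · rintro ⟨a, ν⟩ _ ⟨b, ν'⟩ _ h
    simp only at h
    have hres := congrArg (residue O) h
    rw [map_add, map_add, map_mul, map_mul, (residue_eq_zero_iff_dvd hπ π).2 dvd_rfl,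
      zero_mul, zero_mul, add_zero, add_zero, hT.residue_apply, hT.residue_apply] at hres
    subst hres
    rw [mul_left_cancel₀ hπ.ne_zero (add_left_cancel h)]
  · intro x hx
    simp only [repSet, Finset.mem_image, Fintype.mem_piFinset] at hx
    obtain ⟨c, hc, rfl⟩ := hx
    obtain ⟨a, ha⟩ := (hTs _).1 (hc 0)
    refine ⟨(a, ∑ i : Fin n, π ^ (i : ℕ) * c i.succ), ?_, ?_⟩
    · simp only [repSet, Finset.mem_product, Finset.mem_univ, true_and, Finset.mem_image,
        Fintype.mem_piFinset]
      exact ⟨fun i => c i.succ, fun i => hc _, rfl⟩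
    · rw [Fin.sum_univ_succ, Finset.mul_sum, ha]
      simp [pow_succ', mul_assoc]
  · intros; rfl

theorem tElt_eq_sum (k : Fin f → ℕ) (hk : k ≤ r) (n : ℕ) :
    tElt F E p hπ w r k hk n = ∑ μ ∈ repSet π n,
      compactInd (weightKZ E p F hπ w r) (gMat F hπ n μ)
        (compactIndMkHom _ 1 (symVec E r k hk)) := by
  refine Finset.sum_congr rfl fun μ _ => ?_
  rw [compactInd_compactIndMkHom, mul_one]
  rfl

theorem tElt_zero (k : Fin f → ℕ) (hk : k ≤ r) :
    tElt F E p hπ w r k hk 0 = compactIndMkHom _ 1 (symVec E r k hk) := by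
  rw [tElt_eq_sum, sum_repSet_zero]
  have : gMat F hπ 0 0 = 1 := by
    ext i j
    fin_cases i <;> fin_cases j <;> simp [coe_gMat]
  rw [this, map_one]
  rfl

/-- `I_{n+1}` consists of the sums `[a] + π ν` with `ν ∈ I_n`, and the matrices factor accordingly.
This is the recursion that lets `t_n` play the role of `ξ`. -/
theorem tElt_succ {T : ResidueField O →* O} (hT : IsTeichmullerLift π T)
    (hTs : ∀ x, x ∈ teichmullerSet O ↔ ∃ a, T a = x) (k : Fin f → ℕ) (hk : k ≤ r) (n : ℕ) :
    tElt F E p hπ w r k hk (n + 1) = ∑ a : ResidueField O,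
      compactInd (weightKZ E p F hπ w r) (gMat F hπ 1 (T a)) (tElt F E p hπ w r k hk n) := by
  rw [tElt_eq_sum, sum_repSet_succ hπ hT hTs]
  refine Finset.sum_congr rfl fun a _ => ?_
  rw [tElt_eq_sum, map_sum]
  refine Finset.sum_congr rfl fun ν _ => ?_
  rw [← Module.End.mul_apply, ← map_mul, gMat_one_mul]

/-- The vector `⨂ x_j^{r_j-2k_j}` takes the value `1` at every `(1, -μ)` and, the weight being
nonzero, the value `0` at infinity. -/
theorem psiInd_symVec_zero {T : ResidueField O →* O} (hT : IsTeichmullerLift π T)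
    (hTs : ∀ x, x ∈ teichmullerSet O ↔ ∃ a, T a = x) (k : Fin f → ℕ) (hk : k ≤ r)
    (h0 : subTwo r k ≠ 0) :
    psiInd F E p hπ w T k hk (symVec E (subTwo r k) 0 fun _ => Nat.zero_le _) =
      tElt F E p hπ w r k hk 1 := by
  rw [psiInd, psi_symVec_zero _ _ _ _ _ _ _ h0, tElt_succ hπ hT hTs, tElt_zero]

theorem subTwo_ne_zero [NeZero f] {k : Fin f → ℕ} (hk2 : ∀ j, 2 * k j < r j) :
    subTwo r k ≠ 0 := fun h => by
  have h1 := congrFun h 0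
  have h2 := hk2 0
  simp only [subTwo, Pi.zero_apply] at h1
  lia

/-! ### Unipotent elements acting on weights -/

variable (r) in
theorem symRep_redGL_upperK (w : ℕ) (x : O) (u : SymType E r) :
    symRep E p w r (redGL O E (upperK 1 1 x)) u =
      symEnd E p r !![1, resHom O E x; 0, 1] u := by
  change (redGL O E (upperK 1 1 x) : Matrix (Fin 2) (Fin 2) E).det ^ w •
    symEnd E p r (redGL O E (upperK 1 1 x) : Matrix (Fin 2) (Fin 2) E) u = _
  rw [redGL_upperK]
  simp [Matrix.det_fin_two]

variable (r) in
theorem symRep_redGL_lower (w : ℕ) (x : O) (u : SymType E r) :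
    symRep E p w r (redGL O E (swapK * upperK 1 1 x * swapK)) u =
      symEnd E p r !![1, 0; resHom O E x, 1] u := by
  have h : (redGL O E (swapK * upperK 1 1 x * swapK) : Matrix (Fin 2) (Fin 2) E) =
      !![1, 0; resHom O E x, 1] := by
    rw [map_mul, map_mul, Units.val_mul, Units.val_mul, redGL_upperK, redGL_swapK]
    simp
  change (redGL O E (swapK * upperK 1 1 x * swapK) : Matrix (Fin 2) (Fin 2) E).det ^ w •
    symEnd E p r (redGL O E (swapK * upperK 1 1 x * swapK) : Matrix (Fin 2) (Fin 2) E) u = _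
  rw [h]
  simp [Matrix.det_fin_two]

theorem IsTeichmullerLift.resHom_apply {T : ResidueField O →* O} (hT : IsTeichmullerLift π T)
    (c : ResidueField O) : resHom O E (T c) = algebraMap _ E c := by
  rw [resHom, RingHom.comp_apply, hT.residue_apply]

theorem eq_top_of_redGL_stable {T : ResidueField O →* O} (hT : IsTeichmullerLift π T)
    (hq : Fintype.card (ResidueField O) = p ^ f) (hr : ∀ j, r j < p) (w : ℕ)
    (W : Submodule E (SymType E r)) (h0 : symVec E r 0 (fun _ => Nat.zero_le _) ∈ W)
    (hW : ∀ κ : GL (Fin 2) O, ∀ u ∈ W, symRep E p w r (redGL O E κ) u ∈ W) : W = ⊤ := by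
  refine eq_top_of_symVec_zero_mem E p hq hr W h0 fun c u hu => ?_
  rw [← hT.resHom_apply, ← symRep_redGL_lower r w]
  exact hW _ _ hu

theorem eq_bot_or_eq_top_of_redGL_stable {T : ResidueField O →* O} (hT : IsTeichmullerLift π T)
    (hq : Fintype.card (ResidueField O) = p ^ f) (hr : ∀ j, r j < p) (w : ℕ)
    (W : Submodule E (SymType E r))
    (hW : ∀ κ : GL (Fin 2) O, ∀ u ∈ W, symRep E p w r (redGL O E κ) u ∈ W) : W = ⊥ ∨ W = ⊤ := by
  refine or_iff_not_imp_left.2 fun h => eq_top_of_redGL_stable hT hq hr w W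
    (symVec_zero_mem_of_ne_bot E p hq hr W h fun c u hu => ?_) hW
  rw [← hT.resHom_apply, ← symRep_redGL_upperK r w]
  exact hW _ _ hu

/-! ### The maps from weights to the quotient -/

/-- By induction on `i`, the preimage of `M_k` under `Ψ_i` is `K`-stable; it contains the highest
weight vector, which goes to `t_1^i`, and that vector generates the weight. -/
theorem psiInd_mem_lowerSpan [NeZero f] {T : ResidueField O →* O} (hT : IsTeichmullerLift π T)
    (hTs : ∀ x, x ∈ teichmullerSet O ↔ ∃ a, T a = x)
    (hq : Fintype.card (ResidueField O) = p ^ f) (hr : ∀ j, r j < p)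
    {k : Fin f → ℕ} (hk : k ≤ r) (hk2 : ∀ j, 2 * k j < r j) (i : Fin f → ℕ) (hi : i < k)
    (u : SymType E (subTwo r i)) :
    psiInd F E p hπ w T i (hi.le.trans hk) u ∈ (lowerSpan F E p hπ w r k hk).toSubmodule := by
  induction i using WellFoundedLT.induction with
  | ind i ih =>
    have hi2 : ∀ j, 2 * i j < r j := fun j =>
      (Nat.mul_le_mul_left 2 (hi.le j)).trans_lt (hk2 j)
    have h : (lowerSpan F E p hπ w r k hk).toSubmodule.comap
        (psiInd F E p hπ w T i (hi.le.trans hk)) = ⊤ := by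
      refine eq_top_of_redGL_stable hT hq (fun j => (Nat.sub_le _ _).trans_lt (hr j))
        (w + digitSum p i) _ ?_ fun κ u hu => ?_
      · rw [Submodule.mem_comap, psiInd_symVec_zero hπ hT hTs _ _ (subTwo_ne_zero hi2)]
        exact Submodule.subset_span ⟨1, _, ⟨1, le_rfl, i, hi, rfl⟩, by rw [map_one]; rfl⟩
      · rw [Submodule.mem_comap] at hu ⊢
        have h1 := psiInd_equivariant (F := F) (p := p) (w := w) hπ hT (hi.le.trans hk)
          (fun j => (hi2 j).le) (lowerSpan F E p hπ w r k hk).toSubmodule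
          (fun κ y hy => (lowerSpan F E p hπ w r k hk).apply_mem_toSubmodule _ hy)
          (fun m hm u => ih m hm (hm.trans hi) u) κ u
        have h2 := Submodule.sub_mem _
          ((lowerSpan F E p hπ w r k hk).apply_mem_toSubmodule (toG O F κ) hu) h1
        rwa [sub_sub_cancel] at h2
    exact (Submodule.eq_top_iff'.1 h) u

theorem tBar_succ {T : ResidueField O →* O} (hT : IsTeichmullerLift π T)
    (hTs : ∀ x, x ∈ teichmullerSet O ↔ ∃ a, T a = x) (k : Fin f → ℕ) (hk : k ≤ r) (n : ℕ) :
    tBar F E p hπ w r k hk (n + 1) = ∑ a : ResidueField O,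
      indModLower F E p hπ w r k hk (gMat F hπ 1 (T a)) (tBar F E p hπ w r k hk n) := by
  rw [tBar, tElt_succ hπ hT hTs, map_sum]
  rfl

/-- There is an equivariant map from the weight `det^{w + k} ⊗ ⨂_j Sym_j^{r_j - 2 k_j}` to the
quotient that sends the highest weight vector to the image of `t_n^k`. -/
theorem exists_equivariant_tBar [NeZero f] {T : ResidueField O →* O} (hT : IsTeichmullerLift π T)
    (hTs : ∀ x, x ∈ teichmullerSet O ↔ ∃ a, T a = x)
    (hq : Fintype.card (ResidueField O) = p ^ f) (hr : ∀ j, r j < p)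
    {k : Fin f → ℕ} (hk : k ≤ r) (hk2 : ∀ j, 2 * k j < r j) (n : ℕ) :
    ∃ Φ : SymType E (subTwo r k) →ₗ[E]
        (compactIndSpace (weightKZ E p F hπ w r) ⧸ (lowerSpan F E p hπ w r k hk).toSubmodule),
      (∀ κ u, indModLower F E p hπ w r k hk (toG O F κ) (Φ u) =
        Φ (symRep E p (w + digitSum p k) (subTwo r k) (redGL O E κ) u)) ∧
      Φ (symVec E (subTwo r k) 0 fun _ => Nat.zero_le _) = tBar F E p hπ w r k hk (n + 1) := by
  induction n with
  | zero =>
    refine ⟨(lowerSpan F E p hπ w r k hk).toSubmodule.mkQ ∘ₗ psiInd F E p hπ w T k hk,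
      fun κ u => ?_, ?_⟩
    · have h := psiInd_equivariant (F := F) (p := p) (w := w) hπ hT hk (fun j => (hk2 j).le)
        (lowerSpan F E p hπ w r k hk).toSubmodule
        (fun κ y hy => (lowerSpan F E p hπ w r k hk).apply_mem_toSubmodule _ hy)
        (fun i hi u => psiInd_mem_lowerSpan hπ hT hTs hq hr hk hk2 i hi u) κ u
      exact (Submodule.Quotient.eq _).2 h
    · rw [LinearMap.comp_apply, psiInd_symVec_zero hπ hT hTs _ _ (subTwo_ne_zero hk2)]
      rfl
  | succ n ih =>
    obtain ⟨Φ, hΦ, hΦ0⟩ := ih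
    -- By equivariance of the previous map, the image of `t_{n+1}^k` inherits the behaviour of a
    -- highest weight vector and can serve as the next `ξ`.
    have hdiag : IsDiagEigen (O := O) p (indModLower F E p hπ w r k hk) (w + digitSum p k)
        (subTwo r k) (tBar F E p hπ w r k hk (n + 1)) := by
      intro κ h01 h10
      have e01 : redGL O E κ 0 1 = 0 := by
        rw [coe_redGL, resHom, RingHom.comp_apply, h01, map_zero]
      have e10 : redGL O E κ 1 0 = 0 := by
        rw [coe_redGL, resHom, RingHom.comp_apply, h10, map_zero]
      rw [← hΦ0, hΦ, ← map_smul]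
      congr 1
      change (redGL O E κ : Matrix (Fin 2) (Fin 2) E).det ^ _ • symEnd E p _
        (redGL O E κ : Matrix (Fin 2) (Fin 2) E) _ = _
      rw [symEnd_diag_symVec _ _ e01 e10, smul_smul, Matrix.det_fin_two, e01]
      simp [coe_redGL, digitSum]
    -- A highest weight vector is fixed by upper unipotents, so each term vanishes and the new map
    -- is equivariant on the nose.
    have hunip : UnipotentInvariant p (indModLower F E p hπ w r k hk) hπ T
        (subTwo r k) (tBar F E p hπ w r k hk (n + 1)) ⊥ := by
      intro x β₀ β₁ _ u
      rw [Submodule.mem_bot]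
      refine Finset.sum_eq_zero fun μ _ => ?_
      rw [← hΦ0, hΦ, symRep_redGL_upperK, symEnd_upper_symVec]
      have : ∀ i : Below (0 : Fin f → ℕ), i.1 = 0 := fun i => le_antisymm i.2 fun _ => Nat.zero_le _
      haveI : Subsingleton (Below (0 : Fin f → ℕ)) :=
        ⟨fun a b => Subtype.ext ((this a).trans (this b).symm)⟩
      rw [Fintype.sum_subsingleton _ (⟨0, le_rfl⟩ : Below (0 : Fin f → ℕ))]
      simp [digitSum]
    refine ⟨psi E p (indModLower F E p hπ w r k hk) hπ T (w + digitSum p k) (subTwo r k)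
      (tBar F E p hπ w r k hk (n + 1)), fun κ u => ?_, ?_⟩
    · have h := psi_equivariant hπ hT ⊥ (fun κ y hy => by
        rw [(Submodule.mem_bot E).1 hy, map_zero]; exact Submodule.zero_mem _) hdiag hunip κ u
      exact sub_eq_zero.1 ((Submodule.mem_bot E).1 h)
    · rw [psi_symVec_zero _ _ _ _ _ _ _ (subTwo_ne_zero hk2), ← tBar_succ hπ hT hTs]

end LowerSpan
end GL2ModP

namespace GL2ModP

section NonVanishing
open IsLocalRing

variable {O : Type*} [CommRing O] [IsDomain O] [IsDiscreteValuationRing O]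
  {F : Type*} [Field F] [Algebra O F] [IsFractionRing O F]
  {π : O} (hπ : Irreducible π)

/-! ### The Iwasawa decomposition -/

variable (F) in
/-- The matrix `(π^n b; 0 1)` for `n ∈ ℤ` and `b ∈ F`. -/
noncomputable def affG (n : ℤ) (b : F) : GL (Fin 2) F :=
  Matrix.GeneralLinearGroup.mkOfDetNeZero !![((unif F hπ ^ n : Fˣ) : F), b; 0, 1]
    (by simpa using zpow_ne_zero n (unif F hπ).ne_zero)

theorem coe_affG (n : ℤ) (b : F) : (affG F hπ n b : Matrix (Fin 2) (Fin 2) F) =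
    !![((unif F hπ ^ n : Fˣ) : F), b; 0, 1] := rfl

theorem coe_unif : (unif F hπ : F) = algebraMap O F π := rfl

theorem affG_mul (n m : ℤ) (b c : F) :
    affG F hπ n b * affG F hπ m c =
      affG F hπ (n + m) (b + ((unif F hπ ^ n : Fˣ) : F) * c) := by
  ext i j
  fin_cases i <;> fin_cases j <;>
    simp [Matrix.mul_apply, Fin.sum_univ_two, coe_affG, zpow_add₀, add_comm]

theorem affG_zero : affG F hπ 0 0 = 1 := by
  ext i j
  fin_cases i <;> fin_cases j <;> simp [coe_affG]

theorem affG_inv_mul (n m : ℤ) (b c : F) :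
    (affG F hπ n b)⁻¹ * affG F hπ m c =
      (affG F hπ (n - m) (((unif F hπ ^ (-m) : Fˣ) : F) * (b - c)))⁻¹ := by
  rw [inv_mul_eq_iff_eq_mul, eq_mul_inv_iff_mul_eq, affG_mul, add_sub_cancel]
  congr 1
  have : ((unif F hπ ^ m : Fˣ) : F) * ((unif F hπ ^ (-m) : Fˣ) : F) = 1 := by
    rw [← Units.val_mul, ← _root_.zpow_add, add_neg_cancel, zpow_zero, Units.val_one]
  rw [← mul_assoc, this]
  ring

theorem gMat_eq_affG (n : ℕ) (μ : O) : gMat F hπ n μ = affG F hπ n (algebraMap O F μ) := by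
  ext i j
  fin_cases i <;> fin_cases j <;> simp [coe_affG, coe_gMat, coe_unif]

theorem toG_upperK_one_one (x : O) : toG O F (upperK 1 1 x) = affG F hπ 0 (algebraMap O F x) := by
  ext i j
  fin_cases i <;> fin_cases j <;> simp [coe_affG, coe_toG, coe_upperK]

/-- The term at infinity of `Ψ` sits at height `-1`, all others at height `1`. -/
theorem swapK_mul_gMat_eq_affG :
    toG O F swapK * gMat F hπ 1 0 =
      affG F hπ (-1) 0 * (centralG (unif F hπ ^ (1 : ℤ)) * toG O F swapK) := by
  have h := algebraMap_uniformizer_ne_zero F hπ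
  ext i j
  fin_cases i <;> fin_cases j <;>
    simp [Matrix.mul_apply, Fin.sum_univ_two, coe_affG, coe_toG, coe_swapK, coe_gMat, coe_unif,
      centralG, h]

theorem centralG_mul_apply (z : Fˣ) (g : GL (Fin 2) F) (i j : Fin 2) :
    (centralG z * g : GL (Fin 2) F) i j = z * g i j := by
  simp [centralG]

/-- The lower right entry `1` is a power of `π` times a unit, which forces that power to be trivial;
the other entries are then integral, with a unit in the upper left. -/
theorem eq_of_affG_mem {n : ℤ} {b : F} (h : affG F hπ n b ∈ subgroupKZ O F) :
    n = 0 ∧ ∃ x : O, b = algebraMap O F x := by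
  obtain ⟨κ, m, hκ⟩ := (mem_subgroupKZ_iff hπ _).1 h
  have he : ∀ i j, affG F hπ n b i j = ((unif F hπ ^ m : Fˣ) : F) * algebraMap O F (κ i j) := by
    intro i j
    rw [hκ, centralG_mul_apply, coe_toG]
  have h10 : κ 1 0 = 0 := by
    have := he 1 0
    simp only [coe_affG, Matrix.of_apply, Matrix.cons_val', Matrix.cons_val_one,
      Matrix.cons_val_zero, Matrix.cons_val_fin_one] at this
    have h0 := (mul_eq_zero.1 this.symm).resolve_left (Units.ne_zero _)
    exact (map_eq_zero_iff _ (IsFractionRing.injective O F)).1 h0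
  obtain ⟨a, d, x, rfl⟩ := exists_eq_upperK h10
  have h11 : 1 = ((unif F hπ ^ m : Fˣ) : F) * algebraMap O F d := he 1 1
  have h00 : ((unif F hπ ^ n : Fˣ) : F) = ((unif F hπ ^ m : Fˣ) : F) * algebraMap O F a := he 0 0
  have hm : m = 0 := unif_zpow_mul_eq (F := F) hπ d.isUnit isUnit_one (by rw [← h11, map_one])
  subst hm
  refine ⟨unif_zpow_mul_eq (F := F) hπ isUnit_one a.isUnit (by rw [map_one, mul_one, h00]; simp),
    x, ?_⟩
  have h01 : b = ((unif F hπ ^ (0 : ℤ) : Fˣ) : F) * algebraMap O F x := he 0 1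
  simpa using h01

theorem exists_eq_unif_zpow_mul (z : Fˣ) :
    ∃ (n : ℤ) (u : Oˣ), z = unif F hπ ^ n * Units.map (algebraMap O F : O →* F) u := by
  obtain ⟨a, b, hb, hab⟩ := IsFractionRing.div_surjective (A := O) (z : F)
  have hb0 : b ≠ 0 := nonZeroDivisors.ne_zero hb
  have ha0 : a ≠ 0 := by
    rintro rfl
    exact z.ne_zero (by rw [← hab]; simp)
  obtain ⟨i, u, rfl⟩ := IsDiscreteValuationRing.eq_unit_mul_pow_irreducible ha0 hπ
  obtain ⟨j, v, rfl⟩ := IsDiscreteValuationRing.eq_unit_mul_pow_irreducible hb0 hπ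
  refine ⟨(i : ℤ) - j, u * v⁻¹, ?_⟩
  ext
  have hp := algebraMap_uniformizer_ne_zero F hπ
  have hv0 : algebraMap O F (v : O) ≠ 0 := (v.isUnit.map (algebraMap O F)).ne_zero
  rw [← hab, _root_.zpow_sub]
  simp only [map_mul, map_pow, Units.val_mul, Units.coe_map, MonoidHom.coe_coe, zpow_natCast,
    Units.val_pow_eq_pow_val, coe_unif, map_inv, Units.val_inv_eq_inv_val]
  field_simp

/-- Iwasawa decomposition. Column operations over `O` clear the lower left entry, because one of the
two quotients of the bottom row entries is integral; an upper triangular matrix is then scaled by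
its lower right entry. -/
theorem exists_eq_affG_mul (g : GL (Fin 2) F) :
    ∃ (n : ℤ) (b : F) (m : ℤ) (κ : GL (Fin 2) O),
      g = affG F hπ n b * (centralG (unif F hπ ^ m) * toG O F κ) := by
  have h0 : ∀ g : GL (Fin 2) F, g 1 0 = 0 → ∃ (n : ℤ) (b : F) (m : ℤ) (κ : GL (Fin 2) O),
      g = affG F hπ n b * (centralG (unif F hπ ^ m) * toG O F κ) := by
    intro g hg
    obtain ⟨a, d, b, rfl⟩ := exists_eq_upperK hg
    obtain ⟨n, u, hn⟩ := exists_eq_unif_zpow_mul hπ (a * d⁻¹)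
    obtain ⟨m, v, hm⟩ := exists_eq_unif_zpow_mul hπ d
    refine ⟨n, b * (d⁻¹ : Fˣ), m, upperK (u * v) v 0, ?_⟩
    have ha : (a : F) = ((unif F hπ ^ n : Fˣ) : F) * algebraMap O F u * d := by
      have := congrArg (fun z : Fˣ => (z * d : Fˣ).1) hn
      simpa using this
    have hd : (d : F) = ((unif F hπ ^ m : Fˣ) : F) * algebraMap O F v :=
      congrArg Units.val hm
    have hdd : ((d⁻¹ : Fˣ) : F) * d = 1 := d.inv_mul
    have e : ∀ i j, (affG F hπ n (b * (d⁻¹ : Fˣ)) *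
        (centralG (unif F hπ ^ m) * toG O F (upperK (u * v) v 0)) : GL (Fin 2) F) i j =
        !![((unif F hπ ^ n : Fˣ) : F) * (((unif F hπ ^ m : Fˣ) : F) * algebraMap O F (u * v)),
          b * (d⁻¹ : Fˣ) * (((unif F hπ ^ m : Fˣ) : F) * algebraMap O F v); 0,
          ((unif F hπ ^ m : Fˣ) : F) * algebraMap O F v] i j := fun i j => by
      rw [Units.val_mul, Matrix.mul_apply, Fin.sum_univ_two, centralG_mul_apply,
        centralG_mul_apply]
      fin_cases i <;> fin_cases j <;> simp [coe_affG, coe_toG, coe_upperK]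
    ext i j
    rw [e, ← hd, mul_assoc b, hdd, mul_one]
    fin_cases i <;> fin_cases j
    · change (a : F) = _ * (_ * algebraMap O F (u * v))
      rw [ha, hd, map_mul]
      ring
    · rfl
    · rfl
    · rfl
  have h1 : ∀ g : GL (Fin 2) F, (∃ x : O, g 1 0 = algebraMap O F x * g 1 1) →
      ∃ (n : ℤ) (b : F) (m : ℤ) (κ : GL (Fin 2) O),
        g = affG F hπ n b * (centralG (unif F hπ ^ m) * toG O F κ) := by
    rintro g ⟨x, hx⟩
    obtain ⟨n, b, m, κ, h⟩ := h0 (g * toG O F (swapK * upperK 1 1 (-x) * swapK)) (by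
      have hl : ((swapK * upperK 1 1 (-x) * swapK : GL (Fin 2) O) : Matrix (Fin 2) (Fin 2) O) =
          !![1, 0; -x, 1] := by
        ext i j
        fin_cases i <;> fin_cases j <;>
          simp [Matrix.mul_apply, Fin.sum_univ_two, coe_upperK, coe_swapK]
      rw [Units.val_mul, Matrix.mul_apply, Fin.sum_univ_two, coe_toG, coe_toG, hl]
      simp [hx, mul_comm])
    refine ⟨n, b, m, κ * (swapK * upperK 1 1 (-x) * swapK)⁻¹, ?_⟩
    rw [map_mul, ← mul_assoc, ← mul_assoc, mul_assoc (affG F hπ n b), ← h, map_inv,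
      mul_inv_cancel_right]
  rcases ValuationRing.isInteger_or_isInteger O (g 1 0 / g 1 1) with ⟨x, hx⟩ | ⟨x, hx⟩
  -- Division by zero gives `0`, so integrality of the quotient says nothing here, and swapping the
  -- columns takes its place.
  · by_cases h11 : g 1 1 = 0
    · have hg : g = g * toG O F swapK * toG O F swapK := by
        rw [mul_assoc, toG_swapK_mul_self, mul_one]
      obtain ⟨n, b, m, κ, h⟩ := h0 (g * toG O F swapK) (by
        simp [Matrix.mul_apply, Fin.sum_univ_two, coe_toG, coe_swapK, h11])
      refine ⟨n, b, m, κ * swapK, ?_⟩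
      rw [hg, h, map_mul]
      simp only [mul_assoc]
    · exact h1 g ⟨x, by rw [hx]; field_simp⟩
  · by_cases h10 : g 1 0 = 0
    · exact h0 g h10
    · obtain ⟨n, b, m, κ, h⟩ := h1 (g * toG O F swapK) ⟨x, by
        have : g 1 1 = algebraMap O F x * g 1 0 := by
          rw [hx, inv_div]; field_simp
        simp [Matrix.mul_apply, Fin.sum_univ_two, coe_toG, coe_swapK, this]⟩
      have hg : g = g * toG O F swapK * toG O F swapK := by
        rw [mul_assoc, toG_swapK_mul_self, mul_one]
      refine ⟨n, b, m, κ * swapK, ?_⟩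
      rw [hg, h, map_mul]
      simp only [mul_assoc]

end NonVanishing
end GL2ModP

namespace GL2ModP

/-! ### The image of `t_n^k` in the quotient is nonzero -/

section Heights
open IsLocalRing

variable {O : Type*} [CommRing O] [IsDomain O] [IsDiscreteValuationRing O]
  {F : Type*} [Field F] [Algebra O F] [IsFractionRing O F]
  {E : Type*} [Field E] {p : ℕ} [CharP E p] [Fact p.Prime]
  [Algebra (ResidueField O) E] {f : ℕ}
  {π : O} (hπ : Irreducible π) {w : ℕ} {r : Fin f → ℕ} [Fintype (ResidueField O)]
  {T : ResidueField O →* O}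

/-- The matrices `(π^n b; 0 1)` and `(π^m c; 0 1)` can define the same coset of `KZ` only if `n = m`
and `b - c ∈ π^m O`. -/
theorem compactIndMkHom_affG_apply (n m : ℤ) (b c : F) (v : SymType E r)
    (h : ¬ (n = m ∧ ∃ x : O, b - c = algebraMap O F x * ((unif F hπ ^ m : Fˣ) : F))) :
    (compactIndMkHom (weightKZ E p F hπ w r) (affG F hπ m c) v).1 (affG F hπ n b)⁻¹ = 0 := by
  refine compactIndMk_apply_of_notMem _ (fun hm => h ?_) v
  rw [affG_inv_mul] at hm
  obtain ⟨h1, x, hx⟩ := eq_of_affG_mem hπ (inv_mem_iff.1 hm)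
  refine ⟨sub_eq_zero.1 h1, x, ?_⟩
  have : ((unif F hπ ^ m : Fˣ) : F) * ((unif F hπ ^ (-m) : Fˣ) : F) = 1 := by
    rw [← Units.val_mul, ← _root_.zpow_add, add_neg_cancel, zpow_zero, Units.val_one]
  rw [← hx]
  linear_combination (c - b) * this

theorem compactIndMkHom_swapK_mul_gMat_apply {n : ℤ} (hn : n ≠ -1) (b : F) (v : SymType E r) :
    (compactIndMkHom (weightKZ E p F hπ w r) (toG O F swapK * gMat F hπ 1 0) v).1
      (affG F hπ n b)⁻¹ = 0 := by
  have hmem : centralG (unif F hπ ^ (1 : ℤ)) * toG O F swapK ∈ subgroupKZ O F :=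
    (mem_subgroupKZ_iff hπ _).2 ⟨swapK, 1, rfl⟩
  rw [swapK_mul_gMat_eq_affG]
  have := compactIndMkHom_mul (weightKZ E p F hπ w r) (affG F hπ (-1) 0) ⟨_, hmem⟩ v
  rw [this]
  exact compactIndMkHom_affG_apply hπ _ _ _ _ _ fun h => hn h.1

theorem coe_sum_compactInd {ι : Type*} (s : Finset ι)
    (φ : ι → compactIndSpace (weightKZ E p F hπ w r)) (x : GL (Fin 2) F) :
    (∑ i ∈ s, φ i).1 x = ∑ i ∈ s, (φ i).1 x := by
  rw [AddSubmonoidClass.coe_finsetSum, Finset.sum_apply]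

theorem psiInd_apply_affG (i : Fin f → ℕ) (hi : i ≤ r) (u : SymType E (subTwo r i)) {n : ℤ}
    (hn : n ≠ -1) (b : F) :
    (psiInd F E p hπ w T i hi u).1 (affG F hπ n b)⁻¹ = ∑ μ : ResidueField O,
      symEval E p _ 1 (-algebraMap _ E μ) u • (compactIndMkHom (weightKZ E p F hπ w r)
        (affG F hπ 1 (algebraMap O F (T μ))) (symVec E r i hi)).1 (affG F hπ n b)⁻¹ := by
  have hg : ∀ μ : O, gMat F hπ 1 μ = affG F hπ 1 (algebraMap O F μ) := fun μ => by
    rw [gMat_eq_affG, Nat.cast_one]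
  rw [psiInd, psi_apply]
  simp only [compactInd_compactIndMkHom, mul_one]
  change (∑ μ : ResidueField O, symEval E p _ 1 (-algebraMap _ E μ) u •
    compactIndMkHom (weightKZ E p F hπ w r) (gMat F hπ 1 (T μ)) (symVec E r i hi)).1 _ +
      ((-1 : E) ^ (w + digitSum p i) * symEval E p _ 0 1 u) •
        (compactIndMkHom (weightKZ E p F hπ w r) (toG O F swapK * gMat F hπ 1 0)
        (symVec E r i hi)).1 _ = _
  rw [compactIndMkHom_swapK_mul_gMat_apply hπ hn, smul_zero, add_zero, coe_sum_compactInd]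
  simp only [hg]
  rfl

theorem psiInd_apply_affG_of_ne (i : Fin f → ℕ) (hi : i ≤ r) (u : SymType E (subTwo r i)) {n : ℤ}
    (hn : n ≠ -1) (hn1 : n ≠ 1) (b : F) :
    (psiInd F E p hπ w T i hi u).1 (affG F hπ n b)⁻¹ = 0 := by
  rw [psiInd_apply_affG hπ i hi u hn]
  refine Finset.sum_eq_zero fun μ _ => ?_
  rw [compactIndMkHom_affG_apply hπ _ _ _ _ _ fun h => hn1 h.1, smul_zero]

theorem psiInd_apply_affG_one_of_notMem (i : Fin f → ℕ) (hi : i ≤ r) (u : SymType E (subTwo r i))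
    {b : F} (hb : ∀ x : O, b ≠ algebraMap O F x) :
    (psiInd F E p hπ w T i hi u).1 (affG F hπ 1 b)⁻¹ = 0 := by
  rw [psiInd_apply_affG hπ i hi u (by norm_num)]
  refine Finset.sum_eq_zero fun μ _ => ?_
  rw [compactIndMkHom_affG_apply hπ, smul_zero]
  rintro ⟨-, x, hx⟩
  refine hb (x * π + T μ) ?_
  rw [map_add, map_mul, ← sub_eq_iff_eq_add, hx, zpow_one, coe_unif]

theorem psiInd_apply_affG_one (hT : IsTeichmullerLift π T) (i : Fin f → ℕ) (hi : i ≤ r)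
    (u : SymType E (subTwo r i)) (μ : ResidueField O) :
    (psiInd F E p hπ w T i hi u).1 (affG F hπ 1 (algebraMap O F (T μ)))⁻¹ =
      symEval E p _ 1 (-algebraMap _ E μ) u • symVec E r i hi := by
  rw [psiInd_apply_affG hπ i hi u (by norm_num), Finset.sum_eq_single μ]
  · congr 1
    exact compactIndMk_apply_inv _ _ _
  · intro ν _ hν
    rw [compactIndMkHom_affG_apply hπ, smul_zero]
    rintro ⟨-, x, hx⟩
    rw [zpow_one, coe_unif, ← map_sub, ← map_mul] at hx
    have := congrArg (residue O) (IsFractionRing.injective O F hx)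
    rw [map_sub, map_mul, hT.residue_apply, hT.residue_apply,
      (residue_eq_zero_iff_dvd hπ π).2 dvd_rfl, mul_zero] at this
    exact hν (sub_eq_zero.1 this).symm
  · intro h
    exact absurd (Finset.mem_univ μ) h

/-! ### Filtration of the translates of `S` by height -/

section Range
variable {k : Fin f → ℕ} (hk : k ≤ r)

theorem range_psiSum_apply_of_ne {s : compactIndSpace (weightKZ E p F hπ w r)}
    (hs : s ∈ LinearMap.range (psiSum F E p hπ w T k hk)) {n : ℤ}
    (hn : n ≠ -1) (hn1 : n ≠ 1) (b : F) : s.1 (affG F hπ n b)⁻¹ = 0 := by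
  obtain ⟨u, rfl⟩ := hs
  rw [psiSum_apply, coe_sum_compactInd]
  exact Finset.sum_eq_zero fun i _ => psiInd_apply_affG_of_ne hπ _ _ _ hn hn1 b

theorem range_psiSum_apply_of_notMem {s : compactIndSpace (weightKZ E p F hπ w r)}
    (hs : s ∈ LinearMap.range (psiSum F E p hπ w T k hk))
    {b : F} (hb : ∀ x : O, b ≠ algebraMap O F x) : s.1 (affG F hπ 1 b)⁻¹ = 0 := by
  obtain ⟨u, rfl⟩ := hs
  rw [psiSum_apply, coe_sum_compactInd]
  exact Finset.sum_eq_zero fun i _ => psiInd_apply_affG_one_of_notMem hπ _ _ _ hb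

/-- At height `1` the map `Ψ_i` takes values in the line of the `i`-th basis vector, and `i ≠ k`. -/
theorem symCoord_range_psiSum_apply (hT : IsTeichmullerLift π T)
    {s : compactIndSpace (weightKZ E p F hπ w r)}
    (hs : s ∈ LinearMap.range (psiSum F E p hπ w T k hk)) (μ : ResidueField O) :
    symCoord E r k (s.1 (affG F hπ 1 (algebraMap O F (T μ)))⁻¹) = 0 := by
  obtain ⟨u, rfl⟩ := hs
  rw [psiSum_apply, coe_sum_compactInd, map_sum]
  refine Finset.sum_eq_zero fun i _ => ?_
  rw [psiInd_apply_affG_one hπ hT, map_smul, symCoord_symVec, if_neg i.2.ne, smul_zero]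

/-- The `i`-th coordinate of the value at `[μ]` is `u_i(1, -μ)`, and these numbers determine `u_i`.
In particular the sum of the `Ψ_i` is direct. -/
theorem range_psiSum_eq_zero (hT : IsTeichmullerLift π T)
    (hq : Fintype.card (ResidueField O) = p ^ f) (hr : ∀ j, r j < p)
    {s : compactIndSpace (weightKZ E p F hπ w r)}
    (hs : s ∈ LinearMap.range (psiSum F E p hπ w T k hk))
    (h : ∀ μ : ResidueField O, s.1 (affG F hπ 1 (algebraMap O F (T μ)))⁻¹ = 0) : s = 0 := by
  obtain ⟨u, rfl⟩ := hs
  suffices hu : u = 0 by rw [hu, map_zero]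
  funext i
  refine eq_zero_of_symEval_eq_zero (k := ResidueField O) E p hq
    (fun j => (Nat.sub_le _ _).trans_lt (hr j)) fun c => ?_
  have h1 := congrArg (symCoord E r i.1) (h (-c))
  rw [psiSum_apply, coe_sum_compactInd, map_sum, map_zero, Finset.sum_eq_single i] at h1
  · rwa [psiInd_apply_affG_one hπ hT, map_smul, symCoord_symVec, if_pos rfl, smul_eq_mul, mul_one,
      map_neg, neg_neg] at h1
  · intro j _ hj
    rw [psiInd_apply_affG_one hπ hT, map_smul, symCoord_symVec, if_neg fun h => hj (Subtype.ext h),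
      smul_zero]
  · simp

variable (w E p T) in
/-- The span of the translates of `∑_{i < k} Ψ_i` by the matrices `(π^n b; 0 1)` with `n ≤ N`. -/
noncomputable def heightSpan (N : ℤ) : Submodule E (compactIndSpace (weightKZ E p F hπ w r)) :=
  Submodule.span E {φ | ∃ n ≤ N, ∃ b : F, ∃ s ∈ LinearMap.range (psiSum F E p hπ w T k hk),
    φ = compactInd (weightKZ E p F hπ w r) (affG F hπ n b) s}

theorem heightSpan_mono {N M : ℤ} (h : N ≤ M) :
    heightSpan (F := F) E p hπ w T hk N ≤ heightSpan E p hπ w T hk M := by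
  refine Submodule.span_mono ?_
  rintro _ ⟨n, hn, b, s, hs, rfl⟩
  exact ⟨n, hn.trans h, b, s, hs, rfl⟩

/-- Translation by an element of height `m` shifts all heights by `m`. -/
theorem compactInd_affG_apply (n m : ℤ) (b c : F)
    (s : compactIndSpace (weightKZ E p F hπ w r)) :
    (compactInd (weightKZ E p F hπ w r) (affG F hπ m c) s).1 (affG F hπ n b)⁻¹ =
      s.1 (affG F hπ (n - m) (((unif F hπ ^ (-m) : Fˣ) : F) * (b - c)))⁻¹ := by
  rw [compactInd_apply, affG_inv_mul]

theorem heightSpan_apply_eq_zero {N n : ℤ} (hn : N + 1 < n)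
    {φ : compactIndSpace (weightKZ E p F hπ w r)} (hφ : φ ∈ heightSpan E p hπ w T hk N) (b : F) :
    φ.1 (affG F hπ n b)⁻¹ = 0 := by
  induction hφ using Submodule.span_induction with
  | mem x hx =>
    obtain ⟨m, hm, c, s, hs, rfl⟩ := hx
    rw [compactInd_affG_apply]
    exact range_psiSum_apply_of_ne hπ hk hs (by lia) (by lia) _
  | zero => rfl
  | add x y _ _ hx hy =>
    change x.1 _ + y.1 _ = 0
    rw [hx, hy, add_zero]
  | smul a x _ hx =>
    change a • x.1 _ = 0
    rw [hx, smul_zero]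

theorem affG_eq_mul_toG (N : ℤ) (b c : F) (x : O)
    (h : c = b + ((unif F hπ ^ N : Fˣ) : F) * algebraMap O F x) :
    affG F hπ N c = affG F hπ N b * toG O F (upperK 1 1 x) := by
  rw [toG_upperK_one_one hπ, affG_mul, add_zero, h]

/-- Only translates of exact height `N` are visible at height `N + 1`, and they show the values of
`S` at height `1`, which lack the `k`-th coordinate. -/
theorem symCoord_heightSpan_apply (hT : IsTeichmullerLift π T) (hk2 : ∀ j, 2 * k j ≤ r j) {N : ℤ}
    {φ : compactIndSpace (weightKZ E p F hπ w r)} (hφ : φ ∈ heightSpan E p hπ w T hk N) (b : F) :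
    symCoord E r k (φ.1 (affG F hπ (N + 1) b)⁻¹) = 0 := by
  induction hφ using Submodule.span_induction with
  | mem x hx =>
    obtain ⟨m, hm, c, s, hs, rfl⟩ := hx
    rcases hm.lt_or_eq with hm | rfl
    · rw [compactInd_affG_apply,
        range_psiSum_apply_of_ne hπ hk hs (by lia) (by lia), map_zero]
    -- If `c ∈ b + π^m O`, the `K`-stability of `S` moves the centre from `c` to `b`, so the
    -- evaluation takes place at `[0]`. Otherwise the argument is not integral and the value is
    -- zero.
    · by_cases h : ∃ x : O, c = b + ((unif F hπ ^ m : Fˣ) : F) * algebraMap O F x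
      · obtain ⟨x, hx⟩ := h
        rw [affG_eq_mul_toG hπ m b c x hx, map_mul, Module.End.mul_apply, compactInd_affG_apply]
        rw [sub_self, mul_zero, add_sub_cancel_left]
        have := symCoord_range_psiSum_apply hπ hk hT
          (toG_mem_range_psiSum hπ hT k hk hk2 (upperK 1 1 x) s hs) 0
        rw [hT.map_zero, map_zero] at this
        exact this
      · rw [compactInd_affG_apply, add_sub_cancel_left, range_psiSum_apply_of_notMem hπ hk hs,
          map_zero]
        intro x hx
        refine h ⟨-x, ?_⟩
        have : ((unif F hπ ^ m : Fˣ) : F) * ((unif F hπ ^ (-m) : Fˣ) : F) = 1 := by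
          rw [← Units.val_mul, ← _root_.zpow_add, add_neg_cancel, zpow_zero, Units.val_one]
        rw [map_neg, ← hx]
        linear_combination (b - c) * this
  | zero => exact map_zero _
  | add x y _ _ hx hy =>
    change symCoord E r k (x.1 _ + y.1 _) = 0
    rw [map_add, hx, hy, add_zero]
  | smul a x _ hx =>
    change symCoord E r k (a • x.1 _) = 0
    rw [map_smul, hx, smul_zero]

variable (F) in
/-- The subgroup `π^N O` of `F`. -/
noncomputable def unifLattice (N : ℤ) : AddSubgroup F :=
  AddMonoidHom.range ((AddMonoidHom.mulLeft ((unif F hπ ^ N : Fˣ) : F)).comp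
    (algebraMap O F).toAddMonoidHom)

theorem mem_unifLattice (N : ℤ) (b : F) :
    b ∈ unifLattice F hπ N ↔ ∃ x : O, ((unif F hπ ^ N : Fˣ) : F) * algebraMap O F x = b := Iff.rfl

/-- An element of `heightSpan N` that vanishes at height `N + 1` belongs to
`heightSpan (N - 1)`. -/
theorem mem_heightSpan_of_apply_eq_zero (hT : IsTeichmullerLift π T)
    (hq : Fintype.card (ResidueField O) = p ^ f) (hr : ∀ j, r j < p)
    (hk2 : ∀ j, 2 * k j ≤ r j) {N : ℤ}
    {φ : compactIndSpace (weightKZ E p F hπ w r)} (hφ : φ ∈ heightSpan E p hπ w T hk N)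
    (h0 : ∀ b, φ.1 (affG F hπ (N + 1) b)⁻¹ = 0) : φ ∈ heightSpan E p hπ w T hk (N - 1) := by
  classical
  -- Since `S` is `K`-stable, the translate of `S` by `(π^N b; 0 1)` depends only on the class of
  -- `b` modulo `π^N O`; one copy of `S` per class suffices for the top layer.
  let Q := F ⧸ unifLattice F hπ N
  let S := LinearMap.range (psiSum F E p hπ w T k hk)
  let Θ : (Q →₀ S) →ₗ[E] compactIndSpace (weightKZ E p F hπ w r) :=
    Finsupp.lsum E fun q : Q =>
      (compactInd (weightKZ E p F hπ w r) (affG F hπ N (Quotient.out q))) ∘ₗ S.subtype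
  have hle : heightSpan E p hπ w T hk N ≤
      heightSpan E p hπ w T hk (N - 1) ⊔ LinearMap.range Θ := by
    refine Submodule.span_le.2 ?_
    rintro _ ⟨n, hn, b, s, hs, rfl⟩
    rcases hn.lt_or_eq with hn | rfl
    · exact Submodule.mem_sup_left (Submodule.subset_span ⟨n, by lia, b, s, hs, rfl⟩)
    · refine Submodule.mem_sup_right ?_
      have hb : -(Quotient.out (QuotientAddGroup.mk b : Q)) + b ∈ unifLattice F hπ n :=
        QuotientAddGroup.eq.1 (QuotientAddGroup.out_eq' (QuotientAddGroup.mk b : Q))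
      obtain ⟨x, hx⟩ := (mem_unifLattice hπ n _).1 hb
      refine ⟨Finsupp.single (QuotientAddGroup.mk b) ⟨_,
        toG_mem_range_psiSum hπ hT k hk hk2 (upperK 1 1 x) s hs⟩, ?_⟩
      simp only [Θ, Finsupp.lsum_single, LinearMap.comp_apply, Submodule.subtype_apply]
      rw [affG_eq_mul_toG hπ n (Quotient.out (QuotientAddGroup.mk b : Q)) b x (by rw [hx]; ring),
        map_mul, Module.End.mul_apply]
  obtain ⟨φ', hφ', _, ⟨c, rfl⟩, rfl⟩ := Submodule.mem_sup.1 (hle hφ)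
  suffices hc : c = 0 by rwa [hc, map_zero, add_zero]
  ext1 q
  apply Subtype.ext
  refine range_psiSum_eq_zero hπ hk hT hq hr (c q).2 fun μ => ?_
  -- At this point of height `N + 1` the lower layers vanish, and so do the translates for other
  -- classes, whose arguments are not integral. What remains is the value of `c q` at `[μ]`.
  set b : F := Quotient.out q + ((unif F hπ ^ N : Fˣ) : F) * algebraMap O F (T μ) with hb
  have h1 : (φ' + Θ c).1 (affG F hπ (N + 1) b)⁻¹ = 0 := h0 b
  change φ'.1 _ + (Θ c).1 _ = 0 at h1
  rw [heightSpan_apply_eq_zero hπ hk (by lia) hφ', zero_add] at h1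
  have hinv : ((unif F hπ ^ N : Fˣ) : F) * ((unif F hπ ^ (-N) : Fˣ) : F) = 1 := by
    rw [← Units.val_mul, ← _root_.zpow_add, add_neg_cancel, zpow_zero, Units.val_one]
  have hΘ : Θ c = ∑ q' ∈ insert q c.support,
      compactInd (weightKZ E p F hπ w r) (affG F hπ N (Quotient.out q')) (c q').1 := by
    refine Finsupp.sum_of_support_subset c (Finset.subset_insert _ _) _ fun _ _ => map_zero _
  rw [hΘ, coe_sum_compactInd, Finset.sum_eq_single q] at h1
  · rw [compactInd_affG_apply, add_sub_cancel_left] at h1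
    have harg : ((unif F hπ ^ (-N) : Fˣ) : F) * (b - Quotient.out q) = algebraMap O F (T μ) := by
      rw [hb]
      linear_combination (algebraMap O F (T μ)) * hinv
    rwa [harg] at h1
  · intro q' _ hq'
    rw [compactInd_affG_apply, add_sub_cancel_left]
    refine range_psiSum_apply_of_notMem hπ hk (c q').2 fun x hx => hq' ?_
    rw [← QuotientAddGroup.out_eq' q, ← QuotientAddGroup.out_eq' q']
    refine QuotientAddGroup.eq.2 ((mem_unifLattice hπ N _).2 ⟨x - T μ, ?_⟩)
    rw [map_sub, ← hx, hb]
    linear_combination (Quotient.out q - Quotient.out q' +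
      ((unif F hπ ^ N : Fˣ) : F) * algebraMap O F (T μ)) * hinv
  · intro h
    exact absurd (Finset.mem_insert_self _ _) h

theorem tElt_apply_eq_zero (n : ℕ) {m : ℤ} {b : F}
    (h : ¬ (m = n ∧ ∃ x : O, b = algebraMap O F x)) :
    (tElt F E p hπ w r k hk n).1 (affG F hπ m b)⁻¹ = 0 := by
  rw [tElt, coe_sum_compactInd]
  refine Finset.sum_eq_zero fun μ _ => ?_
  rw [gMat_eq_affG]
  refine compactIndMkHom_affG_apply hπ _ _ _ _ _ ?_
  rintro ⟨hm, x, hx⟩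
  refine h ⟨hm, μ + x * π ^ n, ?_⟩
  rw [map_add, map_mul, map_pow, ← sub_eq_iff_eq_add', hx]
  simp [coe_unif]

/-- In the recursion for `t_{n+1}` only the summand `a = 0` is supported at this point, since a
nonzero Teichmüller lift is not divisible by `π`. -/
theorem tElt_apply_self (hT : IsTeichmullerLift π T)
    (hTs : ∀ x, x ∈ teichmullerSet O ↔ ∃ a, T a = x) (n : ℕ) :
    (tElt F E p hπ w r k hk n).1 (affG F hπ n 0)⁻¹ = symVec E r k hk := by
  induction n with
  | zero =>
    rw [tElt_zero, Nat.cast_zero, affG_zero]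
    exact compactIndMk_apply_inv _ _ _
  | succ n ih =>
    rw [tElt_succ hπ hT hTs, coe_sum_compactInd, Finset.sum_eq_single 0]
    · rw [gMat_eq_affG, compactInd_affG_apply, hT.map_zero, map_zero, sub_self, mul_zero]
      simpa using ih
    · intro a _ ha
      rw [gMat_eq_affG, compactInd_affG_apply]
      refine tElt_apply_eq_zero hπ hk n ?_
      rintro ⟨-, x, hx⟩
      apply ha
      have hu : ((unif F hπ ^ (-((1 : ℕ) : ℤ)) : Fˣ) : F) * algebraMap O F π = 1 := by
        rw [Nat.cast_one, zpow_neg_one]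
        exact (unif F hπ).inv_mul
      have h1 : algebraMap O F (T a) = algebraMap O F (π * -x) := by
        rw [map_mul, map_neg, ← hx]
        linear_combination -(algebraMap O F (T a)) * hu
      rw [← hT.residue_apply a, IsFractionRing.injective O F h1, map_mul,
        (residue_eq_zero_iff_dvd hπ π).2 dvd_rfl, zero_mul]
    · simp

/-- All `t_l^i` with `i < k` are in the `G`-span of `S`, by the recursion from `t_1^i`. In the
Iwasawa decomposition of a group element, the factor from `KZ` preserves `S`, leaving a translate by
an affine matrix. -/
theorem lowerSpan_le_iUnion_heightSpan [NeZero f] (hT : IsTeichmullerLift π T)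
    (hTs : ∀ x, x ∈ teichmullerSet O ↔ ∃ a, T a = x) (hk2 : ∀ j, 2 * k j < r j)
    {φ : compactIndSpace (weightKZ E p F hπ w r)}
    (hφ : φ ∈ (lowerSpan F E p hπ w r k hk).toSubmodule) :
    ∃ N, φ ∈ heightSpan E p hπ w T hk N := by
  let S := LinearMap.range (psiSum F E p hπ w T k hk)
  let U := generatedBy (compactInd (weightKZ E p F hπ w r)) (S : Set _)
  have ht : ∀ (l : ℕ) (i : Fin f → ℕ) (hi : i < k),
      tElt F E p hπ w r i (hi.le.trans hk) (l + 1) ∈ U.toSubmodule := by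
    intro l i hi
    induction l with
    | zero =>
      refine Submodule.subset_span
        ⟨1, tElt F E p hπ w r i (hi.le.trans hk) (0 + 1), ?_, by rw [map_one]; rfl⟩
      rw [zero_add, ← psiInd_symVec_zero hπ hT hTs _ _ (subTwo_ne_zero (fun j =>
        (Nat.mul_le_mul_left 2 (hi.le j)).trans_lt (hk2 j)))]
      exact psiInd_mem_range_psiSum hπ T hk hi _
    | succ l ih =>
      rw [tElt_succ hπ hT hTs]
      exact Submodule.sum_mem _ fun a _ => U.apply_mem_toSubmodule _ ih
  have hMU : (lowerSpan F E p hπ w r k hk).toSubmodule ≤ U.toSubmodule := by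
    refine Submodule.span_le.2 ?_
    rintro _ ⟨g, _, ⟨l, hl, i, hi, rfl⟩, rfl⟩
    obtain ⟨l, rfl⟩ := Nat.exists_eq_add_of_le' hl
    exact U.apply_mem_toSubmodule _ (ht l i hi)
  have hU := hMU hφ
  clear hφ
  induction hU using Submodule.span_induction with
  | mem x hx =>
    obtain ⟨g, s, hs, rfl⟩ := hx
    obtain ⟨n, b, m, κ, rfl⟩ := exists_eq_affG_mul hπ g
    refine ⟨n, Submodule.subset_span ⟨n, le_rfl, b, _,
      toG_mem_range_psiSum hπ hT k hk (fun j => (hk2 j).le) κ s hs, ?_⟩⟩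
    rw [map_mul, map_mul, Module.End.mul_apply, Module.End.mul_apply, compactInd_centralG]
  | zero => exact ⟨0, Submodule.zero_mem _⟩
  | add x y _ _ hx hy =>
    obtain ⟨N, hN⟩ := hx
    obtain ⟨M, hM⟩ := hy
    exact ⟨max N M, Submodule.add_mem _ (heightSpan_mono hπ hk (le_max_left _ _) hN)
      (heightSpan_mono hπ hk (le_max_right _ _) hM)⟩
  | smul a x _ hx =>
    obtain ⟨N, hN⟩ := hx
    exact ⟨N, Submodule.smul_mem _ a hN⟩

end Range

theorem tBar_ne_zero [NeZero f] (hT : IsTeichmullerLift π T)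
    (hTs : ∀ x, x ∈ teichmullerSet O ↔ ∃ a, T a = x)
    (hq : Fintype.card (ResidueField O) = p ^ f) (hr : ∀ j, r j < p)
    {k : Fin f → ℕ} (hk : k ≤ r) (hk2 : ∀ j, 2 * k j < r j) (n : ℕ) :
    tBar F E p hπ w r k hk (n + 1) ≠ 0 := by
  intro h
  have h0 := (Submodule.Quotient.mk_eq_zero _).1 h
  obtain ⟨N, hN⟩ := lowerSpan_le_iUnion_heightSpan hπ hk hT hTs hk2 h0
  -- The element `t_{n+1}` vanishes at every height other than `n + 1`, so the bound can be lowered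
  -- one step at a time down to `n`.
  have hdesc : ∀ m : ℕ, tElt F E p hπ w r k hk (n + 1) ∈ heightSpan E p hπ w T hk ((n : ℤ) + m) →
      tElt F E p hπ w r k hk (n + 1) ∈ heightSpan E p hπ w T hk n := by
    intro m
    induction m with
    | zero => simp
    | succ m ih =>
      intro hm
      refine ih ?_
      have := mem_heightSpan_of_apply_eq_zero hπ hk hT hq hr (fun j => (hk2 j).le) hm fun b =>
        tElt_apply_eq_zero hπ hk (n + 1) fun h => by
          have := h.1
          push_cast at this
          lia
      convert this using 2
      push_cast
      ring
  have h1 := hdesc (N - n).toNat (heightSpan_mono hπ hk (by lia) hN)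
  have h2 := symCoord_heightSpan_apply hπ hk hT (fun j => (hk2 j).le) h1 0
  have h3 := tElt_apply_self (F := F) (E := E) (p := p) (w := w) hπ hk hT hTs (n + 1)
  rw [Nat.cast_add, Nat.cast_one] at h3
  rw [h3, symCoord_symVec, if_pos rfl] at h2
  exact one_ne_zero h2

end Heights
end GL2ModP

namespace GL2ModP

/-! ### Teichmüller lifts in the ring of integers -/

section Complete
open AdicCompletion

/-- A finite module over a complete Noetherian local ring is complete. -/
theorem isAdicComplete_of_finite (R M : Type*) [CommRing R] [IsNoetherianRing R] [IsLocalRing R]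
    [IsAdicComplete (IsLocalRing.maximalIdeal R) R] [AddCommGroup M] [Module R M]
    [Module.Finite R M] : IsAdicComplete (IsLocalRing.maximalIdeal R) M := by
  set I := IsLocalRing.maximalIdeal R
  have hH : IsHausdorff I M := IsHausdorff.of_isLocalRing _ _ (IsLocalRing.maximalIdeal.isMaximal R).ne_top
  have hP : IsPrecomplete I M := by
    rw [← of_surjective_iff]
    intro y
    -- The completion of a surjection from `Rⁿ` is surjective, so precompleteness of `M` reduces,
    -- coordinate by coordinate, to that of `R`.
    obtain ⟨n, g, hg⟩ := Module.Finite.exists_fin' R M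
    obtain ⟨z, rfl⟩ := map_surjective I hg y
    choose x hx using fun j => of_surjective I R (piEquivOfFintype I (fun _ : Fin n => R) z j)
    have hz : z = of I (Fin n → R) x := by
      apply (piEquivOfFintype I (fun _ : Fin n => R)).injective
      funext j
      rw [← hx]
      rw [piEquivOfFintype_apply]
      exact (map_of I (LinearMap.proj (R := R) (φ := fun _ : Fin n => R) j) x).symm
    exact ⟨g x, by rw [hz, map_of]⟩
  exact { toIsHausdorff := hH, toIsPrecomplete := hP }

end Complete

/-! ### Existence of Teichmüller lifts and their additivity modulo `π²` -/

section Teichmuller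
open IsLocalRing Polynomial

variable {O : Type*} [CommRing O] [IsDomain O] [IsDiscreteValuationRing O] {π : O}

/-- The cofactor of `x - y` in `x^q - y^q` is congruent to `q y^{q-1}` modulo `π`, and thus
contributes one more factor `π`. -/
theorem pow_dvd_pow_sub_pow (hπ : Irreducible π) {q : ℕ} (hq : π ∣ (q : O)) {x y : O} {m : ℕ}
    (h : π ^ (m + 1) ∣ x - y) : π ^ (m + 2) ∣ x ^ q - y ^ q := by
  rw [← (Commute.all x y).geom_sum₂_mul, mul_comm, pow_succ π (m + 1)]
  refine mul_dvd_mul h ((residue_eq_zero_iff_dvd hπ _).1 ?_)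
  have hxy : residue O x = residue O y := by
    rw [← sub_eq_zero, ← map_sub, residue_eq_zero_iff_dvd hπ]
    exact (dvd_pow_self π m.succ_ne_zero).trans h
  have hq0 : (q : ResidueField O) = 0 := by
    rw [← map_natCast (residue O), residue_eq_zero_iff_dvd hπ]
    exact hq
  rw [RingHom.map_geom_sum₂, hxy, geom_sum₂_self, hq0, zero_mul]

/-- Existence of the Teichmüller lift of a residue class. -/
theorem exists_pow_eq_self_residue_eq (hπ : Irreducible π) (I : Ideal O) [HenselianRing O I]
    (hI : I ≤ maximalIdeal O) {N : ℕ} (hN : π ^ (N + 1) ∈ I) [Finite (ResidueField O)]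
    (hq : (Nat.card (ResidueField O) : O) ∈ I) (x : O) :
    ∃ y : O, y ^ Nat.card (ResidueField O) = y ∧ residue O y = residue O x := by
  classical
  have := Fintype.ofFinite (ResidueField O)
  set q := Nat.card (ResidueField O) with hqdef
  have hq1 : 1 < q := Finite.one_lt_card
  have hpow : ∀ a : ResidueField O, a ^ q = a := fun a => by
    rw [hqdef, Nat.card_eq_fintype_card, FiniteField.pow_card]
  have hqπ : π ∣ (q : O) := by
    rw [← residue_eq_zero_iff_dvd hπ, residue_eq_zero_iff]
    exact hI hq
  have hm : ∀ m : ℕ, π ^ (m + 1) ∣ (x ^ q ^ m) ^ q - x ^ q ^ m := by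
    intro m
    induction m with
    | zero =>
      rw [pow_zero, zero_add, pow_one, pow_one, ← residue_eq_zero_iff_dvd hπ, map_sub, map_pow, hpow,
        sub_self]
    | succ m ih =>
      rw [pow_succ q m, pow_mul x]
      exact pow_dvd_pow_sub_pow hπ hqπ ih
  have hres : ∀ m : ℕ, residue O (x ^ q ^ m) = residue O x := by
    intro m
    induction m with
    | zero => simp
    | succ m ih => rw [pow_succ, pow_mul, map_pow, ih, hpow]
  -- Being a root modulo the maximal ideal is not enough for the ideal `I`. The iterate `x^{q^N}` is
  -- a root modulo `π^{N+1} ∈ I`, has the same residue as `x`, and the derivative of `X^q - X` is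
  -- `-1` modulo `I`.
  obtain ⟨y, hy, hyx⟩ := HenselianRing.is_henselian (I := I) (X ^ q - X : O[X])
    (monic_X_pow_sub (by rw [degree_X]; exact_mod_cast hq1)) (x ^ q ^ N)
    (by
      rw [eval_sub, eval_pow, eval_X]
      exact I.mem_of_dvd (hm N) hN)
    (by
      rw [derivative_sub, derivative_X_pow, derivative_X, eval_sub, eval_mul, eval_C, eval_one,
        map_sub, map_mul, Ideal.Quotient.eq_zero_iff_mem.2 hq, zero_mul, map_one, zero_sub]
      exact isUnit_one.neg)
  refine ⟨y, ?_, ?_⟩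
  · rw [IsRoot.def, eval_sub, eval_pow, eval_X] at hy
    exact sub_eq_zero.1 hy
  · rw [← hres N, ← sub_eq_zero, ← map_sub, residue_eq_zero_iff]
    exact hI hyx

/-- The roots of `X^q - X` are simple modulo the maximal ideal, its derivative reducing to `-1`. -/
theorem eq_of_pow_eq_self_of_residue_eq {q : ℕ} (hq : (q : O) ∈ maximalIdeal O) {x y : O}
    (hx : x ^ q = x) (hy : y ^ q = y) (h : residue O x = residue O y) : x = y := by
  refine eq_of_eval_eq_zero_of_not_isUnit_sub (f := (X ^ q - X : O[X])) (by simp [hx])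
    (by simp [hy]) ?_ ?_
  · rw [← mem_nonunits_iff, ← mem_maximalIdeal, ← residue_eq_zero_iff, map_sub, h, sub_self]
  · rw [derivative_sub, derivative_X_pow, derivative_X, eval_sub, eval_mul, eval_C, eval_one]
    by_contra h
    rw [← mem_nonunits_iff, ← mem_maximalIdeal, ← residue_eq_zero_iff, map_sub, map_mul,
      (residue_eq_zero_iff _).2 hq, zero_mul, map_one, zero_sub, neg_eq_zero] at h
    exact one_ne_zero h

theorem mem_teichmullerSet [Finite (ResidueField O)] (x : O) :
    x ∈ teichmullerSet O ↔ x ^ Nat.card (ResidueField O) = x := by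
  classical
  have hne : (X ^ Nat.card (ResidueField O) - X : O[X]) ≠ 0 :=
    (monic_X_pow_sub (by rw [degree_X]; exact_mod_cast Finite.one_lt_card)).ne_zero
  rw [teichmullerSet, Multiset.mem_toFinset, mem_roots hne, IsRoot.def, eval_sub, eval_pow, eval_X,
    sub_eq_zero]

/-- The Teichmüller lift in a ramified complete discrete valuation ring. -/
theorem exists_isTeichmullerLift (hπ : Irreducible π) (p : ℕ) [Fact p.Prime]
    [HenselianRing O (Ideal.span {(p : O)})] (hp0 : (p : O) ≠ 0) (hp : π ^ 2 ∣ (p : O))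
    [Finite (ResidueField O)] {f : ℕ} (hcard : Nat.card (ResidueField O) = p ^ f) :
    ∃ T : ResidueField O →* O, IsTeichmullerLift π T ∧
      ∀ x, x ∈ teichmullerSet O ↔ ∃ a, T a = x := by
  set q := Nat.card (ResidueField O) with hqdef
  have hq1 : 1 < q := Finite.one_lt_card
  have hf : f ≠ 0 := by
    rintro rfl
    rw [pow_zero] at hcard
    exact hq1.ne' hcard
  have hpq : (p : O) ∣ (q : O) := by
    rw [hcard, Nat.cast_pow]
    exact dvd_pow_self _ hf
  have hpm : (p : O) ∈ maximalIdeal O := by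
    rw [← residue_eq_zero_iff, residue_eq_zero_iff_dvd hπ]
    exact (dvd_pow_self π two_ne_zero).trans hp
  have hI : Ideal.span {(p : O)} ≤ maximalIdeal O := by
    rwa [Ideal.span_singleton_le_iff_mem]
  have hqI : (q : O) ∈ Ideal.span {(p : O)} := Ideal.mem_span_singleton.2 hpq
  obtain ⟨N, u, hu⟩ := IsDiscreteValuationRing.eq_unit_mul_pow_irreducible hp0 hπ
  have hN : π ^ (N + 1) ∈ Ideal.span {(p : O)} := by
    rw [Ideal.mem_span_singleton, hu, pow_succ]
    exact (u.isUnit.mul_left_dvd.2 dvd_rfl).mul_right _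
  have hex : ∀ a : ResidueField O, ∃ y : O, y ^ q = y ∧ residue O y = a := fun a => by
    obtain ⟨x, rfl⟩ := residue_surjective a
    exact exists_pow_eq_self_residue_eq hπ _ hI hN hqI x
  choose t ht htr using hex
  have huniq : ∀ x y : O, x ^ q = x → y ^ q = y → residue O x = residue O y → x = y :=
    fun x y => eq_of_pow_eq_self_of_residue_eq (hI hqI)
  let T : ResidueField O →* O :=
    { toFun := t
      map_one' := huniq _ _ (ht 1) (one_pow q) (by rw [htr, map_one])
      map_mul' := fun a b => huniq _ _ (ht _) (by rw [mul_pow, ht, ht])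
        (by rw [htr, map_mul, htr, htr]) }
  refine ⟨T, ⟨htr, fun a b => ?_⟩, fun x => ?_⟩
  -- The `q`-th power map is additive modulo `p`, and `p` is divisible by `π²`.
  · have hsum : (p : O) ∣ (t a + t b) ^ q - (t a ^ q + t b ^ q) := by
      rw [← Ideal.mem_span_singleton, ← Ideal.Quotient.eq_zero_iff_mem]
      have : CharP (O ⧸ Ideal.span {(p : O)}) p := CharP.quotient O p ((mem_maximalIdeal _).1 hpm)
      rw [map_sub, map_pow, map_add, map_add, map_pow, map_pow, hcard, add_pow_char_pow, sub_self]
    -- The elements `t a + t b` and `t (a + b)` agree modulo `π`, so their `q`-th powers agree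
    -- modulo `π²`; Teichmüller lifts are their own `q`-th powers.
    have hπ2 : π ^ 2 ∣ (t a + t b) ^ q - t (a + b) ^ q := by
      refine pow_dvd_pow_sub_pow (m := 0) hπ (((dvd_pow_self π two_ne_zero).trans hp).trans hpq) ?_
      rw [zero_add, pow_one, ← residue_eq_zero_iff_dvd hπ, map_sub, map_add, htr, htr, htr, sub_self]
    rw [ht] at hπ2
    rw [ht, ht] at hsum
    have := dvd_sub hπ2 (hp.trans hsum)
    rwa [show (t a + t b) ^ q - t (a + b) - ((t a + t b) ^ q - (t a + t b)) =
      t a + t b - t (a + b) by ring] at this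
  · rw [mem_teichmullerSet]
    exact ⟨fun hx => ⟨residue O x, huniq _ _ (ht _) hx (htr _)⟩, by rintro ⟨a, rfl⟩; exact ht a⟩

end Teichmuller

/-! ### Completeness, residue field and ramification of the ring of integers -/

section RingOfIntegers
open IsLocalRing

variable (p : ℕ) [Fact p.Prime] (F : Type*) [Field F] [Algebra ℚ_[p] F]
  [FiniteDimensional ℚ_[p] F] [Algebra ℤ_[p] F] [IsScalarTower ℤ_[p] ℚ_[p] F]

instance finite_integralClosure : Module.Finite ℤ_[p] (integralClosure ℤ_[p] F) :=
  IsIntegralClosure.finite ℤ_[p] ℚ_[p] F (integralClosure ℤ_[p] F)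

theorem map_maximalIdeal_padicInt : (maximalIdeal ℤ_[p]).map
    (algebraMap ℤ_[p] (integralClosure ℤ_[p] F)) =
      Ideal.span {(p : integralClosure ℤ_[p] F)} := by
  rw [PadicInt.maximalIdeal_eq_span_p, Ideal.map_span, Set.image_singleton, map_natCast]

/-- The ring of integers is finite over `ℤ_p`, hence `p`-adically complete, and completeness implies
the Henselian property. -/
instance henselianRing_integralClosure :
    HenselianRing (integralClosure ℤ_[p] F) (Ideal.span {(p : integralClosure ℤ_[p] F)}) := by
  have h := isAdicComplete_of_finite ℤ_[p] (integralClosure ℤ_[p] F)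
  rw [← IsAdicComplete.map_algebraMap_iff (S := integralClosure ℤ_[p] F),
    map_maximalIdeal_padicInt] at h
  infer_instance

theorem natCast_integralClosure_ne_zero : (p : integralClosure ℤ_[p] F) ≠ 0 := by
  intro h
  have h1 : algebraMap ℚ_[p] F p = 0 := by
    rw [map_natCast]
    simpa using congrArg Subtype.val h
  rw [map_eq_zero, Nat.cast_eq_zero] at h1
  exact (Fact.out : p.Prime).ne_zero h1

instance liesOver_maximalIdeal_integralClosure :
    (maximalIdeal (integralClosure ℤ_[p] F)).LiesOver (maximalIdeal ℤ_[p]) := by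
  refine ⟨?_⟩
  have : (Ideal.under ℤ_[p] (maximalIdeal (integralClosure ℤ_[p] F))).IsMaximal :=
    inferInstance
  exact (eq_maximalIdeal this).symm

instance finite_residueField_integralClosure :
    Finite (ResidueField (integralClosure ℤ_[p] F)) := by
  have h1 : Finite (ℤ_[p] ⧸ maximalIdeal ℤ_[p]) :=
    Finite.of_equiv _ (PadicInt.residueField (p := p)).symm.toEquiv
  exact Module.finite_of_finite (ℤ_[p] ⧸ maximalIdeal ℤ_[p])
    (M := integralClosure ℤ_[p] F ⧸ maximalIdeal (integralClosure ℤ_[p] F))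

theorem _root_.Ideal.natCard_quotient_eq_pow_inertiaDeg {R S : Type*} [CommRing R] [CommRing S]
    [Algebra R S] (P : Ideal R) (Q : Ideal S) [Q.LiesOver P] [P.IsMaximal] [Q.IsMaximal]
    [Module.Finite R S] : Nat.card (S ⧸ Q) = Nat.card (R ⧸ P) ^ Q.inertiaDeg R := by
  rw [Ideal.inertiaDeg_eq_of_isMaximal P]
  let : Field (R ⧸ P) := Ideal.Quotient.field P
  exact Module.natCard_eq_pow_finrank

theorem card_residueField_integralClosure :
    Nat.card (ResidueField (integralClosure ℤ_[p] F)) =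
      p ^ (maximalIdeal (integralClosure ℤ_[p] F)).inertiaDeg ℤ_[p] := by
  have h : Nat.card (ℤ_[p] ⧸ maximalIdeal ℤ_[p]) = p :=
    (Nat.card_congr (PadicInt.residueField (p := p)).toEquiv).trans (Nat.card_zmod p)
  exact (Ideal.natCard_quotient_eq_pow_inertiaDeg (maximalIdeal ℤ_[p])
    (maximalIdeal (integralClosure ℤ_[p] F))).trans (congrArg (· ^ _) h)

theorem sq_dvd_natCast_of_one_lt_ramificationIdx {π : integralClosure ℤ_[p] F}
    (hπ : Irreducible π)
    (he : 1 < (maximalIdeal (integralClosure ℤ_[p] F)).ramificationIdx ℤ_[p]) :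
    π ^ 2 ∣ (p : integralClosure ℤ_[p] F) := by
  have : Module.IsTorsionFree ℤ_[p] (integralClosure ℤ_[p] F) := by
    rw [Module.isTorsionFree_iff_algebraMap_injective]
    intro a b hab
    have : Function.Injective (algebraMap ℤ_[p] F) := by
      rw [IsScalarTower.algebraMap_eq ℤ_[p] ℚ_[p] F]
      exact (algebraMap ℚ_[p] F).injective.comp (IsFractionRing.injective ℤ_[p] ℚ_[p])
    exact this (congrArg Subtype.val hab)
  have hne : maximalIdeal ℤ_[p] ≠ ⊥ := IsDiscreteValuationRing.not_a_field _
  rw [← Ideal.ramificationIdx'_eq_ramificationIdx (maximalIdeal ℤ_[p]) _ hne] at he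
  have h := Ideal.le_pow_of_le_ramificationIdx' (Nat.succ_le_of_lt he)
  rw [map_maximalIdeal_padicInt, hπ.maximalIdeal_eq, Ideal.span_singleton_pow,
    Ideal.span_singleton_le_span_singleton] at h
  exact h

end RingOfIntegers
end GL2ModP

namespace GL2ModP

/-! ### The representation generated by the image of `t_n^k` -/

section Transport
variable {G E V S : Type*} [Group G] [Field E] [AddCommGroup V] [Module E V]
  [AddCommGroup S] [Module E S]

theorem isIrreducible_of_submodule {σ : Representation E G S} [Nontrivial S]
    (h : ∀ U : Submodule E S, (∀ g, ∀ u ∈ U, σ g u ∈ U) → U = ⊥ ∨ U = ⊤) : σ.IsIrreducible where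
  exists_pair_ne := by
    refine ⟨⊥, ⊤, fun h => ?_⟩
    exact bot_ne_top (congrArg Subrepresentation.toSubmodule h)
  eq_bot_or_eq_top X := by
    refine (h X.toSubmodule X.apply_mem_toSubmodule).imp (fun h => ?_) fun h => ?_ <;>
      exact Subrepresentation.toSubmodule_injective h

theorem isIrreducible_of_equiv {σ : Representation E G S} {ρ : Representation E G V}
    (e : ρ.Equiv σ) [Nontrivial S]
    (h : ∀ U : Submodule E S, (∀ g, ∀ u ∈ U, σ g u ∈ U) → U = ⊥ ∨ U = ⊤) : ρ.IsIrreducible := by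
  have : Nontrivial V := e.toLinearEquiv.toEquiv.nontrivial
  refine isIrreducible_of_submodule fun U hU => ?_
  have hmap := h (U.map e.toLinearEquiv.toLinearMap) ?_
  · exact hmap.imp (fun h => (Submodule.map_eq_bot_iff (e := e.toLinearEquiv)).1 h)
      fun h => (Submodule.map_eq_top_iff (e := e.toLinearEquiv)).1 h
  · rintro g _ ⟨u, hu, rfl⟩
    exact ⟨ρ g u, hU g u hu, LinearMap.congr_fun (e.isIntertwining' g) u⟩

/-- An injective equivariant map is an isomorphism onto its range. -/
theorem nonempty_equiv_of_range_eq {ρ : Representation E G V} {σ : Representation E G S}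
    (Φ : S →ₗ[E] V) (hΦ : ∀ g u, ρ g (Φ u) = Φ (σ g u)) (hinj : Function.Injective Φ)
    (W : Subrepresentation ρ) (hW : W.toSubmodule = LinearMap.range Φ) :
    Nonempty (W.toRepresentation.Equiv σ) := by
  let e : S ≃ₗ[E] W.toSubmodule :=
    (LinearEquiv.ofInjective Φ hinj).trans (LinearEquiv.ofEq _ _ hW.symm)
  have he : ∀ u, (e u : V) = Φ u := fun u => rfl
  refine ⟨Representation.Equiv.mk e.symm fun g => LinearMap.ext fun x => ?_⟩
  obtain ⟨u, rfl⟩ := e.surjective x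
  have h : W.toRepresentation g (e u) = e (σ g u) := Subtype.ext (hΦ g u)
  change e.symm (W.toRepresentation g (e u)) = σ g (e.symm (e u))
  rw [h, e.symm_apply_apply, e.symm_apply_apply]

/-- As `v ≠ 0`, the eigenvalues are uniquely determined and therefore multiplicative; a
multiplicative map from a group has values in the units. -/
theorem exists_character_of_forall_exists_smul (ρ : Representation E G V) (J : Subgroup G) {v : V}
    (hv : v ≠ 0) (h : ∀ g ∈ J, ∃ c : E, ρ g v = c • v) :
    ∃ χ : J →* Eˣ, ∀ g : J, ρ g v = (χ g : E) • v := by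
  choose c hc using fun g : J => h g g.2
  let χ : J →* E :=
    { toFun := c
      map_one' := smul_left_injective E hv (by
        change c 1 • v = (1 : E) • v
        rw [← hc, Subgroup.coe_one, map_one, one_smul, Module.End.one_apply])
      map_mul' := fun g g' => smul_left_injective E hv (by
        change c (g * g') • v = (c g * c g') • v
        rw [← hc, Subgroup.coe_mul, map_mul, Module.End.mul_apply, hc, map_smul, hc, smul_smul,
          mul_comm]) }
  exact ⟨χ.toHomUnits, fun g => hc g⟩

end Transport

section Generated
open IsLocalRing

variable {O : Type*} [CommRing O] [IsDomain O] [IsDiscreteValuationRing O]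
  {F : Type*} [Field F] [Algebra O F] [IsFractionRing O F]
  {E : Type*} [Field E] {p : ℕ} [CharP E p] [Fact p.Prime]
  [Algebra (ResidueField O) E] {f : ℕ}
  {π : O} (hπ : Irreducible π) {w : ℕ} {r : Fin f → ℕ}

theorem symEnd_symVec_zero_of_apply_eq_zero (g : Matrix (Fin 2) (Fin 2) E) (h10 : g 1 0 = 0) :
    symEnd E p r g (symVec E r 0 fun _ => Nat.zero_le _) =
      g 0 0 ^ digitSum p r • symVec E r 0 fun _ => Nat.zero_le _ := by
  have hp := (Fact.out : p.Prime).ne_zero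
  apply symType_ext
  simp only [map_smul, symVal_symEnd, symVal_symVec, map_prod, map_mul, map_pow, symSubst_X, h10]
  have hpow : g 0 0 ^ digitSum p r = ∏ j : Fin f, (g 0 0 ^ p ^ (j : ℕ)) ^ r j := by
    rw [digitSum, ← Finset.prod_pow_eq_pow_sum]
    exact Finset.prod_congr rfl fun j _ => by rw [← pow_mul, mul_comm]
  rw [hpow, MvPolynomial.smul_eq_C_mul, map_prod, ← Finset.prod_mul_distrib]
  refine Finset.prod_congr rfl fun j _ => ?_
  simp [hp, mul_pow]

theorem symRep_redGL_iwahori {κ : GL (Fin 2) O} (hκ : κ ∈ iwahori O) :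
    symRep E p w r (redGL O E κ) (symVec E r 0 fun _ => Nat.zero_le _) =
      ((resHom O E (κ 0 0) * resHom O E (κ 1 1)) ^ w * resHom O E (κ 0 0) ^ digitSum p r) •
        symVec E r 0 fun _ => Nat.zero_le _ := by
  have h10 : redGL O E κ 1 0 = 0 := by
    rw [coe_redGL, resHom, RingHom.comp_apply, show residue O (κ 1 0) = 0 from hκ, map_zero]
  change (redGL O E κ : Matrix (Fin 2) (Fin 2) E).det ^ w • symEnd E p r _ _ = _
  rw [symEnd_symVec_zero_of_apply_eq_zero _ h10, smul_smul, Matrix.det_fin_two, h10, mul_zero,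
    sub_zero]
  rfl

variable {k : Fin f → ℕ} {hk : k ≤ r}

theorem indModLower_centralG (n : ℤ)
    (x : compactIndSpace (weightKZ E p F hπ w r) ⧸ (lowerSpan F E p hπ w r k hk).toSubmodule) :
    indModLower F E p hπ w r k hk (centralG (unif F hπ ^ n)) x = x := by
  obtain ⟨φ, rfl⟩ := Submodule.Quotient.mk_surjective _ x
  exact congrArg Submodule.Quotient.mk (compactInd_centralG hπ w r n φ)

theorem indModLower_subgroupKZ {w' : ℕ} {r' : Fin f → ℕ} {Φ : SymType E r' →ₗ[E]
      compactIndSpace (weightKZ E p F hπ w r) ⧸ (lowerSpan F E p hπ w r k hk).toSubmodule}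
    (hΦ : ∀ κ u, indModLower F E p hπ w r k hk (toG O F κ) (Φ u) =
      Φ (symRep E p w' r' (redGL O E κ) u)) (g : subgroupKZ O F) (u : SymType E r') :
    indModLower F E p hπ w r k hk g (Φ u) = Φ (weightKZ E p F hπ w' r' g u) := by
  obtain ⟨κ, m, h⟩ := (mem_subgroupKZ_iff hπ _).1 g.2
  rw [weightKZ_apply hπ w' r' g m κ h, ← hΦ, h, map_mul, Module.End.mul_apply,
    indModLower_centralG]

variable [Fintype (ResidueField O)] {T : ResidueField O →* O}

theorem stable_eq_bot_or_eq_top (hT : IsTeichmullerLift π T)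
    (hq : Fintype.card (ResidueField O) = p ^ f) (hr : ∀ j, r j < p)
    (U : Submodule E (SymType E r)) (hU : ∀ g, ∀ u ∈ U, weightKZ E p F hπ w r g u ∈ U) :
    U = ⊥ ∨ U = ⊤ :=
  eq_bot_or_eq_top_of_redGL_stable hT hq hr w U fun κ u hu => by
    rw [← weightKZ_toG (F := F) hπ w r κ]
    exact hU _ u hu

/-- Properties of the image of `t_{n+1}^k` over any ramified discrete valuation ring that admits
Teichmüller lifts. -/
theorem tBar_properties [NeZero f] (hT : IsTeichmullerLift π T)
    (hTs : ∀ x, x ∈ teichmullerSet O ↔ ∃ a, T a = x)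
    (hq : Fintype.card (ResidueField O) = p ^ f) (hr : ∀ j, r j < p)
    (hk2 : ∀ j, 2 * k j < r j) (n : ℕ) :
    (∃ χ : inG F (iwahori O) →* Eˣ, ∀ g : inG F (iwahori O),
      indModLower F E p hπ w r k hk g (tBar F E p hπ w r k hk (n + 1)) =
        (χ g : E) • tBar F E p hπ w r k hk (n + 1)) ∧
    (∀ g ∈ inG F (iwahoriOne O), indModLower F E p hπ w r k hk g
      (tBar F E p hπ w r k hk (n + 1)) = tBar F E p hπ w r k hk (n + 1)) ∧
    (tBarKZ F E p hπ w r k hk (n + 1)).toRepresentation.IsIrreducible ∧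
    Nonempty ((tBarKZ F E p hπ w r k hk (n + 1)).toRepresentation.Equiv
      (weightKZ E p F hπ (w + digitSum p k) (subTwo r k))) := by
  have h0 := tBar_ne_zero (F := F) (E := E) (p := p) (w := w) hπ hT hTs hq hr hk hk2 n
  obtain ⟨Φ, hΦ, hΦ0⟩ := exists_equivariant_tBar (F := F) (E := E) (p := p) (w := w) hπ hT hTs hq
    hr hk hk2 n
  have hr' : ∀ j, subTwo r k j < p := fun j => (Nat.sub_le _ _).trans_lt (hr j)
  have hΦKZ := indModLower_subgroupKZ hπ hΦ
  -- The kernel is a stable subspace of an irreducible weight, and it is not everything because the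
  -- highest weight vector has nonzero image.
  have hinj : Function.Injective Φ := by
    rw [← LinearMap.ker_eq_bot]
    refine (stable_eq_bot_or_eq_top (F := F) (w := w + digitSum p k) hπ hT hq hr' (LinearMap.ker Φ)
      fun g u hu => ?_).resolve_right fun h => h0 ?_
    · rw [LinearMap.mem_ker] at hu ⊢
      rw [← hΦKZ, hu, map_zero]
    · rw [← hΦ0, LinearMap.ker_eq_top.1 h, LinearMap.zero_apply]
  -- The highest weight vector generates the weight, and its image generates the subrepresentation
  -- in question.
  have hrange : (tBarKZ F E p hπ w r k hk (n + 1)).toSubmodule = LinearMap.range Φ := by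
    refine le_antisymm (Submodule.span_le.2 ?_) ?_
    · rintro _ ⟨g, _, rfl, rfl⟩
      exact ⟨weightKZ E p F hπ _ _ g (symVec E (subTwo r k) 0 fun _ => Nat.zero_le _), by
        rw [← hΦKZ, hΦ0]; rfl⟩
    · rw [LinearMap.range_eq_map, Submodule.map_le_iff_le_comap, top_le_iff]
      refine eq_top_of_redGL_stable hT hq hr' (w + digitSum p k) _ ?_ fun κ u hu => ?_
      · rw [Submodule.mem_comap, hΦ0]
        exact Submodule.subset_span ⟨1, _, rfl, by rw [map_one]; rfl⟩
      · rw [Submodule.mem_comap, ← hΦ]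
        exact (tBarKZ F E p hπ w r k hk (n + 1)).apply_mem_toSubmodule
          ⟨toG O F κ, toG_mem_subgroupKZ κ⟩ hu
  have heigen : ∀ κ ∈ iwahori O, indModLower F E p hπ w r k hk (toG O F κ)
      (tBar F E p hπ w r k hk (n + 1)) =
        ((resHom O E (κ 0 0) * resHom O E (κ 1 1)) ^ (w + digitSum p k) *
          resHom O E (κ 0 0) ^ digitSum p (subTwo r k)) • tBar F E p hπ w r k hk (n + 1) :=
    fun κ hκ => by rw [← hΦ0, hΦ, symRep_redGL_iwahori hκ, map_smul]
  have hequiv := nonempty_equiv_of_range_eq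
    (ρ := (indModLower F E p hπ w r k hk).comp (subgroupKZ O F).subtype) Φ hΦKZ hinj _ hrange
  refine ⟨?_, ?_, ?_, hequiv⟩
  · refine exists_character_of_forall_exists_smul _ _ h0 ?_
    rintro _ ⟨κ, hκ, rfl⟩
    exact ⟨_, heigen κ hκ⟩
  · rintro _ ⟨κ, ⟨h10, h00, h11⟩, rfl⟩
    rw [heigen κ h10]
    simp only [resHom, RingHom.comp_apply, h00, h11, map_one, one_pow, mul_one, one_smul]
  · obtain ⟨e⟩ := hequiv
    have : Nontrivial (SymType E (subTwo r k)) :=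
      ⟨symVec E (subTwo r k) 0 fun _ => Nat.zero_le _, 0, fun h => h0 (by rw [← hΦ0, h, map_zero])⟩
    exact isIrreducible_of_equiv e (stable_eq_bot_or_eq_top hπ hT hq hr')

end Generated
end GL2ModP


/-! ### The theorem for a finite extension of `ℚ_p` -/

open GL2ModP IsLocalRing in
theorem proposition3p14 (p : ℕ) [Fact p.Prime]
    (F : Type*) [Field F] [Algebra ℚ_[p] F] [FiniteDimensional ℚ_[p] F]
    [Algebra ℤ_[p] F] [IsScalarTower ℤ_[p] ℚ_[p] F]
    (π : integralClosure ℤ_[p] F) (hπ : Irreducible π)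
    (E : Type*) [Field E] [CharP E p] [Algebra (ResidueField (integralClosure ℤ_[p] F)) E]
    [IsAlgClosure (ResidueField (integralClosure ℤ_[p] F)) E]
    (he : 1 < (maximalIdeal (integralClosure ℤ_[p] F)).ramificationIdx ℤ_[p])
    (f : ℕ) (hf : f = (maximalIdeal (integralClosure ℤ_[p] F)).inertiaDeg ℤ_[p])
    (w : ℕ) (r : Fin f → ℕ) (hr : ∀ j, 2 < r j ∧ r j + 3 < p)
    (k : Fin f → ℕ) (hk : ∀ j, k j ≤ r j / 2 - 1)
    (n : ℕ) (hn : 1 ≤ n) :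
    tBar F E p hπ w r k (le_of_le_half_sub_one hk) n ≠ 0 ∧
    (∃ χ : inG F (iwahori (integralClosure ℤ_[p] F)) →* Eˣ,
      ∀ g : inG F (iwahori (integralClosure ℤ_[p] F)),
        indModLower F E p hπ w r k (le_of_le_half_sub_one hk) g
            (tBar F E p hπ w r k (le_of_le_half_sub_one hk) n) =
          (χ g : E) • tBar F E p hπ w r k (le_of_le_half_sub_one hk) n) ∧
    (∀ g ∈ inG F (iwahoriOne (integralClosure ℤ_[p] F)),
      indModLower F E p hπ w r k (le_of_le_half_sub_one hk) g
          (tBar F E p hπ w r k (le_of_le_half_sub_one hk) n) =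
        tBar F E p hπ w r k (le_of_le_half_sub_one hk) n) ∧
    (tBarKZ F E p hπ w r k (le_of_le_half_sub_one hk) n).toRepresentation.IsIrreducible ∧
    Nonempty ((tBarKZ F E p hπ w r k (le_of_le_half_sub_one hk) n).toRepresentation.Equiv
      (weightKZ E p F hπ (w + ∑ j : Fin f, k j * p ^ (j : ℕ)) fun j => r j - 2 * k j)) := by

  have := Fintype.ofFinite (ResidueField (integralClosure ℤ_[p] F))
  have hcard := card_residueField_integralClosure p F
  -- With at least one factor, `2 k_j < r_j` makes the weight `r - 2k` nonzero, so its highest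
  -- weight vector vanishes at infinity.
  have : NeZero f := ⟨by
    rw [hf]
    exact (Ideal.inertiaDeg_pos _ _).ne'⟩
  rw [← hf] at hcard
  -- This is where `e > 1` enters: it gives `π² ∣ p`, hence additivity of Teichmüller lifts modulo
  -- `π²`.
  obtain ⟨T, hT, hTs⟩ := exists_isTeichmullerLift hπ p (natCast_integralClosure_ne_zero p F)
    (sq_dvd_natCast_of_one_lt_ramificationIdx p F hπ he) hcard
  rw [Nat.card_eq_fintype_card] at hcard
  have hr' : ∀ j, r j < p := fun j => by have := (hr j).2; lia
  -- From `r_j > 2` the truncated subtraction in `r j / 2 - 1` is a genuine one, so that `2 k_j ≤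
  -- r_j - 2`.
  have hk2 : ∀ j, 2 * k j < r j := fun j => by
    have := hk j
    have := (hr j).1
    lia
  obtain ⟨n, rfl⟩ := Nat.exists_eq_add_of_le' hn
  have h := tBar_properties (F := F) (E := E) (w := w) (hk := le_of_le_half_sub_one hk) hπ hT hTs
    hcard hr' hk2 n
  exact ⟨tBar_ne_zero hπ hT hTs hcard hr' _ hk2 n, h⟩
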